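/- **Definitions.** For a commutative cancellative monoid $H$ and $a\in H$, let $\mathsf L(a)\subset\mathbb N_0$ be the set of all $k$ such that $a$ is (up to a unit) a product of $k$ atoms. For $L\subset\mathbb N_0$ let $\Delta(L)$ be the set of all positive integers $d$ for which there is $a\in L$ with $L\cap[a,a+d]=\{a,a+d\}$, and let $\rho(L)=\sup (L\setminus\{0\})/\min (L\setminus\{0\})$, with $\rho(L)=1$ if $L\subset\{0\}$. Put $\Delta(H)=\bigcup_{a\in H}\Delta(\mathsf L(a))$ and $\rho(H)=\sup_{a\in H}\rho(\mathsf L(a))$. Let $[\![a]\!]$ be the smallest divisor-closed submonoid of $H$ containing $a$ (all divisors of powers of $a$), and $$\Delta^*_\rho(H)=\{\min\Delta([\![a]\!]) : a\in H,\ \rho(\mathsf L(a))=\rho(H)\}.$$ For a subset $G_0$ of a finite group $G$, let $\mathcal B(G_0)$ be the monoid of product-one sequences over $G_0$: finite multisets of elements of $G_0$ whose terms can be ordered so that their product is $1_G$, with multiset union (adding multiplicities) as operation. Write $\Delta(G_0)=\Delta(\mathcal B(G_0))$ and $\Delta^*_\rho(G)=\Delta^*_\rho(\mathcal B(G))$.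 If $\Delta(G_0)=\emptyset$, put $\min\Delta(G_0)=0$, so that such a $G_0$ is disregarded in a greatest common divisor. **Theorem 6.7.** Let $n\ge 3$ be odd and let $G=\langle\alpha,\tau : \alpha^n=\tau^2=1_G,\ \alpha\tau=\tau\alpha^{-1}\rangle$ be the dihedral group of order $2n$. 1. $\{1,2n-2\}\subset\Delta^*_\rho(G)$, and every $d\in\Delta^*_\rho(G)\setminus\{2n-2\}$ satisfies $d\le\max\{1,\frac{n-1}{4}\}$, with the single possible exception $d=2$ for $n=7$. 2. If there is $i\in[2,n-1]$ with $\gcd(i,n)=1$ such that $$\gcd\bigl(\min\Delta(\{\alpha,\alpha^i\}),\ \min\Delta(\{\alpha,\alpha^{1-i}\}),\ \min\Delta(\{\alpha^i,\alpha^{i-1}\})\bigr)\ \text{ is even,}\qquad(*)$$ then $\Delta^*_\rho(G)\supsetneq\{1,2n-2\}$. If $n=m^2-m+1$ for some odd $m\ge3$, then such an $i$ exists, and it can be chosen so that, moreover, the three sets of distances in $(*)$ are non-empty. -/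

import Mathlib

open scoped ENNReal

namespace ProductOne

/-! ### Arithmetic of monoids -/

/-- The set of distances of a set `A` of non-negative integers: all positive `d` such that
`A ∩ [a, a + d] = {a, a + d}` for some `a ∈ A`. -/
def distances (A : Set ℕ) : Set ℕ :=
  {d | 0 < d ∧ ∃ a ∈ A, A ∩ Set.Icc a (a + d) = {a, a + d}}

open Classical in
/-- The elasticity `sup (A ∩ ℕ₊) / min (A ∩ ℕ₊)` of a set `A` of non-negative integers,
with value `1` if `A` has no positive element. -/
noncomputable def elasticity (A : Set ℕ) : ℝ≥0∞ :=
  if {k ∈ A | 0 < k}.Nonempty then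
    (⨆ k ∈ {k ∈ A | 0 < k}, (k : ℝ≥0∞)) / ((sInf {k ∈ A | 0 < k} : ℕ) : ℝ≥0∞)
  else 1

section Monoid

variable {H : Type*} [CommMonoid H]

/-- The set of lengths `L(a)`: all `k` such that `a` is, up to a unit, a product of `k` atoms. -/
def lengthSet (a : H) : Set ℕ :=
  {k | ∃ z : Multiset H, (∀ u ∈ z, Irreducible u) ∧ Associated z.prod a ∧ z.card = k}

variable (H) in
/-- The set of distances `Δ(H)` of a monoid `H`: the union of the sets of distances of all
sets of lengths. -/
def distSet : Set ℕ := ⋃ a : H, distances (lengthSet a)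

variable (H) in
/-- The elasticity `ρ(H) = sup {ρ(L) : L a set of lengths of H}` of a monoid `H`. -/
noncomputable def monoidElasticity : ℝ≥0∞ := ⨆ a : H, elasticity (lengthSet a)

/-- The smallest divisor-closed submonoid of `H` containing `a`: all divisors of powers of `a`. -/
def divisorClosure (a : H) : Submonoid H where
  carrier := {b | ∃ k : ℕ, b ∣ a ^ k}
  one_mem' := ⟨0, one_dvd _⟩
  mul_mem' := by
    rintro x y ⟨k, hk⟩ ⟨l, hl⟩
    exact ⟨k + l, by rw [pow_add]; exact mul_dvd_mul hk hl⟩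

variable (H) in
/-- `Δ*_ρ(H)`: the minimal distances `min Δ(⟦a⟧)` of the divisor-closed submonoids `⟦a⟧`
generated by those `a ∈ H` whose set of lengths has the maximal elasticity `ρ(H)`. -/
def deltaStarRho : Set ℕ :=
  {d | ∃ a : H, elasticity (lengthSet a) = monoidElasticity H ∧
    IsLeast (distSet (divisorClosure a)) d}

end Monoid

/-! ### Product-one sequences -/

section Group

variable {G : Type*} [Group G]

/-- The monoid `B(G₀)` of product-one sequences over `G₀ ⊆ G`. A sequence is a finite multiset of
elements of `G₀`, it is a product-one sequence if its terms can be ordered such that their product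
is `1`, and the operation (written multiplicatively) is the union of multisets counting
multiplicities. -/
def productOneMonoid (G₀ : Set G) : Submonoid (Multiplicative (Multiset G)) where
  carrier := {S | (∀ g ∈ S.toAdd, g ∈ G₀) ∧ ∃ l : List G, (l : Multiset G) = S.toAdd ∧ l.prod = 1}
  one_mem' := ⟨by simp, [], by simp, by simp⟩
  mul_mem' := by
    rintro S T ⟨hS, l, hl, hl1⟩ ⟨hT, l', hl', hl'1⟩
    refine ⟨fun g hg => ?_, l ++ l', ?_, by simp [hl1, hl'1]⟩
    · rw [toAdd_mul, Multiset.mem_add] at hg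
      exact hg.elim (hS g) (hT g)
    · rw [← Multiset.coe_add, hl, hl', toAdd_mul]

/-- `Δ(G₀)`, the set of distances of the monoid of product-one sequences over `G₀`. -/
def groupDistSet (G₀ : Set G) : Set ℕ := distSet (productOneMonoid G₀)

/-- `min Δ(G₀)`. When there are no distances at all, the value is `0`, so that such a `G₀`
does not contribute to a greatest common divisor of minimal distances. -/
noncomputable def minDist (G₀ : Set G) : ℕ := sInf (groupDistSet G₀)

variable (G) in
/-- `Δ*_ρ(G)`, the set `Δ*_ρ` of the monoid of product-one sequences over the group `G`. -/
def groupDeltaStarRho : Set ℕ := deltaStarRho (productOneMonoid (Set.univ : Set G))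

/-- `gcd (min Δ({α, αⁱ}), min Δ({α, α¹⁻ⁱ}), min Δ({αⁱ, αⁱ⁻¹}))`. -/
noncomputable def gcdMinDist (α : G) (i : ℕ) : ℕ :=
  Nat.gcd (minDist {α, α ^ i})
    (Nat.gcd (minDist {α, α ^ (1 - (i : ℤ))}) (minDist {α ^ i, α ^ ((i : ℤ) - 1)}))

end Group

end ProductOne

/-!
Sequences are treated as multisets; `lengths S` is the set of lengths of `S` and `distOver G₀` the
set of distances over `G₀`. In a finite group every product-one sequence over the support of `S`
divides a power of `S`, so the divisor-closed submonoid generated by `S` consists of the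
product-one sequences over that support (`distSet_divisorClosure`). The minimum of a set of
distances divides all differences of lengths (`dvd_sub_of_isLeast`), so upper bounds for minimal
distances come from exhibiting relations between atoms, and lower bounds from a function on
sequences that is additive and constant on atoms modulo some number (`dvd_mul_sub_of_atoms`).

A sequence over the dihedral group has product one for some ordering if and only if its rotations
can be given signs, and its reflections be paired, such that a signed sum in `ZMod n` vanishes
(`isProdOne_signedSeq`, `exists_signedSeq`). In an atom the positive and the negative parts are
almost zero-sum free, hence short. Thus atoms have length at most `2 n`, and the zero-sum free
sequences of length `n - 1` being constant, the atoms of length `2 n` are `(r g) ^ (2 n - 2)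
(sr x) ^ 2` and `(sr x) ^ n (sr y) ^ n` (`IsMinProdOne.eq_of_card_eq`). The elasticity is therefore
`n`, and it is attained by exactly those sequences that are products of atoms of length `2 n` and
also products of atoms of length `2` (`exists_of_mem_lengths`).

If such a sequence involves an atom of the first kind, its minimal distance divides `2 n - 2` and
`n - 2`, so it is `1`. Otherwise the support consists of reflections. For two reflections the
minimal distance is `2 n - 2` (`eq_of_isLeast_sr_pair`). For three reflections `sr x`, `sr y`,
`sr z` with `z - x = k (y - x)`, the atoms `(sr x) ^ m (sr y) ^ m` and
`(sr x) ^ (k - 1) (sr y) ^ k (sr z)` multiply to squares, and a product of squares of reflections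
has the obvious factorization into atoms of length `2`. If all differences are units this gives
`d ∣ n - 1` and `d ∣ k - 1`. If `(n - 1) / d < 4`, few values of `k` remain, and permuting the
reflections turns `k` into `2` or `3`; only `n = 7`, `d = 2` survives. If a difference is not a
unit, comparing orders leaves three pairs `(n, d)`, which are excluded one by one
(`DvdLengths.bound_of_triple`).

For the second part, an atom over `sr 0`, `sr 1`, `sr i` different from a square has one of the
reflections as one half of its terms, and corresponds to an atom over two rotations
(`IsMinProdOne.card_eq_two_or`). If the distances over these pairs of rotations are even, such
atoms of rotations have odd length, so all atoms over the three reflections have length `2` modulo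
`4`, and all distances over them are even. As the minimal distance divides `2 (i - 1)`, it is
neither `1` nor `2 n - 2`. For `n = m ^ 2 - m + 1` the choice `i = m` works, because `m` is a
primitive sixth root of unity modulo `n`: the three pairs of rotations all have the form
`{r g, r (m g)}` with a unit `g`, and the atoms over such a pair can be listed.
-/

namespace ProductOne

/-! ### Product-one sequences as multisets -/

section General

variable {G : Type*} [Group G]

/-- A multiset over `G` is a product-one sequence if its terms can be ordered such that their
product is `1`. -/
def IsProdOne (S : Multiset G) : Prop := ∃ l : List G, (l : Multiset G) = S ∧ l.prod = 1

/-- A minimal product-one sequence: a nonempty product-one sequence that is not the union of two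
nonempty product-one sequences. These are the atoms of the monoid of product-one sequences. -/
def IsMinProdOne (S : Multiset G) : Prop :=
  IsProdOne S ∧ S ≠ 0 ∧ ∀ T U, IsProdOne T → IsProdOne U → S = T + U → T = 0 ∨ U = 0

/-- The set of lengths of a multiset `S`: all `k` such that `S` is a union of `k` minimal
product-one sequences. -/
def lengths (S : Multiset G) : Set ℕ :=
  {k | ∃ Z : Multiset (Multiset G), (∀ A ∈ Z, IsMinProdOne A) ∧ Z.sum = S ∧ Z.card = k}

/-- The set of distances of the product-one sequences over `G₀`, in terms of multisets. -/
def distOver (G₀ : Set G) : Set ℕ :=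
  {d | ∃ S : Multiset G, IsProdOne S ∧ (∀ g ∈ S, g ∈ G₀) ∧ d ∈ distances (lengths S)}

lemma isProdOne_zero : IsProdOne (0 : Multiset G) := ⟨[], rfl, rfl⟩

lemma IsProdOne.add {S T : Multiset G} (hS : IsProdOne S) (hT : IsProdOne T) :
    IsProdOne (S + T) := by
  obtain ⟨l, rfl, hl⟩ := hS
  obtain ⟨l', rfl, hl'⟩ := hT
  exact ⟨l ++ l', by simp, by simp [hl, hl']⟩

lemma IsProdOne.nsmul {S : Multiset G} (hS : IsProdOne S) (k : ℕ) : IsProdOne (k • S) := by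
  induction k with
  | zero => simpa using isProdOne_zero
  | succ k ih => rw [succ_nsmul]; exact ih.add hS

lemma IsProdOne.map_inv {S : Multiset G} (hS : IsProdOne S) : IsProdOne (S.map (·⁻¹)) := by
  obtain ⟨l, rfl, hl⟩ := hS
  refine ⟨(l.map (·⁻¹)).reverse, by simp, ?_⟩
  rw [← List.prod_inv_reverse, hl, inv_one]

lemma map_inv_map_inv (S : Multiset G) : (S.map (·⁻¹)).map (·⁻¹) = S := by
  simp [Multiset.map_map]

lemma IsMinProdOne.map_inv {S : Multiset G} (hS : IsMinProdOne S) :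
    IsMinProdOne (S.map (·⁻¹)) := by
  refine ⟨hS.1.map_inv, by simpa using hS.2.1, fun T U hT hU h => ?_⟩
  have := hS.2.2 _ _ hT.map_inv hU.map_inv
    (by rw [← Multiset.map_add, ← h, map_inv_map_inv])
  simpa using this

lemma isProdOne_replicate {g : G} {k : ℕ} (h : g ^ k = 1) :
    IsProdOne (Multiset.replicate k g) :=
  ⟨List.replicate k g, rfl, by simpa using h⟩

lemma isProdOne_pair (g : G) : IsProdOne ({g, g⁻¹} : Multiset G) :=
  ⟨[g, g⁻¹], rfl, by simp⟩

lemma isProdOne_add_map_inv (W : Multiset G) : IsProdOne (W + W.map (·⁻¹)) := by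
  induction W using Multiset.induction with
  | empty => simpa using isProdOne_zero
  | cons g W ih =>
    have e : W + W.map (·⁻¹) + {g, g⁻¹} = g ::ₘ W + (g ::ₘ W).map (·⁻¹) := by
      rw [Multiset.map_cons, Multiset.insert_eq_cons, ← Multiset.singleton_add g,
        ← Multiset.singleton_add g, ← Multiset.singleton_add g⁻¹]
      abel
    exact e ▸ ih.add (isProdOne_pair g)

lemma isProdOne_singleton {g : G} : IsProdOne ({g} : Multiset G) ↔ g = 1 := by
  refine ⟨?_, fun h => ⟨[g], rfl, by simpa using h⟩⟩
  rintro ⟨l, hl, h⟩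
  rw [Multiset.coe_eq_singleton] at hl
  simpa [hl] using h

lemma isMinProdOne_pair {g : G} (hg : g ≠ 1) : IsMinProdOne ({g, g⁻¹} : Multiset G) := by
  refine ⟨isProdOne_pair g, by simp, fun T U hT hU h => ?_⟩
  by_contra! hne
  have hc := congrArg Multiset.card h
  have h1 := Multiset.card_pos.2 hne.1
  have h2 := Multiset.card_pos.2 hne.2
  simp only [Multiset.insert_eq_cons, Multiset.card_cons, Multiset.card_singleton,
    Multiset.card_add] at hc
  obtain ⟨t, rfl⟩ := Multiset.card_eq_one.1 (by lia : T.card = 1)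
  have ht : t ∈ ({g, g⁻¹} : Multiset G) := by rw [h]; simp
  rw [isProdOne_singleton] at hT
  simp only [Multiset.insert_eq_cons, Multiset.mem_cons, Multiset.mem_singleton] at ht
  subst hT
  rcases ht with h | h
  · exact hg h.symm
  · exact hg (by simpa using h.symm)

lemma add_mem_lengths {S T : Multiset G} {k l : ℕ} (hk : k ∈ lengths S) (hl : l ∈ lengths T) :
    k + l ∈ lengths (S + T) := by
  obtain ⟨Z, hZ, rfl, rfl⟩ := hk
  obtain ⟨Z', hZ', rfl, rfl⟩ := hl
  exact ⟨Z + Z', fun A hA => (Multiset.mem_add.1 hA).elim (hZ A) (hZ' A), by simp, by simp⟩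

lemma zero_mem_lengths : 0 ∈ lengths (0 : Multiset G) := ⟨0, by simp⟩

lemma mul_mem_lengths_nsmul {S : Multiset G} {k : ℕ} (hk : k ∈ lengths S) (q : ℕ) :
    q * k ∈ lengths (q • S) := by
  induction q with
  | zero => simpa using zero_mem_lengths
  | succ q ih => rw [succ_nsmul, Nat.succ_mul]; exact add_mem_lengths ih hk

lemma IsMinProdOne.one_mem_lengths {S : Multiset G} (hS : IsMinProdOne S) : 1 ∈ lengths S :=
  ⟨{S}, by simpa using hS, by simp, by simp⟩

/-- Pairing every term with its inverse. -/
lemma card_mem_lengths_add_map_inv {W : Multiset G} (hW : ∀ g ∈ W, g ≠ 1) :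
    W.card ∈ lengths (W + W.map (·⁻¹)) := by
  induction W using Multiset.induction with
  | empty => simpa using zero_mem_lengths
  | cons g W ih =>
    have h := add_mem_lengths (ih fun x hx => hW x (by simp [hx]))
      (isMinProdOne_pair (hW g (by simp))).one_mem_lengths
    have e : W + W.map (·⁻¹) + {g, g⁻¹} = g ::ₘ W + (g ::ₘ W).map (·⁻¹) := by
      rw [Multiset.map_cons, Multiset.insert_eq_cons, ← Multiset.singleton_add g,
        ← Multiset.singleton_add g, ← Multiset.singleton_add g⁻¹]
      abel
    rw [e] at h
    simpa using h

lemma IsMinProdOne.two_mem_lengths {A : Multiset G} (hA : IsMinProdOne A) :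
    2 ∈ lengths (A + A.map (·⁻¹)) :=
  add_mem_lengths hA.one_mem_lengths hA.map_inv.one_mem_lengths

/-- An additive function that is constant modulo `N` on the atoms controls the differences of
lengths. -/
lemma dvd_mul_sub_of_atoms {G₀ : Set G} (w : Multiset G →+ ℤ) (e N : ℤ)
    (h : ∀ A, IsMinProdOne A → (∀ g ∈ A, g ∈ G₀) → N ∣ w A - e)
    {S : Multiset G} (hS : ∀ g ∈ S, g ∈ G₀) {k l : ℕ} (hk : k ∈ lengths S)
    (hl : l ∈ lengths S) : N ∣ e * ((k : ℤ) - l) := by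
  have key : ∀ k ∈ lengths S, N ∣ w S - e * k := by
    clear hk hl
    rintro _ ⟨Z, hZ, rfl, rfl⟩
    induction Z using Multiset.induction with
    | empty => simp
    | cons A Z ih =>
      rw [Multiset.sum_cons] at hS ⊢
      have h1 := h A (hZ A (by simp)) fun g hg => hS g (by simp [hg])
      have h2 := ih (fun B hB => hZ B (Multiset.mem_cons_of_mem hB))
        (fun g hg => hS g (Multiset.mem_add.2 (.inr hg)))
      obtain ⟨a, ha⟩ := h1
      obtain ⟨b, hb⟩ := h2
      refine ⟨a + b, ?_⟩
      rw [Multiset.card_cons, map_add]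
      push_cast
      linear_combination ha + hb
  obtain ⟨a, ha⟩ := key k hk
  obtain ⟨b, hb⟩ := key l hl
  exact ⟨b - a, by linear_combination hb - ha⟩

/-! ### Minimal distances divide all differences of lengths -/

lemma exists_mem_distances_le {L : Set ℕ} {k l : ℕ} (hk : k ∈ L) (hl : l ∈ L) (h : k < l) :
    ∃ d ∈ distances L, d ≤ l - k := by
  classical
  have hex : ∃ m, m ∈ L ∧ k < m := ⟨l, hl, h⟩
  obtain ⟨h1, h2⟩ := Nat.find_spec hex
  have h3 : Nat.find hex ≤ l := Nat.find_le ⟨hl, h⟩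
  refine ⟨Nat.find hex - k, ⟨by lia, k, hk, ?_⟩, by lia⟩
  have e : k + (Nat.find hex - k) = Nat.find hex := by lia
  rw [e]
  ext x
  simp only [Set.mem_inter_iff, Set.mem_Icc, Set.mem_insert_iff, Set.mem_singleton_iff]
  constructor
  · rintro ⟨hx, hkx, hx2⟩
    by_contra! hne
    exact Nat.find_min hex (lt_of_le_of_ne hx2 hne.2) ⟨hx, by lia⟩
  · rintro (rfl | rfl)
    · exact ⟨hk, le_rfl, h2.le⟩
    · exact ⟨h1, h2.le, le_rfl⟩

lemma exists_mem_of_mem_distances {L : Set ℕ} {d : ℕ} (hd : d ∈ distances L) :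
    ∃ a ∈ L, a + d ∈ L := by
  obtain ⟨-, a, ha, h⟩ := hd
  refine ⟨a, ha, ?_⟩
  have : a + d ∈ L ∩ Set.Icc a (a + d) := by rw [h]; simp
  exact this.1

lemma distOver_nonempty {G₀ : Set G} {S : Multiset G} (hS : IsProdOne S)
    (hS0 : ∀ g ∈ S, g ∈ G₀) {k l : ℕ} (hk : k ∈ lengths S) (hl : l ∈ lengths S) (hkl : k ≠ l) :
    (distOver G₀).Nonempty := by
  rcases lt_or_gt_of_ne hkl with h | h
  · obtain ⟨d, hd, -⟩ := exists_mem_distances_le hk hl h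
    exact ⟨d, S, hS, hS0, hd⟩
  · obtain ⟨d, hd, -⟩ := exists_mem_distances_le hl hk h
    exact ⟨d, S, hS, hS0, hd⟩

/-- If `e` did not divide a difference of lengths of `S`, then some power of a sequence realizing
the distance `e`, multiplied by `S`, would have two lengths at distance less than `e`. -/
lemma dvd_sub_of_isLeast {G₀ : Set G} {e : ℕ} (he : IsLeast (distOver G₀) e) {S : Multiset G}
    (hS : IsProdOne S) (hS0 : ∀ g ∈ S, g ∈ G₀) {k l : ℕ} (hk : k ∈ lengths S)
    (hl : l ∈ lengths S) : (e : ℤ) ∣ (k : ℤ) - l := by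
  wlog hkl : k ≤ l generalizing k l
  · rw [← dvd_neg, neg_sub]
    exact this hl hk (by lia)
  obtain ⟨T, hT, hT0, hd⟩ := he.1
  obtain ⟨t, ht, hte⟩ := exists_mem_of_mem_distances hd
  have hpos : 0 < e := hd.1
  have hdm := Nat.div_add_mod (l - k) e
  have hlt := Nat.mod_lt (l - k) hpos
  set q := (l - k) / e
  by_cases h0 : (l - k) % e = 0
  · rw [← dvd_neg, neg_sub]
    refine ⟨q, ?_⟩
    rw [← Nat.cast_sub hkl, ← hdm, h0]
    push_cast; ring
  exfalso
  have h1 := add_mem_lengths hl (mul_mem_lengths_nsmul ht q)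
  have h2 := add_mem_lengths hk (mul_mem_lengths_nsmul hte q)
  have e1 : q * (t + e) = q * t + e * q := by ring
  obtain ⟨d, hd1, hd2⟩ := exists_mem_distances_le h2 h1 (by rw [e1]; lia)
  have h3 := he.2 ⟨_, hS.add (hT.nsmul q), fun g hg => ?_, hd1⟩
  · rw [e1] at hd2; lia
  · rcases Multiset.mem_add.1 hg with h | h
    · exact hS0 g h
    · exact hT0 g (Multiset.mem_of_mem_nsmul h)

/-! ### Transfer to the monoids -/

section Transfer

variable {M : Type*} [CommMonoid M] {φ : M →* Multiplicative (Multiset G)}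

omit [Group G] in
lemma toAdd_eq_zero_iff (hinj : Function.Injective φ) (x : M) : (φ x).toAdd = 0 ↔ x = 1 := by
  rw [← hinj.eq_iff, map_one]
  rfl

omit [Group G] in
lemma isUnit_iff_toAdd (hinj : Function.Injective φ) (x : M) :
    IsUnit x ↔ (φ x).toAdd = 0 := by
  refine ⟨fun h => ?_, fun h => ?_⟩
  · obtain ⟨y, hy⟩ := h.exists_right_inv
    have := congrArg (fun z => (φ z).toAdd) hy
    simp only [map_mul, toAdd_mul, map_one, toAdd_one] at this
    exact (add_eq_zero.1 this).1
  · rw [(toAdd_eq_zero_iff hinj x).1 h]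
    exact isUnit_one

lemma irreducible_iff_isMinProdOne (hinj : Function.Injective φ) {G₀ : Set G}
    (hφ : ∀ S : Multiset G, (∃ x, (φ x).toAdd = S) ↔ IsProdOne S ∧ ∀ g ∈ S, g ∈ G₀) (x : M) :
    Irreducible x ↔ IsMinProdOne (φ x).toAdd := by
  have hx := (hφ _).1 ⟨x, rfl⟩
  rw [irreducible_iff, isUnit_iff_toAdd hinj]
  refine ⟨fun ⟨h1, h2⟩ => ⟨hx.1, h1, fun T U hT hU h => ?_⟩, fun ⟨_, h1, h2⟩ => ⟨h1, ?_⟩⟩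
  · obtain ⟨t, rfl⟩ := (hφ T).2 ⟨hT, fun g hg => hx.2 g (by rw [h]; simp [hg])⟩
    obtain ⟨u, rfl⟩ := (hφ U).2 ⟨hU, fun g hg => hx.2 g (by rw [h]; simp [hg])⟩
    rw [← toAdd_mul, ← map_mul, Equiv.apply_eq_iff_eq, hinj.eq_iff] at h
    simpa only [isUnit_iff_toAdd hinj] using h2 h
  · rintro a b rfl
    rw [isUnit_iff_toAdd hinj, isUnit_iff_toAdd hinj]
    exact h2 _ _ ((hφ _).1 ⟨a, rfl⟩).1 ((hφ _).1 ⟨b, rfl⟩).1 (by rw [map_mul, toAdd_mul])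

omit [Group G] in
lemma toAdd_map_prod (z : Multiset M) :
    (φ z.prod).toAdd = (z.map fun x => (φ x).toAdd).sum := by
  induction z using Multiset.induction with
  | empty => simp
  | cons a z ih => simp [ih]

/-- If `φ` identifies `M` with the product-one sequences over `G₀`, then `M` is reduced and its atoms
are the minimal product-one sequences over `G₀`. -/
lemma lengthSet_eq_lengths (hinj : Function.Injective φ) {G₀ : Set G}
    (hφ : ∀ S : Multiset G, (∃ x, (φ x).toAdd = S) ↔ IsProdOne S ∧ ∀ g ∈ S, g ∈ G₀) (x : M) :
    lengthSet x = lengths (φ x).toAdd := by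
  have hassoc : ∀ a b : M, Associated a b ↔ a = b := by
    refine fun a b => ⟨?_, fun h => h ▸ Associated.refl a⟩
    rintro ⟨u, rfl⟩
    rw [(toAdd_eq_zero_iff hinj (u : M)).1 ((isUnit_iff_toAdd hinj _).1 u.isUnit), mul_one]
  ext k
  constructor
  · rintro ⟨z, hz, h, rfl⟩
    rw [hassoc] at h
    refine ⟨z.map fun x => (φ x).toAdd, ?_, by rw [← toAdd_map_prod, h], by simp⟩
    intro A hA
    obtain ⟨u, hu, rfl⟩ := Multiset.mem_map.1 hA
    exact (irreducible_iff_isMinProdOne hinj hφ u).1 (hz u hu)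
  · rintro ⟨Z, hZ, h, rfl⟩
    have hx := (hφ _).1 ⟨x, rfl⟩
    have : ∀ Z : Multiset (Multiset G), (∀ A ∈ Z, IsMinProdOne A) → (∀ g ∈ Z.sum, g ∈ G₀) →
        ∃ z : Multiset M, z.map (fun x => (φ x).toAdd) = Z := by
      intro Z
      induction Z using Multiset.induction with
      | empty => exact fun _ _ => ⟨0, rfl⟩
      | cons A Z ih =>
        intro h1 h2
        rw [Multiset.sum_cons] at h2
        obtain ⟨z, hz⟩ := ih (fun B hB => h1 B (Multiset.mem_cons_of_mem hB))
          (fun g hg => h2 g (Multiset.mem_add.2 (.inr hg)))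
        obtain ⟨a, ha⟩ := (hφ A).2 ⟨(h1 A (by simp)).1, fun g hg => h2 g (by simp [hg])⟩
        exact ⟨a ::ₘ z, by simp [hz, ha]⟩
    obtain ⟨z, rfl⟩ := this Z hZ (by rw [h]; exact hx.2)
    refine ⟨z, fun u hu => (irreducible_iff_isMinProdOne hinj hφ u).2
      (hZ _ (Multiset.mem_map_of_mem _ hu)), ?_, by simp⟩
    rw [← toAdd_map_prod, Equiv.apply_eq_iff_eq, hinj.eq_iff] at h
    rw [h]

lemma distSet_eq_distOver (hinj : Function.Injective φ) {G₀ : Set G}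
    (hφ : ∀ S : Multiset G, (∃ x, (φ x).toAdd = S) ↔ IsProdOne S ∧ ∀ g ∈ S, g ∈ G₀) :
    distSet M = distOver G₀ := by
  ext d
  simp only [distSet, Set.mem_iUnion, lengthSet_eq_lengths hinj hφ]
  constructor
  · rintro ⟨x, hx⟩
    obtain ⟨h1, h2⟩ := (hφ _).1 ⟨x, rfl⟩
    exact ⟨_, h1, h2, hx⟩
  · rintro ⟨S, h1, h2, hd⟩
    obtain ⟨x, rfl⟩ := (hφ S).2 ⟨h1, h2⟩
    exact ⟨x, hd⟩

end Transfer

lemma range_subtype_productOneMonoid (G₀ : Set G) (S : Multiset G) :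
    (∃ x, ((productOneMonoid G₀).subtype x).toAdd = S) ↔ IsProdOne S ∧ ∀ g ∈ S, g ∈ G₀ := by
  constructor
  · rintro ⟨⟨x, h1, h2⟩, rfl⟩
    exact ⟨h2, h1⟩
  · rintro ⟨h1, h2⟩
    exact ⟨⟨Multiplicative.ofAdd S, h2, h1⟩, rfl⟩

lemma groupDistSet_eq_distOver (G₀ : Set G) : groupDistSet G₀ = distOver G₀ :=
  distSet_eq_distOver Subtype.val_injective (range_subtype_productOneMonoid G₀)

lemma lengthSet_eq_lengths_coe {G₀ : Set G} (x : productOneMonoid G₀) :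
    lengthSet x = lengths (Multiplicative.toAdd (x : Multiplicative (Multiset G))) :=
  lengthSet_eq_lengths Subtype.val_injective (range_subtype_productOneMonoid G₀) x

lemma minDist_dvd_sub {G₀ : Set G} {S : Multiset G} (hS : IsProdOne S)
    (hS0 : ∀ g ∈ S, g ∈ G₀) {k l : ℕ} (hk : k ∈ lengths S) (hl : l ∈ lengths S) :
    (minDist G₀ : ℤ) ∣ (k : ℤ) - l := by
  by_cases hkl : k = l
  · simp [hkl]
  have hne := distOver_nonempty hS hS0 hk hl hkl
  rw [minDist, groupDistSet_eq_distOver]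
  exact dvd_sub_of_isLeast ⟨Nat.sInf_mem hne, fun x hx => Nat.sInf_le hx⟩ hS hS0 hk hl

/-- Every product-one sequence over the support of `S` divides a power of `S`: if `m` annihilates
`G`, then the quotient is a product of a power of that sequence and of sequences `g ^ m`. -/
lemma exists_nsmul_eq_add [Finite G] {S T : Multiset G} (hT : IsProdOne T)
    (hTS : ∀ g ∈ T, g ∈ S) : ∃ (k : ℕ) (U : Multiset G), IsProdOne U ∧ k • S = T + U := by
  classical
  set m := Nat.card G with hm
  have hm0 : 0 < m := Nat.card_pos
  have hle : T ≤ T.card • S := by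
    rw [Multiset.le_iff_count]
    intro g
    rw [Multiset.count_nsmul]
    by_cases hg : g ∈ T
    · calc T.count g ≤ T.card := Multiset.count_le_card g T
        _ = T.card * 1 := (mul_one _).symm
        _ ≤ _ := Nat.mul_le_mul_left _ (Multiset.one_le_count_iff_mem.2 (hTS g hg))
    · rw [Multiset.count_eq_zero.2 hg]
      exact Nat.zero_le _
  obtain ⟨V, hV⟩ := Multiset.le_iff_exists_add.1 hle
  have hpow : ∀ V : Multiset G, IsProdOne (m • V) := by
    intro V
    induction V using Multiset.induction with
    | empty => simpa using isProdOne_zero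
    | cons g V ih =>
      rw [← Multiset.singleton_add, nsmul_add, Multiset.nsmul_singleton]
      exact (isProdOne_replicate (pow_card_eq_one' (x := g))).add ih
  refine ⟨m * T.card, (m - 1) • T + m • V, (hT.nsmul _).add (hpow V), ?_⟩
  rw [mul_nsmul', hV, nsmul_add, ← add_assoc, ← succ_nsmul', Nat.sub_add_cancel hm0]

/-- The divisor-closed submonoid generated by `a` is the monoid of product-one sequences over the
support of `a`. -/
lemma distSet_divisorClosure [Finite G] (a : productOneMonoid (Set.univ : Set G)) :
    distSet (divisorClosure a) =
      distOver {g | g ∈ Multiplicative.toAdd (a : Multiplicative (Multiset G))} := by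
  refine distSet_eq_distOver (φ := (productOneMonoid (Set.univ : Set G)).subtype.comp
    (divisorClosure a).subtype) (Subtype.val_injective.comp Subtype.val_injective) fun S => ?_
  constructor
  · rintro ⟨⟨⟨x, h1, h2⟩, k, ⟨y, hy⟩⟩, rfl⟩
    refine ⟨h2, fun g hg => ?_⟩
    have e := congrArg (fun z : productOneMonoid (Set.univ : Set G) =>
      Multiplicative.toAdd (z : Multiplicative (Multiset G))) hy
    simp only [SubmonoidClass.coe_pow, toAdd_pow, Submonoid.coe_mul, toAdd_mul] at e
    refine Multiset.mem_of_mem_nsmul (n := k) ?_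
    rw [e]
    exact Multiset.mem_add.2 (.inl hg)
  · rintro ⟨h1, h2⟩
    obtain ⟨k, U, hU, e⟩ := exists_nsmul_eq_add h1 h2
    refine ⟨⟨⟨Multiplicative.ofAdd S, fun _ _ => trivial, h1⟩, k,
      ⟨⟨Multiplicative.ofAdd U, fun _ _ => trivial, hU⟩, ?_⟩⟩, rfl⟩
    apply Subtype.ext
    simp only [SubmonoidClass.coe_pow, Submonoid.coe_mul, ← ofAdd_add, ← e, ofAdd_nsmul, ofAdd_toAdd]

end General

/-! ### Elasticity -/

lemma elasticity_le {L : Set ℕ} {n : ℕ} (hn : 1 ≤ n) (h : ∀ k ∈ L, ∀ l ∈ L, l ≤ n * k) :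
    elasticity L ≤ n := by
  classical
  unfold elasticity
  split_ifs with hne
  · have hm := Nat.sInf_mem hne
    refine ENNReal.div_le_of_le_mul (iSup₂_le fun l hl => ?_)
    exact_mod_cast h _ hm.1 l hl.1
  · exact_mod_cast hn

lemma le_elasticity {L : Set ℕ} {n k : ℕ} (hk : 0 < k) (hn : 0 < n) (h1 : k ∈ L)
    (h2 : n * k ∈ L) : (n : ℝ≥0∞) ≤ elasticity L := by
  classical
  have hne : {k ∈ L | 0 < k}.Nonempty := ⟨k, h1, hk⟩
  unfold elasticity
  rw [if_pos hne]
  have hm := Nat.sInf_mem hne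
  rw [ENNReal.le_div_iff_mul_le (.inl (by exact_mod_cast hm.2.ne')) (.inl (by simp))]
  refine le_trans ?_ (le_iSup₂ (f := fun (k : ℕ) (_ : k ∈ {k ∈ L | 0 < k}) => (k : ℝ≥0∞))
    (n * k) ⟨h2, Nat.mul_pos hn hk⟩)
  exact_mod_cast Nat.mul_le_mul_left n (Nat.sInf_le (s := {k ∈ L | 0 < k}) ⟨h1, hk⟩)

lemma exists_of_elasticity_eq {L : Set ℕ} {n : ℕ} (hn : 2 ≤ n)
    (h : ∀ k ∈ L, ∀ l ∈ L, l ≤ n * k) (he : elasticity L = n) :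
    ∃ k, 0 < k ∧ k ∈ L ∧ n * k ∈ L := by
  classical
  unfold elasticity at he
  split_ifs at he with hne
  · have hm := Nat.sInf_mem hne
    set m := sInf {k ∈ L | 0 < k}
    refine ⟨m, hm.2, hm.1, ?_⟩
    by_contra hcon
    have hpos : 0 < n * m := Nat.mul_pos (by lia) hm.2
    have hle : (⨆ k ∈ {k ∈ L | 0 < k}, (k : ℝ≥0∞)) ≤ ((n * m - 1 : ℕ) : ℝ≥0∞) := by
      refine iSup₂_le fun l hl => ?_
      have h1 := h m hm.1 l hl.1
      have h2 : l ≠ n * m := fun e => hcon (e ▸ hl.1)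
      exact_mod_cast (by lia : l ≤ n * m - 1)
    have h1 : (n : ℝ≥0∞) * m ≤ ((n * m - 1 : ℕ) : ℝ≥0∞) := by
      rw [← he]
      refine le_trans (le_of_eq ?_) hle
      exact ENNReal.div_mul_cancel (by exact_mod_cast hm.2.ne') (by simp)
    have h2 : n * m ≤ n * m - 1 := by exact_mod_cast h1
    lia
  · have : (1 : ℕ) = n := by exact_mod_cast he
    lia

/-! ### Zero-sum free multisets in cyclic groups -/

section ZeroSum

variable {A : Type*} [AddCommGroup A]

/-- A multiset over an abelian group is zero-sum free if none of its nonempty sub-multisets has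
sum zero. -/
def ZeroSumFree (Z : Multiset A) : Prop := ∀ T ≤ Z, T.sum = 0 → T = 0

lemma ZeroSumFree.mono {Z W : Multiset A} (hZ : ZeroSumFree Z) (h : W ≤ Z) : ZeroSumFree W :=
  fun T hT => hZ T (hT.trans h)

variable [DecidableEq A]

/-- The set of sums of all sub-multisets. -/
def subsums (Z : Multiset A) : Finset A := (Z.powerset.map Multiset.sum).toFinset

lemma mem_subsums {Z : Multiset A} {a : A} : a ∈ subsums Z ↔ ∃ T ≤ Z, T.sum = a := by
  simp [subsums]

/-- Otherwise the set of subsums of `Z` would be stable under adding `a`, and `0` would be `a` plus a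
subsum of `Z`. -/
lemma card_subsums_lt {Z : Multiset A} {a : A} (h : ZeroSumFree (a ::ₘ Z)) :
    (subsums Z).card < (subsums (a ::ₘ Z)).card := by
  have hsub : subsums Z ⊆ subsums (a ::ₘ Z) := fun x hx => by
    obtain ⟨T, hT, rfl⟩ := mem_subsums.1 hx
    exact mem_subsums.2 ⟨T, hT.trans (Multiset.le_cons_self _ _), rfl⟩
  by_contra! hcard
  have heq := Finset.eq_of_subset_of_card_le hsub hcard
  have himg : (subsums Z).image (a + ·) = subsums Z := by
    refine Finset.eq_of_subset_of_card_le ?_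
      (Finset.card_image_of_injective _ (add_right_injective a)).ge
    intro x hx
    obtain ⟨y, hy, rfl⟩ := Finset.mem_image.1 hx
    obtain ⟨T, hT, rfl⟩ := mem_subsums.1 hy
    rw [heq]
    exact mem_subsums.2 ⟨a ::ₘ T, Multiset.cons_le_cons _ hT, by simp⟩
  have h0 : (0 : A) ∈ (subsums Z).image (a + ·) := by
    rw [himg]
    exact mem_subsums.2 ⟨0, Multiset.zero_le _, rfl⟩
  obtain ⟨y, hy, hy0⟩ := Finset.mem_image.1 h0
  obtain ⟨T, hT, rfl⟩ := mem_subsums.1 hy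
  exact Multiset.cons_ne_zero (h (a ::ₘ T) (Multiset.cons_le_cons _ hT) (by simpa using hy0))

lemma card_subsums_add_card_le {W Z : Multiset A} (h : ZeroSumFree (W + Z)) :
    (subsums W).card + Z.card ≤ (subsums (W + Z)).card := by
  induction Z using Multiset.induction with
  | empty => simp
  | cons a Z ih =>
    rw [Multiset.add_cons] at h ⊢
    have h1 := ih (h.mono (Multiset.le_cons_self _ _))
    have h2 := card_subsums_lt h
    rw [Multiset.card_cons]
    lia

variable [Fintype A]

lemma ZeroSumFree.card_lt {Z : Multiset A} (h : ZeroSumFree Z) : Z.card < Fintype.card A := by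
  have h1 := card_subsums_add_card_le (W := 0) (Z := Z) (by simpa using h)
  have h2 : (subsums (0 : Multiset A)).card = 1 := by simp [subsums]
  have h3 := (subsums (0 + Z)).card_le_univ
  lia

/-- A zero-sum free multiset of maximal length is constant: two distinct terms `a`, `b` have the
four distinct subsums `0, a, b, a + b`, and each further term contributes a new one. -/
lemma ZeroSumFree.eq_of_mem {Z : Multiset A} (h : ZeroSumFree Z)
    (hc : Z.card + 1 = Fintype.card A) {a b : A} (ha : a ∈ Z) (hb : b ∈ Z) : a = b := by
  by_contra hab
  obtain ⟨Z', rfl⟩ := Multiset.exists_cons_of_mem ha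
  have hb' : b ∈ Z' := by
    rcases Multiset.mem_cons.1 hb with h | h
    · exact absurd h.symm hab
    · exact h
  obtain ⟨W, rfl⟩ := Multiset.exists_cons_of_mem hb'
  have e : a ::ₘ b ::ₘ W = (a ::ₘ b ::ₘ 0) + W := by simp
  have h0 : ∀ T ≤ a ::ₘ b ::ₘ (0 : Multiset A), T ≠ 0 → T.sum ≠ 0 := fun T hT hT0 hs =>
    hT0 (h T (hT.trans (by rw [e]; exact Multiset.le_add_right _ _)) hs)
  have ha0 : a ≠ 0 := by simpa using h0 {a} (by simp) (by simp)
  have hb0 : b ≠ 0 := by simpa using h0 {b} (by simp) (by simp)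
  have hab0 : a + b ≠ 0 := by simpa using h0 (a ::ₘ b ::ₘ 0) le_rfl (by simp)
  have h4 : ({0, a, b, a + b} : Finset A) ⊆ subsums (a ::ₘ b ::ₘ 0) := by
    intro x hx
    rw [mem_subsums]
    simp only [Finset.mem_insert, Finset.mem_singleton] at hx
    rcases hx with rfl | rfl | rfl | rfl
    · exact ⟨0, by simp, rfl⟩
    · exact ⟨{x}, by simp, by simp⟩
    · exact ⟨{x}, by simp, by simp⟩
    · exact ⟨_, le_rfl, by simp⟩
  have h5 : ({0, a, b, a + b} : Finset A).card = 4 := by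
    rw [Finset.card_insert_of_notMem, Finset.card_insert_of_notMem,
      Finset.card_insert_of_notMem, Finset.card_singleton]
    · simpa using ha0
    · simpa using ⟨hab, hb0⟩
    · simpa using ⟨ha0.symm, hb0.symm, hab0.symm⟩
  have h6 := Finset.card_le_card h4
  rw [e] at h hc
  have h7 := card_subsums_add_card_le h
  have h8 := (subsums ((a ::ₘ b ::ₘ 0) + W)).card_le_univ
  simp only [Multiset.card_add, Multiset.card_cons, Multiset.card_zero] at hc
  lia

end ZeroSum

/-- The multiples `x g` with `0 < x < n` are nonzero. -/
lemma ZeroSumFree.isUnit {n : ℕ} [NeZero n] {g : ZMod n}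
    (h : ZeroSumFree (Multiset.replicate (n - 1) g)) : IsUnit g := by
  have hinj : Function.Injective fun x : ZMod n => x * g := by
    rw [show (fun x : ZMod n => x * g) = AddMonoidHom.mulRight g from rfl,
      injective_iff_map_eq_zero]
    intro x hx
    have hlt := ZMod.val_lt x
    have := h (Multiset.replicate x.val g)
      (Multiset.replicate_mono g (by lia)) (by simpa using hx)
    have h0 := congrArg Multiset.card this
    simpa using h0
  obtain ⟨x, hx⟩ := Finite.injective_iff_surjective.1 hinj 1
  exact IsUnit.of_mul_eq_one x (by rw [mul_comm]; exact hx)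

lemma exists_map_eq_of_map_eq_add {α β : Type*} {f : α → β} {Q : Multiset α}
    {T U : Multiset β} (h : Q.map f = T + U) :
    ∃ Q₁ Q₂, Q = Q₁ + Q₂ ∧ Q₁.map f = T ∧ Q₂.map f = U := by
  classical
  induction T using Multiset.induction generalizing Q with
  | empty => exact ⟨0, Q, by simp, by simp, by simpa using h⟩
  | cons t T ih =>
    rw [Multiset.cons_add, ← Multiset.map_eq_cons] at h
    obtain ⟨a, ha, rfl, h⟩ := h
    obtain ⟨Q₁, Q₂, e, rfl, rfl⟩ := ih h
    exact ⟨a ::ₘ Q₁, Q₂, by rw [Multiset.cons_add, ← e, Multiset.cons_erase ha], by simp, rfl⟩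

lemma exists_add_of_le_add {α : Type*} {T A B : Multiset α} (h : T ≤ A + B) :
    ∃ T₁ T₂, T₁ ≤ A ∧ T₂ ≤ B ∧ T = T₁ + T₂ := by
  classical
  exact ⟨T ∩ A, T - A, Multiset.inter_le_right, tsub_le_iff_left.2 h,
    by rw [add_comm, Multiset.sub_add_inter]⟩

/-! ### Product-one sequences over dihedral groups -/

open DihedralGroup

section Dihedral

variable {n : ℕ}

/-- The sequence of rotations in `P` and `M` and of the reflections in the pairs of `Q`. -/
def signedSeq (P M : Multiset (ZMod n)) (Q : Multiset (ZMod n × ZMod n)) :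
    Multiset (DihedralGroup n) :=
  P.map r + M.map r + (Q.map (fun q => sr q.1) + Q.map fun q => sr q.2)

/-- The exponent of the product of `signedSeq P M Q`, ordered such that the rotations in `P` and
the first components of `Q` count positively, those in `M` and the second components negatively. -/
def signedSum (P M : Multiset (ZMod n)) (Q : Multiset (ZMod n × ZMod n)) : ZMod n :=
  P.sum - M.sum + (Q.map fun q => q.1 - q.2).sum

lemma signedSeq_add (P M P' M' : Multiset (ZMod n)) (Q Q' : Multiset (ZMod n × ZMod n)) :
    signedSeq (P + P') (M + M') (Q + Q') = signedSeq P M Q + signedSeq P' M' Q' := by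
  simp only [signedSeq, Multiset.map_add]
  abel

lemma signedSum_add (P M P' M' : Multiset (ZMod n)) (Q Q' : Multiset (ZMod n × ZMod n)) :
    signedSum (P + P') (M + M') (Q + Q') = signedSum P M Q + signedSum P' M' Q' := by
  simp only [signedSum, Multiset.map_add, Multiset.sum_add]
  ring

lemma signedSeq_swap (P M : Multiset (ZMod n)) (Q : Multiset (ZMod n × ZMod n)) :
    signedSeq M P (Q.map Prod.swap) = signedSeq P M Q := by
  simp only [signedSeq, Multiset.map_map, Function.comp_def, Prod.fst_swap, Prod.snd_swap]
  abel

lemma signedSum_swap (P M : Multiset (ZMod n)) (Q : Multiset (ZMod n × ZMod n)) :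
    signedSum M P (Q.map Prod.swap) = -signedSum P M Q := by
  have : (Q.map fun q => q.2 - q.1).sum = -(Q.map fun q => q.1 - q.2).sum := by
    rw [← Multiset.sum_map_neg']
    simp
  simp only [signedSum, Multiset.map_map, Function.comp_def, Prod.fst_swap, Prod.snd_swap, this]
  ring

lemma card_signedSeq (P M : Multiset (ZMod n)) (Q : Multiset (ZMod n × ZMod n)) :
    (signedSeq P M Q).card = P.card + M.card + 2 * Q.card := by
  simp only [signedSeq, Multiset.card_add, Multiset.card_map]
  ring

/-- A vanishing signed sum gives an ordering with product one: the rotations in `M` are placed between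
the two reflections of one pair, which inverts them. Hence `M` has to be empty if there is no pair. -/
lemma isProdOne_signedSeq {P M : Multiset (ZMod n)} {Q : Multiset (ZMod n × ZMod n)}
    (h : Q = 0 → M = 0) (hs : signedSum P M Q = 0) : IsProdOne (signedSeq P M Q) := by
  have hP : ∀ P : Multiset (ZMod n), ∃ l : List (DihedralGroup n),
      (l : Multiset (DihedralGroup n)) = P.map r ∧ l.prod = r P.sum := by
    intro P
    induction P using Multiset.induction with
    | empty => exact ⟨[], by simp, by simp⟩
    | cons a P ih =>
      obtain ⟨l, hl, hp⟩ := ih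
      exact ⟨r a :: l, by simp [← hl], by simp [hp]⟩
  have hQ : ∀ Q : Multiset (ZMod n × ZMod n), ∃ l : List (DihedralGroup n),
      (l : Multiset (DihedralGroup n)) = Q.map (fun q => sr q.1) + Q.map (fun q => sr q.2) ∧
        l.prod = r (Q.map fun q => q.1 - q.2).sum := by
    intro Q
    induction Q using Multiset.induction with
    | empty => exact ⟨[], by simp, by simp⟩
    | cons q Q ih =>
      obtain ⟨l, hl, hp⟩ := ih
      refine ⟨sr q.2 :: sr q.1 :: l, ?_, by
        rw [List.prod_cons, List.prod_cons, hp, ← mul_assoc, sr_mul_sr, r_mul_r,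
          Multiset.map_cons, Multiset.sum_cons]⟩
      rw [← Multiset.cons_coe, ← Multiset.cons_coe, hl]
      simp only [Multiset.map_cons]
      simp only [← Multiset.singleton_add]
      abel
  obtain ⟨l₁, h₁, hp₁⟩ := hP P
  rcases Multiset.empty_or_exists_mem Q with rfl | ⟨q, hq⟩
  · obtain rfl := h rfl
    refine ⟨l₁, by simp [signedSeq, h₁], ?_⟩
    have : P.sum = 0 := by simpa [signedSum] using hs
    rw [hp₁, this, one_def]
  · obtain ⟨Q', rfl⟩ := Multiset.exists_cons_of_mem hq
    obtain ⟨l₂, h₂, hp₂⟩ := hP M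
    obtain ⟨l₃, h₃, hp₃⟩ := hQ Q'
    refine ⟨l₁ ++ (sr q.2 :: (l₂ ++ (sr q.1 :: l₃))), ?_, ?_⟩
    · rw [← Multiset.coe_add, ← Multiset.cons_coe, ← Multiset.coe_add, ← Multiset.cons_coe, h₁,
        h₂, h₃, signedSeq]
      simp only [Multiset.map_cons]
      simp only [← Multiset.singleton_add]
      abel
    · simp only [List.prod_append, List.prod_cons, hp₁, hp₂, hp₃, sr_mul_r, r_mul_sr, r_mul_r,
        sr_mul_sr, one_def]
      rw [← hs, signedSum, Multiset.map_cons, Multiset.sum_cons]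
      congr 1
      ring

/-- Every product-one sequence is of the form `signedSeq P M Q` with vanishing signed sum. In an
ordering with product one, the sign of a rotation is the parity of the number of reflections on one
side of it, and every reflection is paired with a neighbouring one. -/
lemma exists_signedSeq {S : Multiset (DihedralGroup n)} (hS : IsProdOne S) :
    ∃ P M Q, (Q = 0 → M = 0) ∧ S = signedSeq P M Q ∧ signedSum P M Q = 0 := by
  have key : ∀ l : List (DihedralGroup n), ∃ (P M : Multiset (ZMod n))
      (Q : Multiset (ZMod n × ZMod n)), (l.prod = r (signedSum P M Q) ∧ (Q = 0 → M = 0) ∧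
        (l : Multiset (DihedralGroup n)) = signedSeq P M Q) ∨
      ∃ x, l.prod = sr (signedSum P M Q + x) ∧
        (l : Multiset (DihedralGroup n)) = sr x ::ₘ signedSeq P M Q := by
    intro l
    induction l with
    | nil => exact ⟨0, 0, 0, .inl ⟨by simp [signedSum], by simp, by simp [signedSeq]⟩⟩
    | cons g l ih =>
      obtain ⟨P, M, Q, ⟨hp, h0, hl⟩ | ⟨x, hp, hl⟩⟩ := ih
      · rcases g with i | i
        · refine ⟨i ::ₘ P, M, Q, .inl ⟨?_, h0, ?_⟩⟩
          · simp only [List.prod_cons, hp, r_mul_r, signedSum, Multiset.sum_cons]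
            congr 1; ring
          · rw [← Multiset.cons_coe, hl]
            simp [signedSeq]
        · refine ⟨P, M, Q, .inr ⟨i, ?_, ?_⟩⟩
          · simp only [List.prod_cons, hp, sr_mul_r]
            congr 1; ring
          · rw [← Multiset.cons_coe, hl]
      · rcases g with i | i
        · refine ⟨P, i ::ₘ M, Q, .inr ⟨x, ?_, ?_⟩⟩
          · simp only [List.prod_cons, hp, r_mul_sr, signedSum, Multiset.sum_cons]
            congr 1; ring
          · rw [← Multiset.cons_coe, hl]
            simp only [signedSeq, Multiset.map_cons]
            simp only [← Multiset.singleton_add]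
            abel
        · refine ⟨P, M, (x, i) ::ₘ Q, .inl ⟨?_, by simp, ?_⟩⟩
          · simp only [List.prod_cons, hp, sr_mul_sr, signedSum, Multiset.sum_cons,
              Multiset.map_cons]
            congr 1; ring
          · rw [← Multiset.cons_coe, hl]
            simp only [signedSeq, Multiset.map_cons]
            simp only [← Multiset.singleton_add]
            abel
  obtain ⟨l, rfl, hl⟩ := hS
  obtain ⟨P, M, Q, ⟨hp, h0, e⟩ | ⟨x, hp, -⟩⟩ := key l
  · rw [hl, one_def] at hp
    exact ⟨P, M, Q, h0, e, (r.inj hp).symm⟩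
  · rw [hl, one_def] at hp
    cases hp

/-- A zero-sum sub-multiset of the positive rotations and of the differences of all but one pair of
reflections splits off a product-one sequence; the remaining pair makes up for the signs. -/
lemma zeroSumFree_of_isMinProdOne {P M : Multiset (ZMod n)} {Q : Multiset (ZMod n × ZMod n)}
    {q : ZMod n × ZMod n} (hA : IsMinProdOne (signedSeq P M (q ::ₘ Q)))
    (hs : signedSum P M (q ::ₘ Q) = 0) :
    ZeroSumFree (P + Q.map fun q => q.1 - q.2) := by
  intro T hT hT0
  obtain ⟨P₁, W, hP₁, hW, e1⟩ := exists_add_of_le_add hT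
  obtain ⟨P₂, rfl⟩ := Multiset.le_iff_exists_add.1 hP₁
  obtain ⟨V, hV⟩ := Multiset.le_iff_exists_add.1 hW
  obtain ⟨Q₁, Q₂, rfl, hQ₁, -⟩ := exists_map_eq_of_map_eq_add hV
  have hs1 : signedSum P₁ 0 Q₁ = 0 := by
    rw [signedSum, hQ₁, Multiset.sum_zero, sub_zero, ← Multiset.sum_add, ← e1, hT0]
  have eQ : q ::ₘ (Q₁ + Q₂) = Q₁ + q ::ₘ Q₂ := by rw [Multiset.add_cons]
  have e2 := signedSeq_add P₁ 0 P₂ M Q₁ (q ::ₘ Q₂)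
  have e3 := signedSum_add P₁ 0 P₂ M Q₁ (q ::ₘ Q₂)
  rw [zero_add, ← eQ] at e2 e3
  rw [hs, hs1, zero_add] at e3
  rcases hA.2.2 _ _ (isProdOne_signedSeq (fun _ => rfl) hs1)
    (isProdOne_signedSeq (by simp) e3.symm) e2 with h | h
  · have h' := congrArg Multiset.card h
    simp only [card_signedSeq, Multiset.card_zero] at h'
    have hP0 : P₁ = 0 := Multiset.card_eq_zero.1 (by lia)
    have hQ0 : Q₁ = 0 := Multiset.card_eq_zero.1 (by lia)
    rw [e1, hP0, ← hQ₁, hQ0]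
    simp
  · have h' := congrArg Multiset.card h
    simp only [card_signedSeq, Multiset.card_zero, Multiset.card_cons] at h'
    lia

lemma zeroSumFree_neg_of_isMinProdOne {P M : Multiset (ZMod n)}
    {Q : Multiset (ZMod n × ZMod n)}
    {q : ZMod n × ZMod n} (hA : IsMinProdOne (signedSeq P M (q ::ₘ Q)))
    (hs : signedSum P M (q ::ₘ Q) = 0) :
    ZeroSumFree (M + Q.map fun q => q.2 - q.1) := by
  have e : (q ::ₘ Q).map Prod.swap = q.swap ::ₘ Q.map Prod.swap := Multiset.map_cons _ _ _
  rw [← signedSeq_swap, e] at hA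
  have := zeroSumFree_of_isMinProdOne hA (by rw [← e, signedSum_swap, hs, neg_zero])
  simpa [Multiset.map_map, Function.comp_def] using this

lemma zeroSumFree_of_isMinProdOne_map_r {P : Multiset (ZMod n)} {p : ZMod n}
    (hA : IsMinProdOne ((p ::ₘ P).map r)) (hs : (p ::ₘ P).sum = 0) : ZeroSumFree P := by
  intro T hT hT0
  obtain ⟨U, rfl⟩ := Multiset.le_iff_exists_add.1 hT
  have h1 : ∀ T : Multiset (ZMod n), T.sum = 0 → IsProdOne (T.map r) := fun T hT => by
    have := isProdOne_signedSeq (P := T) (M := 0) (Q := 0) (fun _ => rfl)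
      (by simpa [signedSum] using hT)
    simpa [signedSeq] using this
  have h2 : (p ::ₘ U).sum = 0 := by
    rw [← hs]
    simp [hT0]
  rcases hA.2.2 _ _ (h1 T hT0) (h1 _ h2)
    (by rw [← Multiset.map_add, Multiset.add_cons]) with h | h
  · simpa using h
  · simp at h

end Dihedral

/-! ### Minimal product-one sequences of maximal length -/

section LongAtoms

variable {n : ℕ}

lemma ZeroSumFree.card_lt_zmod [NeZero n] {Z : Multiset (ZMod n)} (h : ZeroSumFree Z) :
    Z.card < n := by
  simpa [ZMod.card] using h.card_lt

lemma ZeroSumFree.eq_replicate [NeZero n] {Z : Multiset (ZMod n)} (h : ZeroSumFree Z)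
    (hc : Z.card = n - 1) (hn : 2 ≤ n) :
    ∃ g, IsUnit g ∧ Z = Multiset.replicate (n - 1) g := by
  obtain ⟨g, hg⟩ := Multiset.card_pos_iff_exists_mem.1 (by lia : 0 < Z.card)
  have e : Z = Multiset.replicate (n - 1) g := Multiset.eq_replicate.2
    ⟨hc, fun b hb => h.eq_of_mem (by rw [ZMod.card]; lia) hb hg⟩
  exact ⟨g, (e ▸ h).isUnit, e⟩

/-- Either `A` consists of rotations, so that it has length at most `n`, or it contains a pair of
reflections. -/
lemma IsMinProdOne.exists_signedSeq [NeZero n] {A : Multiset (DihedralGroup n)}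
    (hA : IsMinProdOne A) :
    A.card ≤ n ∨ ∃ P M q Q, A = signedSeq P M (q ::ₘ Q) ∧ signedSum P M (q ::ₘ Q) = 0 := by
  obtain ⟨P, M, Q, h0, rfl, hs⟩ := ProductOne.exists_signedSeq hA.1
  rcases Multiset.empty_or_exists_mem Q with rfl | ⟨q, hq⟩
  · left
    obtain rfl := h0 rfl
    rcases Multiset.empty_or_exists_mem P with rfl | ⟨p, hp⟩
    · simp [card_signedSeq]
    · obtain ⟨P, rfl⟩ := Multiset.exists_cons_of_mem hp
      have e : signedSeq (p ::ₘ P) 0 0 = (p ::ₘ P).map r := by simp [signedSeq]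
      have := (zeroSumFree_of_isMinProdOne_map_r (e ▸ hA)
        (by simpa [signedSum] using hs)).card_lt_zmod
      rw [card_signedSeq, Multiset.card_cons, Multiset.card_zero, Multiset.card_zero]
      lia
  · right
    obtain ⟨Q, rfl⟩ := Multiset.exists_cons_of_mem hq
    exact ⟨P, M, q, Q, rfl, hs⟩

lemma IsMinProdOne.card_le [NeZero n] {A : Multiset (DihedralGroup n)} (hA : IsMinProdOne A) :
    A.card ≤ 2 * n := by
  rcases hA.exists_signedSeq with h | ⟨P, M, q, Q, rfl, hs⟩
  · lia
  have h1 := (zeroSumFree_of_isMinProdOne hA hs).card_lt_zmod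
  have h2 := (zeroSumFree_neg_of_isMinProdOne hA hs).card_lt_zmod
  rw [Multiset.card_add, Multiset.card_map] at h1 h2
  rw [card_signedSeq, Multiset.card_cons]
  lia

/-- In a minimal product-one sequence of `n` pairs of reflections all pairs are equal, since the
pairs have equal differences for each way of pairing the reflections. -/
lemma eq_of_isMinProdOne_pairs [NeZero n] (hn : 3 ≤ n) {Q : Multiset (ZMod n × ZMod n)}
    (hc : Q.card = n) (hA : IsMinProdOne (signedSeq 0 0 Q)) (hs : signedSum 0 0 Q = 0)
    {p q : ZMod n × ZMod n} (hp : p ∈ Q) (hq : q ∈ Q) : p = q := by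
  by_contra hpq
  obtain ⟨Q, rfl⟩ := Multiset.exists_cons_of_mem hp
  have hq' : q ∈ Q := by
    rcases Multiset.mem_cons.1 hq with h | h
    · exact absurd h.symm hpq
    · exact h
  obtain ⟨Q, rfl⟩ := Multiset.exists_cons_of_mem hq'
  rw [Multiset.card_cons, Multiset.card_cons] at hc
  obtain ⟨s, hs'⟩ := Multiset.card_pos_iff_exists_mem.1 (by lia : 0 < Q.card)
  obtain ⟨Q, rfl⟩ := Multiset.exists_cons_of_mem hs'
  rw [Multiset.card_cons] at hc
  have key : ∀ a b : ZMod n × ZMod n, IsMinProdOne (signedSeq 0 0 (a ::ₘ b ::ₘ s ::ₘ Q)) →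
      signedSum 0 0 (a ::ₘ b ::ₘ s ::ₘ Q) = 0 → b.1 - b.2 = s.1 - s.2 := by
    intro a b h1 h2
    have h3 := zeroSumFree_of_isMinProdOne h1 h2
    refine h3.eq_of_mem ?_ (by simp) (by simp)
    rw [zero_add, Multiset.card_map, Multiset.card_cons, Multiset.card_cons, ZMod.card]
    lia
  have e1 : ∀ a b c d : ZMod n, signedSeq 0 0 ((a, b) ::ₘ (c, d) ::ₘ s ::ₘ Q) =
      signedSeq 0 0 ((a, d) ::ₘ (c, b) ::ₘ s ::ₘ Q) := by
    intro a b c d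
    simp only [signedSeq, Multiset.map_cons]
    simp only [← Multiset.singleton_add]
    abel
  have e2 : ∀ a b c d : ZMod n, signedSum 0 0 ((a, b) ::ₘ (c, d) ::ₘ s ::ₘ Q) =
      signedSum 0 0 ((a, d) ::ₘ (c, b) ::ₘ s ::ₘ Q) := by
    intro a b c d
    simp only [signedSum, Multiset.map_cons, Multiset.sum_cons]
    ring
  obtain ⟨a, b⟩ := p
  obtain ⟨c, d⟩ := q
  have h1 := key _ _ hA hs
  have h2 := key _ _ (e1 _ _ _ _ ▸ hA) (e2 _ _ _ _ ▸ hs)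
  rw [Multiset.cons_swap] at hA hs
  have h3 := key _ _ hA hs
  simp only at h1 h2 h3
  have hb : b = d := by linear_combination h1 - h2
  have ha : a = c := by linear_combination h3 - h2
  exact hpq (by rw [ha, hb])

/-- If `g ≠ h`, write `g = -b h` with `1 ≤ b ≤ n - 2`. The rotation part splits off `g h ^ b`,
and the remaining terms still have product one after a change of signs: with `h = (i + 1) g`, let
one copy of `h` count positively and `i` copies of `g` negatively. -/
lemma not_isMinProdOne_of_ne [NeZero n] (hn : 3 ≤ n) {g h : ZMod n} (hg : IsUnit g)
    (hh : IsUnit h) (hgh : g ≠ h) {q : ZMod n × ZMod n} (hq : q.1 - q.2 = g - h) :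
    ¬ IsMinProdOne (signedSeq (Multiset.replicate (n - 1) g) (Multiset.replicate (n - 1) h)
      {q}) := by
  intro hA
  have : Fact (1 < n) := ⟨by lia⟩
  obtain ⟨u, rfl⟩ := hg
  obtain ⟨v, rfl⟩ := hh
  set b := (-(u : ZMod n) * ((v⁻¹ : (ZMod n)ˣ) : ZMod n)).val with hb
  set j := ((v : ZMod n) * ((u⁻¹ : (ZMod n)ˣ) : ZMod n)).val with hj
  have hb1 : (b : ZMod n) * v = -u := by
    rw [hb, ZMod.natCast_zmod_val, mul_assoc, Units.inv_mul, mul_one]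
  have hj1 : (j : ZMod n) * u = v := by
    rw [hj, ZMod.natCast_zmod_val, mul_assoc, Units.inv_mul, mul_one]
  have hbn : b < n := ZMod.val_lt _
  have hjn : j < n := ZMod.val_lt _
  have hj0 : j ≠ 0 := by
    intro h0
    rw [h0, Nat.cast_zero, zero_mul] at hj1
    exact v.ne_zero hj1.symm
  have hbn1 : b ≠ n - 1 := by
    intro h0
    rw [h0, Nat.cast_sub (by lia), ZMod.natCast_self] at hb1
    exact hgh (by push_cast at hb1; linear_combination hb1)
  clear_value j
  obtain ⟨i, rfl⟩ : ∃ i, j = i + 1 := ⟨j - 1, by lia⟩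
  have h1 : IsProdOne (signedSeq (Multiset.replicate 1 (u : ZMod n) + Multiset.replicate b (v : ZMod n))
      0 0) := by
    refine isProdOne_signedSeq (fun _ => rfl) ?_
    simp [signedSum, hb1]
  have h2 : IsProdOne (signedSeq
      (Multiset.replicate (n - 2 - i) (u : ZMod n) + Multiset.replicate 1 (v : ZMod n))
      (Multiset.replicate i (u : ZMod n) + Multiset.replicate (n - 2 - b) (v : ZMod n)) {q}) := by
    refine isProdOne_signedSeq (fun h => by simp at h) ?_
    simp only [signedSum, Multiset.sum_add, Multiset.sum_replicate, nsmul_eq_mul,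
      Multiset.map_singleton, Multiset.sum_singleton, hq]
    have e : ∀ a : ℕ, a ≤ n - 2 → ((n - 2 - a : ℕ) : ZMod n) = -2 - a := fun a ha => by
      rw [Nat.cast_sub ha, Nat.cast_sub (by lia), ZMod.natCast_self]
      push_cast
      ring
    rw [e i (by lia), e b (by lia)]
    push_cast at hj1 ⊢
    linear_combination hb1 - 2 * hj1
  have hadd := signedSeq_add (Multiset.replicate 1 (u : ZMod n) + Multiset.replicate b (v : ZMod n))
    0 (Multiset.replicate (n - 2 - i) (u : ZMod n) + Multiset.replicate 1 (v : ZMod n))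
    (Multiset.replicate i (u : ZMod n) + Multiset.replicate (n - 2 - b) (v : ZMod n)) 0 {q}
  rcases hA.2.2 _ _ h1 h2 (Eq.trans (by
    simp only [signedSeq, zero_add, ← Multiset.map_add]
    congr 2
    rw [← add_assoc, show n - 1 = 1 + (n - 2 - i) + i by lia, Multiset.replicate_add,
      Multiset.replicate_add, show 1 + (n - 2 - i) + i = b + 1 + (n - 2 - b) by lia,
      Multiset.replicate_add, Multiset.replicate_add]
    abel) hadd) with h | h
  · have := congrArg Multiset.card h
    simp [card_signedSeq] at this
  · have := congrArg Multiset.card h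
    simp [card_signedSeq] at this

/-- The minimal product-one sequences of maximal length `2 n`. -/
theorem IsMinProdOne.eq_of_card_eq [NeZero n] (hn : 3 ≤ n) {A : Multiset (DihedralGroup n)}
    (hA : IsMinProdOne A) (hc : A.card = 2 * n) :
    (∃ g x : ZMod n, IsUnit g ∧
      A = Multiset.replicate (2 * n - 2) (r g) + Multiset.replicate 2 (sr x)) ∨
    ∃ x y : ZMod n, IsUnit (x - y) ∧
      A = Multiset.replicate n (sr x) + Multiset.replicate n (sr y) := by
  rcases hA.exists_signedSeq with h | ⟨P, M, q, Q, rfl, hs⟩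
  · lia
  have hZ := zeroSumFree_of_isMinProdOne hA hs
  have hZ' := zeroSumFree_neg_of_isMinProdOne hA hs
  have h1 := hZ.card_lt_zmod
  have h2 := hZ'.card_lt_zmod
  rw [Multiset.card_add, Multiset.card_map] at h1 h2
  rw [card_signedSeq, Multiset.card_cons] at hc
  obtain ⟨g, hg, eg⟩ := hZ.eq_replicate (by rw [Multiset.card_add, Multiset.card_map]; lia)
    (by lia)
  obtain ⟨h, hh, eh⟩ := hZ'.eq_replicate (by rw [Multiset.card_add, Multiset.card_map]; lia)
    (by lia)
  have hP : ∀ p ∈ P, p = g := fun p hp =>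
    Multiset.eq_of_mem_replicate (eg ▸ Multiset.mem_add.2 (.inl hp))
  have hM : ∀ p ∈ M, p = h := fun p hp =>
    Multiset.eq_of_mem_replicate (eh ▸ Multiset.mem_add.2 (.inl hp))
  have hQ : ∀ p ∈ Q, p.1 - p.2 = g := fun p hp =>
    Multiset.eq_of_mem_replicate (eg ▸ Multiset.mem_add.2 (.inr (Multiset.mem_map_of_mem _ hp)))
  have hQ' : ∀ p ∈ Q, p.2 - p.1 = h := fun p hp =>
    Multiset.eq_of_mem_replicate (eh ▸ Multiset.mem_add.2
      (.inr (Multiset.mem_map_of_mem (fun p : ZMod n × ZMod n => p.2 - p.1) hp)))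
  have eP := Multiset.eq_replicate_card.2 hP
  have eM := Multiset.eq_replicate_card.2 hM
  rcases Nat.eq_zero_or_pos Q.card with hQ0 | hQ0
  · -- one pair of reflections
    left
    obtain rfl := Multiset.card_eq_zero.1 hQ0
    rw [show P.card = n - 1 by lia] at eP
    rw [show M.card = n - 1 by lia] at eM
    have hq : q.1 - q.2 = g - h := by
      simp only [signedSum, eP, eM, Multiset.sum_replicate, nsmul_eq_mul, Multiset.map_cons,
        Multiset.map_zero, Multiset.sum_cons, Multiset.sum_zero] at hs
      rw [Nat.cast_sub (by lia), ZMod.natCast_self] at hs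
      push_cast at hs
      linear_combination hs
    by_cases hgh : g = h
    · subst hgh
      rw [sub_self, sub_eq_zero] at hq
      refine ⟨g, q.1, hg, ?_⟩
      simp only [signedSeq, eP, eM, Multiset.map_replicate, Multiset.map_cons, Multiset.map_zero,
        ← hq, ← Multiset.replicate_add]
      congr 2
      lia
    · rw [eP, eM] at hA
      exact absurd hA (not_isMinProdOne_of_ne hn hg hh hgh hq)
  · obtain ⟨p, hp⟩ := Multiset.card_pos_iff_exists_mem.1 hQ0
    have hgh : h = -g := by rw [← hQ p hp, ← hQ' p hp]; ring
    by_cases hl : Q.card + 1 = n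
    · -- only reflections
      right
      obtain rfl := Multiset.card_eq_zero.1 (by lia : P.card = 0)
      obtain rfl := Multiset.card_eq_zero.1 (by lia : M.card = 0)
      have e : q ::ₘ Q = Multiset.replicate n p := Multiset.eq_replicate.2
        ⟨by rw [Multiset.card_cons, hl], fun s hs' => eq_of_isMinProdOne_pairs hn
          (by rw [Multiset.card_cons, hl]) hA hs hs' (Multiset.mem_cons_of_mem hp)⟩
      refine ⟨p.1, p.2, by rwa [hQ p hp], ?_⟩
      simp [e, signedSeq]
    · -- the signed sum is `-(Q.card + 1) g`, and `0 < Q.card + 1 < n`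
      exfalso
      obtain ⟨Q, rfl⟩ := Multiset.exists_cons_of_mem hp
      have hq : q.1 - q.2 = g := by
        rw [Multiset.cons_swap] at hA hs
        have h3 := zeroSumFree_of_isMinProdOne hA hs
        obtain ⟨a, ha⟩ := Multiset.card_pos_iff_exists_mem.1 (by lia : 0 < P.card)
        rw [← hP a ha]
        refine h3.eq_of_mem ?_ (by simp) (by simp [ha])
        rw [Multiset.card_cons] at hc
        rw [ZMod.card, Multiset.card_add, Multiset.card_map, Multiset.card_cons]
        rw [Multiset.card_cons] at h1 h2
        lia
      have e : ((q ::ₘ p ::ₘ Q).map fun q => q.1 - q.2) =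
          Multiset.replicate ((p ::ₘ Q).card + 1) g := by
        refine Multiset.eq_replicate.2 ⟨by simp, fun x hx => ?_⟩
        obtain ⟨s, hs', rfl⟩ := Multiset.mem_map.1 hx
        rcases Multiset.mem_cons.1 hs' with rfl | hs'
        · exact hq
        · exact hQ s hs'
      rw [signedSum, e, eP, eM, hgh] at hs
      simp only [Multiset.sum_replicate, nsmul_eq_mul] at hs
      have h4 : (P.card : ZMod n) + M.card + 2 * ((p ::ₘ Q).card + 1) = 0 := by
        have := congrArg (Nat.cast : ℕ → ZMod n) hc
        push_cast at this
        rw [ZMod.natCast_self] at this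
        linear_combination this
      have h5 : (((p ::ₘ Q).card + 1 : ℕ) : ZMod n) * g = 0 := by
        push_cast at hs ⊢
        linear_combination h4 * g - hs
      rw [hg.mul_left_eq_zero, ZMod.natCast_eq_zero_iff] at h5
      have := Nat.le_of_dvd (by lia) h5
      lia

end LongAtoms

/-! ### Some minimal product-one sequences -/

section Atoms

variable {n : ℕ}

lemma IsProdOne.exists_signedSeq_sr {T : Multiset (DihedralGroup n)} (hT : IsProdOne T)
    (hs : ∀ g ∈ T, ∃ i, g = sr i) : ∃ Q, T = signedSeq 0 0 Q ∧ signedSum 0 0 Q = 0 := by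
  obtain ⟨P, M, Q, -, rfl, hsum⟩ := exists_signedSeq hT
  have hr : ∀ a : ZMod n, (r a : DihedralGroup n) ∉ signedSeq P M Q := fun a ha => by
    obtain ⟨i, h⟩ := hs _ ha
    cases h
  obtain rfl : P = 0 := Multiset.eq_zero_of_forall_notMem fun a ha =>
    hr a (by simp [signedSeq, ha])
  obtain rfl : M = 0 := Multiset.eq_zero_of_forall_notMem fun a ha =>
    hr a (by simp [signedSeq, ha])
  exact ⟨Q, rfl, hsum⟩

/-- The multiplicities of a product-one sequence of reflections, with the signs of its terms in
an alternating product. -/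
lemma IsProdOne.exists_coeff {T : Multiset (DihedralGroup n)} (hT : IsProdOne T)
    (s : Finset (ZMod n)) (hs : ∀ g ∈ T, ∃ i ∈ s, g = sr i) :
    ∃ c : ZMod n → ℤ, (∀ i, |c i| ≤ T.count (sr i) ∧ 2 ∣ (T.count (sr i) : ℤ) - c i) ∧
      ∑ i ∈ s, c i = 0 ∧ ∑ i ∈ s, (c i : ZMod n) * i = 0 := by
  obtain ⟨Q, rfl, hsum⟩ := hT.exists_signedSeq_sr fun g hg => (hs g hg).imp fun _ h => h.2
  set X := Q.map Prod.fst with hX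
  set Y := Q.map Prod.snd with hY
  have hinj : Function.Injective (sr : ZMod n → DihedralGroup n) := fun a b h => sr.inj h
  have e : signedSeq 0 0 Q = X.map sr + Y.map sr := by
    simp [signedSeq, hX, hY, Multiset.map_map]
  have hcount : ∀ i, (signedSeq 0 0 Q).count (sr i) = X.count i + Y.count i := fun i => by
    rw [e, Multiset.count_add, Multiset.count_map_eq_count' _ _ hinj,
      Multiset.count_map_eq_count' _ _ hinj]
  have hXs : ∀ i ∈ X, i ∈ s := fun i hi => by
    obtain ⟨j, hj, h⟩ := hs (sr i) (by rw [e]; simp [hi])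
    exact sr.inj h ▸ hj
  have hYs : ∀ i ∈ Y, i ∈ s := fun i hi => by
    obtain ⟨j, hj, h⟩ := hs (sr i) (by rw [e]; simp [hi])
    exact sr.inj h ▸ hj
  refine ⟨fun i => X.count i - Y.count i, fun i => ?_, ?_, ?_⟩
  · rw [hcount]
    refine ⟨by rw [abs_le]; constructor <;> push_cast <;> lia, ?_⟩
    exact ⟨Y.count i, by push_cast; ring⟩
  · rw [Finset.sum_sub_distrib, ← Nat.cast_sum, ← Nat.cast_sum, Multiset.sum_count_eq_card hXs,
      Multiset.sum_count_eq_card hYs]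
    simp [hX, hY]
  · have h1 := Finset.sum_multiset_count_of_subset X s (fun i hi => hXs i (by simpa using hi))
    have h2 := Finset.sum_multiset_count_of_subset Y s (fun i hi => hYs i (by simpa using hi))
    simp only [nsmul_eq_mul] at h1 h2
    have h3 : X.sum - Y.sum = 0 := by
      rw [← hsum]
      simp [signedSum, hX, hY]
    rw [← h3, h1, h2, ← Finset.sum_sub_distrib]
    refine Finset.sum_congr rfl fun i _ => ?_
    push_cast
    ring

lemma IsProdOne.exists_coeff_pair {T : Multiset (DihedralGroup n)} (hT : IsProdOne T)
    {x y : ZMod n} (hxy : x ≠ y) (hs : ∀ g ∈ T, g = sr x ∨ g = sr y) :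
    ∃ c : ℤ, |c| ≤ T.count (sr x) ∧ |c| ≤ T.count (sr y) ∧
      2 ∣ (T.count (sr x) : ℤ) - c ∧ 2 ∣ (T.count (sr y) : ℤ) - c ∧
      (addOrderOf (x - y) : ℤ) ∣ c := by
  obtain ⟨c, h1, h2, h3⟩ := hT.exists_coeff {x, y} (by simpa using hs)
  rw [Finset.sum_pair hxy] at h2 h3
  have hy : c y = -c x := by lia
  have h4 := h1 y
  rw [hy, abs_neg] at h4
  refine ⟨c x, (h1 x).1, h4.1, (h1 x).2, by have := h4.2; lia, ?_⟩
  rw [addOrderOf_dvd_iff_zsmul_eq_zero, zsmul_eq_mul, ← h3, hy]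
  push_cast
  ring

lemma count_replicate_sr {x y : ZMod n} (h : x ≠ y) (k : ℕ) :
    (Multiset.replicate k (sr x : DihedralGroup n)).count (sr y) = 0 := by
  rw [Multiset.count_replicate, if_neg (by simpa using h)]

lemma isProdOne_sr_pair {x y : ZMod n} {m : ℕ} (h : (m : ZMod n) * (x - y) = 0) :
    IsProdOne (Multiset.replicate m (sr x : DihedralGroup n) + Multiset.replicate m (sr y)) := by
  have := isProdOne_signedSeq (n := n) (P := 0) (M := 0) (Q := Multiset.replicate m (x, y))
    (fun _ => rfl) (by simpa [signedSum] using h)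
  simpa [signedSeq] using this

lemma addOrderOf_dvd_zmod (x : ZMod n) : addOrderOf x ∣ n :=
  addOrderOf_dvd_of_nsmul_eq_zero (by simp)

/-- As `m = addOrderOf (x - y)` is odd, one of two complementary factors has odd multiplicities. Its
signed multiplicities are nonzero multiples of `m`, so it is everything. -/
lemma isMinProdOne_sr_pair [NeZero n] (hodd : Odd n) {x y : ZMod n} (hxy : x ≠ y) :
    IsMinProdOne (Multiset.replicate (addOrderOf (x - y)) (sr x : DihedralGroup n) +
      Multiset.replicate (addOrderOf (x - y)) (sr y)) := by
  set m := addOrderOf (x - y) with hm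
  have hm0 : 0 < m := addOrderOf_pos _
  have hmodd : Odd m := hodd.of_dvd_nat (addOrderOf_dvd_zmod _)
  refine ⟨isProdOne_sr_pair (by rw [← nsmul_eq_mul, hm, addOrderOf_nsmul_eq_zero]), ?_, ?_⟩
  · rw [← Multiset.card_pos]
    simp only [Multiset.card_add, Multiset.card_replicate]
    lia
  intro T U hT hU h
  have hmem : ∀ g ∈ T + U, g = sr x ∨ g = sr y := by
    rw [← h]
    intro g hg
    exact (Multiset.mem_add.1 hg).imp Multiset.eq_of_mem_replicate Multiset.eq_of_mem_replicate
  have hTm : ∀ g ∈ T, g = sr x ∨ g = sr y := fun g hg => hmem g (by simp [hg])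
  have hUm : ∀ g ∈ U, g = sr x ∨ g = sr y := fun g hg => hmem g (by simp [hg])
  have hx := congrArg (Multiset.count (sr x)) h
  have hy := congrArg (Multiset.count (sr y)) h
  rw [Multiset.count_add, Multiset.count_add, Multiset.count_replicate_self,
    count_replicate_sr hxy.symm] at hx
  rw [Multiset.count_add, Multiset.count_add, Multiset.count_replicate_self,
    count_replicate_sr hxy] at hy
  have hzero : ∀ T : Multiset (DihedralGroup n), (∀ g ∈ T, g = sr x ∨ g = sr y) →
      T.count (sr x) = 0 → T.count (sr y) = 0 → T = 0 := by
    refine fun T hT hx hy => Multiset.eq_zero_of_forall_notMem fun g hg => ?_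
    rcases hT g hg with rfl | rfl
    · exact Multiset.count_ne_zero.2 hg hx
    · exact Multiset.count_ne_zero.2 hg hy
  obtain ⟨c, a1, a2, a3, a4, a5⟩ := hT.exists_coeff_pair hxy hTm
  obtain ⟨d, b1, b2, b3, b4, b5⟩ := hU.exists_coeff_pair hxy hUm
  by_cases hc : c = 0
  · by_cases hd : d = 0
    · exfalso
      rw [Nat.odd_iff] at hmodd
      lia
    · left
      have := Int.le_of_dvd (abs_pos.2 hd) ((dvd_abs _ _).2 b5)
      exact hzero T hTm (by lia) (by lia)
  · right
    have := Int.le_of_dvd (abs_pos.2 hc) ((dvd_abs _ _).2 a5)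
    exact hzero U hUm (by lia) (by lia)

/-- The sequence `(sr x) ^ (k - 1) (sr y) ^ k (sr z)`. -/
def tripleSeq (x y z : ZMod n) (k : ℕ) : Multiset (DihedralGroup n) :=
  Multiset.replicate (k - 1) (sr x) + Multiset.replicate k (sr y) + {sr z}

lemma isMinProdOne_tripleSeq [NeZero n] (hodd : Odd n) {x y z : ZMod n} {k : ℕ}
    (hxy : IsUnit (y - x)) (hk2 : 2 ≤ k) (hkn : k < n) (hz : z - x = k * (y - x)) :
    IsMinProdOne (tripleSeq x y z k) := by
  have hn1 : Fact (1 < n) := ⟨by lia⟩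
  have hdvd : ∀ c : ℤ, (c : ZMod n) * (y - x) = 0 → (n : ℤ) ∣ c := fun c hc => by
    rwa [hxy.mul_left_eq_zero, ZMod.intCast_zmod_eq_zero_iff_dvd] at hc
  have hne : x ≠ y := by
    rintro rfl
    simp at hxy
  have hxz : x ≠ z := by
    rintro rfl
    have := hdvd k (by rw [Int.cast_natCast, ← hz, sub_self])
    have := Int.le_of_dvd (by lia) this
    lia
  have hyz : y ≠ z := by
    rintro rfl
    have := hdvd (k - 1) (by push_cast; rw [sub_mul, ← hz]; ring)
    have := Int.le_of_dvd (by lia) this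
    lia
  refine ⟨?_, by simp [tripleSeq], ?_⟩
  · have := isProdOne_signedSeq (n := n) (P := 0) (M := 0)
      (Q := Multiset.replicate (k - 1) (x, y) + {(z, y)}) (fun _ => rfl) ?_
    · convert this using 1
      simp only [signedSeq, tripleSeq, Multiset.map_add, Multiset.map_replicate,
        Multiset.map_singleton, Multiset.map_zero, zero_add]
      rw [show Multiset.replicate k (sr y : DihedralGroup n) =
        Multiset.replicate (k - 1) (sr y) + Multiset.replicate 1 (sr y) by
          rw [← Multiset.replicate_add]; congr 1; lia, Multiset.replicate_one]
      abel
    · simp only [signedSum, Multiset.map_add, Multiset.map_replicate, Multiset.map_singleton,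
        Multiset.sum_add, Multiset.sum_replicate, Multiset.sum_singleton, nsmul_eq_mul,
        Multiset.sum_zero]
      rw [Nat.cast_sub (by lia)]
      push_cast
      linear_combination hz
  have hcx : (tripleSeq x y z k).count (sr x) = k - 1 := by
    simp [tripleSeq, Multiset.count_replicate, hne.symm, hxz]
  have hcy : (tripleSeq x y z k).count (sr y) = k := by
    simp [tripleSeq, Multiset.count_replicate, hne, hyz]
  have hcz : (tripleSeq x y z k).count (sr z) = 1 := by
    simp [tripleSeq, Multiset.count_replicate, hxz, hyz]
  have hmem : ∀ g ∈ tripleSeq x y z k, ∃ i ∈ ({x, y, z} : Finset (ZMod n)), g = sr i := by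
    intro g hg
    simp only [tripleSeq, Multiset.mem_add, Multiset.mem_replicate,
      Multiset.mem_singleton] at hg
    rcases hg with (⟨-, rfl⟩ | ⟨-, rfl⟩) | rfl <;> exact ⟨_, by simp, rfl⟩
  -- In a factor `U` without `sr z` all signed multiplicities vanish, so its multiplicities are even.
  -- For the other factor the bounds on the signed multiplicities then leave nothing for `U`.
  have key : ∀ T U, IsProdOne T → IsProdOne U → tripleSeq x y z k = T + U →
      U.count (sr z) = 0 → U = 0 := by
    intro T U hT hU h hUz
    have hx := congrArg (Multiset.count (sr x)) h
    have hy := congrArg (Multiset.count (sr y)) h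
    have hz' := congrArg (Multiset.count (sr z)) h
    rw [Multiset.count_add] at hx hy hz'
    rw [hcx] at hx
    rw [hcy] at hy
    rw [hcz] at hz'
    obtain ⟨c, c1, c2, c3⟩ := hT.exists_coeff {x, y, z}
      fun g hg => hmem g (by rw [h]; simp [hg])
    obtain ⟨d, d1, d2, d3⟩ := hU.exists_coeff {x, y, z}
      fun g hg => hmem g (by rw [h]; simp [hg])
    rw [Finset.sum_insert (by simp [hne, hxz]), Finset.sum_pair hyz] at c2 c3 d2 d3
    have c4 := hdvd (c y + k * c z) (by
      have := congrArg (Int.cast : ℤ → ZMod n) c2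
      push_cast at this ⊢
      linear_combination c3 - x * this - (c z : ZMod n) * hz)
    have d4 := hdvd (d y + k * d z) (by
      have := congrArg (Int.cast : ℤ → ZMod n) d2
      push_cast at this ⊢
      linear_combination d3 - x * this - (d z : ZMod n) * hz)
    obtain ⟨cx1, cx2⟩ := c1 x
    obtain ⟨cy1, cy2⟩ := c1 y
    obtain ⟨cz1, cz2⟩ := c1 z
    obtain ⟨dx1, dx2⟩ := d1 x
    obtain ⟨dy1, dy2⟩ := d1 y
    obtain ⟨dz1, dz2⟩ := d1 z
    rw [abs_le] at cx1 cy1 cz1 dx1 dy1 dz1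
    have hdz : d z = 0 := by lia
    rw [hdz, mul_zero, add_zero] at d4
    have hdx : |d y| < n := by rw [abs_lt]; constructor <;> lia
    have hdy : d y = 0 := Int.eq_zero_of_abs_lt_dvd d4 hdx
    obtain ⟨t, ht⟩ := c4
    obtain ⟨w, hw⟩ := hodd
    have hcz' : c z = 1 ∨ c z = -1 := by lia
    have hall : U.count (sr x) = 0 ∧ U.count (sr y) = 0 := by
      rcases hcz' with e | e
      · rw [e, mul_one] at ht
        have ht0 : 0 ≤ t := by
          by_contra! hlt
          have : (n : ℤ) * t ≤ n * (-1) := mul_le_mul_of_nonneg_left (by lia) (by lia)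
          lia
        have ht2 : t < 2 := by
          by_contra! hlt
          have : (n : ℤ) * 2 ≤ n * t := mul_le_mul_of_nonneg_left (by lia) (by lia)
          lia
        interval_cases t <;> lia
      · rw [e, mul_neg, mul_one] at ht
        have ht0 : t ≤ 0 := by
          by_contra! hlt
          have : (n : ℤ) * 1 ≤ n * t := mul_le_mul_of_nonneg_left (by lia) (by lia)
          lia
        have ht2 : -2 < t := by
          by_contra! hlt
          have : (n : ℤ) * t ≤ n * (-2) := mul_le_mul_of_nonneg_left (by lia) (by lia)
          lia
        interval_cases t <;> lia
    refine Multiset.eq_zero_of_forall_notMem fun g hg => ?_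
    obtain ⟨i, hi, rfl⟩ := hmem g (by rw [h]; simp [hg])
    simp only [Finset.mem_insert, Finset.mem_singleton] at hi
    have := Multiset.count_ne_zero.2 hg
    rcases hi with rfl | rfl | rfl
    · exact this hall.1
    · exact this hall.2
    · exact this hUz
  intro T U hT hU h
  have hz' := congrArg (Multiset.count (sr z)) h
  rw [hcz, Multiset.count_add] at hz'
  rcases Nat.eq_zero_or_pos (U.count (sr z)) with h0 | h0
  · exact .inr (key T U hT hU h h0)
  · exact .inl (key U T hU hT (by rw [h, add_comm]) (by lia))

/-- Without reflections all signs are positive. -/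
lemma isProdOne_map_r_iff {P : Multiset (ZMod n)} :
    IsProdOne (P.map (r : ZMod n → DihedralGroup n)) ↔ P.sum = 0 := by
  constructor
  · intro h
    obtain ⟨P', M, Q, h0, e, hs⟩ := exists_signedSeq h
    have hQ : Q = 0 := Multiset.eq_zero_of_forall_notMem fun q hq => by
      have : (sr q.1 : DihedralGroup n) ∈ P.map r := by
        rw [e, signedSeq]
        simp only [Multiset.mem_add]
        exact .inr (.inl (Multiset.mem_map_of_mem (fun q : ZMod n × ZMod n => sr q.1) hq))
      simp at this
    obtain rfl := h0 hQ
    subst hQ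
    have e' : P.map (r : ZMod n → DihedralGroup n) = P'.map r := by simpa [signedSeq] using e
    have hinj : Function.Injective (r : ZMod n → DihedralGroup n) := fun a b h => r.inj h
    rw [Multiset.map_injective hinj e']
    simpa [signedSum] using hs
  · intro h
    have := isProdOne_signedSeq (P := P) (M := 0) (Q := 0) (fun _ => rfl)
      (by simpa [signedSum] using h)
    simpa [signedSeq] using this

lemma isProdOne_r_pair_iff {g h : ZMod n} {u v : ℕ} :
    IsProdOne (Multiset.replicate u (r g : DihedralGroup n) + Multiset.replicate v (r h)) ↔
      (u : ZMod n) * g + v * h = 0 := by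
  have := isProdOne_map_r_iff (n := n) (P := Multiset.replicate u g + Multiset.replicate v h)
  simpa using this

/-- Sub-multisets of a multiset with at most two distinct terms. -/
lemma exists_replicate_of_add_eq {α : Type*} {a b : α} {u v : ℕ} {T U : Multiset α}
    (h : Multiset.replicate u a + Multiset.replicate v b = T + U) :
    ∃ u₁ v₁ u₂ v₂, u₁ + u₂ = u ∧ v₁ + v₂ = v ∧
      T = Multiset.replicate u₁ a + Multiset.replicate v₁ b ∧
      U = Multiset.replicate u₂ a + Multiset.replicate v₂ b := by
  classical
  obtain ⟨T₁, T₂, h1, h2, rfl⟩ := exists_add_of_le_add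
    (show T ≤ Multiset.replicate u a + Multiset.replicate v b by rw [h]; exact le_self_add)
  obtain ⟨u₁, hu, rfl⟩ := Multiset.le_replicate_iff.1 h1
  obtain ⟨v₁, hv, rfl⟩ := Multiset.le_replicate_iff.1 h2
  refine ⟨u₁, v₁, u - u₁, v - v₁, by lia, by lia, rfl, ?_⟩
  refine add_left_cancel (h.symm.trans ?_)
  rw [show Multiset.replicate u a = Multiset.replicate u₁ a + Multiset.replicate (u - u₁) a by
      rw [← Multiset.replicate_add]; congr 1; lia,
    show Multiset.replicate v b = Multiset.replicate v₁ b + Multiset.replicate (v - v₁) b by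
      rw [← Multiset.replicate_add]; congr 1; lia]
  abel

lemma isMinProdOne_replicate_r [NeZero n] (g : ZMod n) :
    IsMinProdOne (Multiset.replicate (addOrderOf g) (r g : DihedralGroup n)) := by
  have hm : 0 < addOrderOf g := addOrderOf_pos g
  have h1 : ∀ m : ℕ, IsProdOne (Multiset.replicate m (r g : DihedralGroup n)) ↔
      addOrderOf g ∣ m := fun m => by
    have := isProdOne_r_pair_iff (n := n) (g := g) (h := 0) (u := m) (v := 0)
    rw [addOrderOf_dvd_iff_nsmul_eq_zero, nsmul_eq_mul]
    simpa using this
  refine ⟨(h1 _).2 dvd_rfl, by rw [← Multiset.card_pos]; simpa using hm, ?_⟩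
  intro T U hT hU h
  obtain ⟨u₁, v₁, u₂, v₂, hu, hv, rfl, rfl⟩ := exists_replicate_of_add_eq
    (b := (r g : DihedralGroup n)) (v := 0) (by simpa using h)
  obtain ⟨rfl, rfl⟩ : v₁ = 0 ∧ v₂ = 0 := by lia
  simp only [Multiset.replicate_zero, add_zero] at hT hU ⊢
  rw [h1] at hT hU
  rcases Nat.eq_zero_or_pos u₁ with rfl | h3
  · simp
  · have := Nat.le_of_dvd h3 hT
    obtain rfl : u₂ = 0 := by lia
    simp

/-- The sequence `(r g) ^ (2 n - 2) (sr x) ^ 2` is a minimal product-one sequence: a factor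
without reflections would be `(r g) ^ n`, and then `n - 2` signed copies of `g` would have to sum
to zero, but `n - 2` is odd and smaller than `n`. -/
lemma isMinProdOne_rotations_sr [NeZero n] (hn : 3 ≤ n) (hodd : Odd n) {g : ZMod n}
    (hg : IsUnit g) (x : ZMod n) :
    IsMinProdOne (Multiset.replicate (2 * n - 2) (r g) + Multiset.replicate 2 (sr x)) := by
  have hdvd : ∀ c : ℤ, (c : ZMod n) * g = 0 → (n : ℤ) ∣ c := fun c hc => by
    rwa [hg.mul_left_eq_zero, ZMod.intCast_zmod_eq_zero_iff_dvd] at hc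
  have hcoeff : ∀ u v, IsProdOne (Multiset.replicate u (r g) + Multiset.replicate v (sr x)) →
      2 ∣ v ∧ ∃ c : ℤ, |c| ≤ u ∧ 2 ∣ u - c ∧ (n : ℤ) ∣ c ∧ (v = 0 → c = u) := by
    intro u v h
    obtain ⟨P, M, Q, h0, e, hs⟩ := exists_signedSeq h
    have hP : P = Multiset.replicate P.card g := Multiset.eq_replicate_card.2 fun p hp => by
      have : (r p : DihedralGroup n) ∈ signedSeq P M Q := by simp [signedSeq, hp]
      rw [← e] at this
      exact (by simpa [Multiset.mem_replicate] using this : u ≠ 0 ∧ p = g).2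
    have hM : M = Multiset.replicate M.card g := Multiset.eq_replicate_card.2 fun p hp => by
      have : (r p : DihedralGroup n) ∈ signedSeq P M Q := by simp [signedSeq, hp]
      rw [← e] at this
      exact (by simpa [Multiset.mem_replicate] using this : u ≠ 0 ∧ p = g).2
    have hQ : Q = Multiset.replicate Q.card (x, x) := Multiset.eq_replicate_card.2
      fun q hq => by
        have h1 : (sr q.1 : DihedralGroup n) ∈ signedSeq P M Q := by
          simp only [signedSeq, Multiset.mem_add]
          exact .inr (.inl (Multiset.mem_map_of_mem (fun q : ZMod n × ZMod n => sr q.1) hq))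
        have h2 : (sr q.2 : DihedralGroup n) ∈ signedSeq P M Q := by
          simp only [signedSeq, Multiset.mem_add]
          exact .inr (.inr (Multiset.mem_map_of_mem (fun q : ZMod n × ZMod n => sr q.2) hq))
        rw [← e] at h1 h2
        exact Prod.ext (by simpa [Multiset.mem_replicate] using h1 : v ≠ 0 ∧ q.1 = x).2
          (by simpa [Multiset.mem_replicate] using h2 : v ≠ 0 ∧ q.2 = x).2
    have hx := congrArg (Multiset.count (sr x)) e
    have hr := congrArg (Multiset.count (r g)) e
    rw [hP, hM, hQ] at hx hr hs
    simp only [signedSeq, Multiset.count_add, Multiset.map_replicate, Multiset.count_replicate,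
      reduceCtorEq, if_true, if_false] at hx hr
    have h1 := hdvd (P.card - M.card) (by
      simp only [signedSum, Multiset.map_replicate, Multiset.sum_replicate, nsmul_eq_mul] at hs
      push_cast
      linear_combination hs)
    refine ⟨by lia, P.card - M.card, by rw [abs_le]; lia, by lia, h1, fun hv => ?_⟩
    have := h0 (Multiset.card_eq_zero.1 (by lia))
    rw [this] at hr ⊢
    simp only [Multiset.card_zero] at hr ⊢
    lia
  have key : ∀ u₁ u₂ : ℕ, u₁ + u₂ = 2 * n - 2 →
      IsProdOne (Multiset.replicate u₁ (r g) + Multiset.replicate 0 (sr x)) →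
      IsProdOne (Multiset.replicate u₂ (r g) + Multiset.replicate 2 (sr x)) → u₁ = 0 := by
    intro u₁ u₂ hu h1 h2
    obtain ⟨-, c, -, -, c3, c4⟩ := hcoeff _ _ h1
    obtain ⟨-, d, d1, d2, d3, -⟩ := hcoeff _ _ h2
    rw [c4 rfl, Int.natCast_dvd_natCast] at c3
    by_contra h0
    have := Nat.le_of_dvd (by lia) c3
    have hd := Int.eq_zero_of_abs_lt_dvd d3 (by lia)
    obtain ⟨w, hw⟩ := hodd
    obtain ⟨t, rfl⟩ := c3
    have ht : t < 2 := by
      by_contra! hlt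
      have := Nat.mul_le_mul_left n hlt
      lia
    interval_cases t <;> lia
  refine ⟨?_, by simp, ?_⟩
  · have := isProdOne_signedSeq (n := n) (P := Multiset.replicate (n - 1) g)
      (M := Multiset.replicate (n - 1) g) (Q := {(x, x)}) (by simp) (by simp [signedSum])
    convert this using 1
    simp only [signedSeq, Multiset.map_replicate, ← Multiset.replicate_one,
      ← Multiset.replicate_add]
    congr 2
    lia
  intro T U hT hU h
  obtain ⟨u₁, v₁, u₂, v₂, hu, hv, rfl, rfl⟩ := exists_replicate_of_add_eq h
  obtain ⟨⟨w, rfl⟩, -⟩ := hcoeff _ _ hT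
  obtain rfl | rfl : w = 0 ∨ w = 1 := by lia
  · obtain rfl : v₂ = 2 := by lia
    obtain rfl := key u₁ u₂ hu hT hU
    simp
  · obtain rfl : v₂ = 0 := by lia
    obtain rfl := key u₂ u₁ (by lia) hU hT
    simp

end Atoms

/-! ### Distances over sets of reflections -/

section Reflections

/-- All differences of lengths of product-one sequences over `G₀` are divisible by `d`. -/
def DvdLengths {G : Type*} [Group G] (d : ℕ) (G₀ : Set G) : Prop :=
  ∀ S : Multiset G, IsProdOne S → (∀ g ∈ S, g ∈ G₀) → ∀ k ∈ lengths S, ∀ l ∈ lengths S,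
    (d : ℤ) ∣ (k : ℤ) - l

variable {n : ℕ}

lemma map_inv_eq_self {W : Multiset (DihedralGroup n)} (hW : ∀ g ∈ W, ∃ i, g = sr i) :
    W.map (·⁻¹) = W := by
  refine (Multiset.map_congr rfl fun g hg => ?_).trans (Multiset.map_id W)
  obtain ⟨i, rfl⟩ := hW g hg
  simp

/-- A product of reflections with even multiplicities is a product of squares of reflections, so
the number of atoms in any other factorization is restricted modulo `d`. -/
lemma DvdLengths.dvd_of_sum_eq {d : ℕ} {G₀ : Set (DihedralGroup n)} (hd : DvdLengths d G₀)
    {x y z : ZMod n} (hx : sr x ∈ G₀) (hy : sr y ∈ G₀) (hz : sr z ∈ G₀)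
    {Z : Multiset (Multiset (DihedralGroup n))} (hZ : ∀ A ∈ Z, IsMinProdOne A) {a b c : ℕ}
    (hsum : Z.sum = Multiset.replicate (2 * a) (sr x) + Multiset.replicate (2 * b) (sr y) +
      Multiset.replicate (2 * c) (sr z)) :
    (d : ℤ) ∣ ((a + b + c : ℕ) : ℤ) - Z.card := by
  set W : Multiset (DihedralGroup n) := Multiset.replicate a (sr x) +
    Multiset.replicate b (sr y) + Multiset.replicate c (sr z) with hW
  have hmem : ∀ g ∈ W, g = sr x ∨ g = sr y ∨ g = sr z := fun g hg => by
    simp only [hW, Multiset.mem_add, Multiset.mem_replicate] at hg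
    tauto
  have hinv : W.map (·⁻¹) = W := map_inv_eq_self fun g hg => by
    rcases hmem g hg with h | h | h <;> exact ⟨_, h⟩
  have e : Z.sum = W + W.map (·⁻¹) := by
    rw [hinv, hsum, hW]
    simp only [two_mul, Multiset.replicate_add]
    abel
  have h1 := card_mem_lengths_add_map_inv (W := W) fun g hg h => by
    rcases hmem g hg with rfl | rfl | rfl <;> (rw [one_def] at h; cases h)
  have h2 : W.card = a + b + c := by simp [hW]
  rw [← h2]
  refine hd _ (e ▸ isProdOne_add_map_inv W) (fun g hg => ?_) _ (e ▸ h1) _ ⟨Z, hZ, rfl, rfl⟩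
  rw [e, hinv, Multiset.mem_add, or_self] at hg
  rcases hmem g hg with rfl | rfl | rfl <;> assumption

lemma addOrderOf_eq_iff_isUnit [NeZero n] {a : ZMod n} : addOrderOf a = n ↔ IsUnit a := by
  constructor
  · intro h
    have hinj : Function.Injective fun x : ZMod n => x * a := by
      rw [show (fun x : ZMod n => x * a) = AddMonoidHom.mulRight a from rfl,
        injective_iff_map_eq_zero]
      intro x hx
      have h1 : addOrderOf a ∣ x.val := addOrderOf_dvd_of_nsmul_eq_zero (by simpa using hx)
      rw [h] at h1
      exact (ZMod.val_eq_zero x).1 (Nat.eq_zero_of_dvd_of_lt h1 (ZMod.val_lt x))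
    obtain ⟨x, hx⟩ := Finite.injective_iff_surjective.1 hinj 1
    exact IsUnit.of_mul_eq_one x (by rw [mul_comm]; exact hx)
  · intro h
    refine Nat.dvd_antisymm (addOrderOf_dvd_zmod a) ?_
    have := addOrderOf_nsmul_eq_zero a
    rwa [nsmul_eq_mul, h.mul_left_eq_zero, ZMod.natCast_eq_zero_iff] at this

lemma exists_natCast_mul_eq [NeZero n] {x y z : ZMod n} (hxy : IsUnit (y - x)) (hxz : z ≠ x)
    (hyz : z ≠ y) : ∃ k : ℕ, 2 ≤ k ∧ k < n ∧ z - x = k * (y - x) := by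
  obtain ⟨u, hu⟩ := hxy
  have e : z - x = ((((z - x) * ((u⁻¹ : (ZMod n)ˣ) : ZMod n)).val : ℕ) : ZMod n) * (y - x) := by
    rw [ZMod.natCast_zmod_val, ← hu, mul_assoc, Units.inv_mul, mul_one]
  refine ⟨_, ?_, ZMod.val_lt _, e⟩
  by_contra! hlt
  obtain h | h : ((z - x) * ((u⁻¹ : (ZMod n)ˣ) : ZMod n)).val = 0 ∨
    ((z - x) * ((u⁻¹ : (ZMod n)ˣ) : ZMod n)).val = 1 := by lia
  · rw [h, Nat.cast_zero, zero_mul, sub_eq_zero] at e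
    exact hxz e
  · rw [h, Nat.cast_one, one_mul] at e
    exact hyz (by linear_combination e)

section Relations

variable {d : ℕ} {G₀ : Set (DihedralGroup n)} {x y z : ZMod n} {k : ℕ}

lemma odd_addOrderOf (hodd : Odd n) (a : ZMod n) : Odd (addOrderOf a) :=
  hodd.of_dvd_nat (addOrderOf_dvd_zmod a)

/-- Twice the atom `(sr x) ^ m (sr y) ^ m` is a product of `2 m` squares. -/
lemma DvdLengths.dvd_order [NeZero n] (hd : DvdLengths d G₀) (hodd : Odd n)
    (hx : sr x ∈ G₀) (hy : sr y ∈ G₀) (hxy : x ≠ y) :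
    (d : ℤ) ∣ 2 * (addOrderOf (x - y) - 1) := by
  have hA := isMinProdOne_sr_pair hodd hxy
  have := hd.dvd_of_sum_eq hx hy hy (Z := 2 • {_}) (a := addOrderOf (x - y))
    (b := addOrderOf (x - y)) (c := 0) (by
      intro A hA'
      rw [Multiset.nsmul_singleton, Multiset.mem_replicate] at hA'
      exact hA'.2 ▸ hA) (by
      simp only [Multiset.sum_nsmul, Multiset.sum_singleton, two_mul,
        Multiset.replicate_add, mul_zero, Multiset.replicate_zero]
      abel)
  simp only [Multiset.card_nsmul, Multiset.card_singleton] at this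
  convert this using 1
  push_cast
  ring

/-- Twice the atom `(sr x) ^ (k - 1) (sr y) ^ k (sr z)` is a product of `2 k` squares. -/
lemma DvdLengths.dvd_triple [NeZero n] (hd : DvdLengths d G₀) (hodd : Odd n)
    (hx : sr x ∈ G₀) (hy : sr y ∈ G₀) (hz : sr z ∈ G₀) (hxy : IsUnit (y - x)) (hk2 : 2 ≤ k)
    (hkn : k < n) (e : z - x = k * (y - x)) :
    (d : ℤ) ∣ 2 * (k - 1) := by
  have hA := isMinProdOne_tripleSeq hodd hxy hk2 hkn e
  have := hd.dvd_of_sum_eq hx hy hz (Z := 2 • {_}) (a := k - 1) (b := k) (c := 1) (by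
      intro A hA'
      rw [Multiset.nsmul_singleton, Multiset.mem_replicate] at hA'
      exact hA'.2 ▸ hA) (by
      simp only [Multiset.sum_nsmul, Multiset.sum_singleton, two_mul,
        Multiset.replicate_add, tripleSeq, Multiset.replicate_one]
      abel)
  simp only [Multiset.card_nsmul, Multiset.card_singleton] at this
  convert this using 1
  push_cast [Nat.cast_sub (show 1 ≤ k by lia)]
  ring

/-- The product of the three atoms over two of the reflections each has even multiplicities. -/
lemma DvdLengths.dvd_cycle [NeZero n] (hd : DvdLengths d G₀) (hodd : Odd n)
    (hx : sr x ∈ G₀) (hy : sr y ∈ G₀) (hz : sr z ∈ G₀) (hxy : x ≠ y) (hxz : x ≠ z)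
    (hyz : y ≠ z) :
    (d : ℤ) ∣ addOrderOf (x - y) + addOrderOf (x - z) + addOrderOf (y - z) - 3 := by
  obtain ⟨a, ha⟩ := odd_addOrderOf hodd (x - y)
  obtain ⟨b, hb⟩ := odd_addOrderOf hodd (x - z)
  obtain ⟨c, hc⟩ := odd_addOrderOf hodd (y - z)
  have := hd.dvd_of_sum_eq hx hy hz (Z := {_, _, _}) (a := a + b + 1) (b := a + c + 1)
    (c := b + c + 1) (by
      intro A hA'
      simp only [Multiset.insert_eq_cons, Multiset.mem_cons, Multiset.mem_singleton] at hA'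
      rcases hA' with h | h | h
      · exact h ▸ isMinProdOne_sr_pair hodd hxy
      · exact h ▸ isMinProdOne_sr_pair hodd hxz
      · exact h ▸ isMinProdOne_sr_pair hodd hyz) (by
      simp only [Multiset.insert_eq_cons, Multiset.sum_cons, Multiset.sum_singleton, ha, hb, hc,
        two_mul, Multiset.replicate_add]
      abel)
  simp only [Multiset.insert_eq_cons, Multiset.card_cons, Multiset.card_singleton] at this
  convert this using 1
  rw [ha, hb, hc]
  push_cast
  ring

/-- For even `k`, the product of `(sr x) ^ (k - 1) (sr y) ^ k (sr z)` and the atom over `sr x`, `sr z`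
has even multiplicities. -/
lemma DvdLengths.dvd_triple_even [NeZero n] (hd : DvdLengths d G₀) (hodd : Odd n)
    (hx : sr x ∈ G₀) (hy : sr y ∈ G₀) (hz : sr z ∈ G₀) (hxy : IsUnit (y - x)) (hk2 : 2 ≤ k)
    (hkn : k < n) (e : z - x = k * (y - x)) (hxz : x ≠ z) (hk : Even k) :
    (d : ℤ) ∣ k + addOrderOf (x - z) - 2 := by
  obtain ⟨a, ha⟩ := odd_addOrderOf hodd (x - z)
  obtain ⟨b, rfl⟩ := hk
  obtain ⟨b, rfl⟩ : ∃ c, b = c + 1 := ⟨b - 1, by lia⟩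
  have := hd.dvd_of_sum_eq hx hy hz (Z := {_, _}) (a := a + b + 1) (b := b + 1)
    (c := a + 1) (by
      intro A hA'
      simp only [Multiset.insert_eq_cons, Multiset.mem_cons, Multiset.mem_singleton] at hA'
      rcases hA' with h | h
      · exact h ▸ isMinProdOne_sr_pair hodd hxz
      · exact h ▸ isMinProdOne_tripleSeq hodd hxy hk2 hkn e) (by
      simp only [Multiset.insert_eq_cons, Multiset.sum_cons, Multiset.sum_singleton, ha,
        tripleSeq]
      rw [show b + 1 + (b + 1) - 1 = b + b + 1 by lia]
      simp only [two_mul, Multiset.replicate_add, Multiset.replicate_one]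
      abel)
  simp only [Multiset.insert_eq_cons, Multiset.card_cons, Multiset.card_singleton] at this
  convert this using 1
  rw [ha]
  push_cast
  ring

/-- For odd `k`, the product of `(sr x) ^ (k - 1) (sr y) ^ k (sr z)` and the atom over `sr y`, `sr z`
has even multiplicities. -/
lemma DvdLengths.dvd_triple_odd [NeZero n] (hd : DvdLengths d G₀) (hodd : Odd n)
    (hx : sr x ∈ G₀) (hy : sr y ∈ G₀) (hz : sr z ∈ G₀) (hxy : IsUnit (y - x)) (hk2 : 2 ≤ k)
    (hkn : k < n) (e : z - x = k * (y - x)) (hyz : y ≠ z) (hk : Odd k) :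
    (d : ℤ) ∣ k + addOrderOf (y - z) - 2 := by
  obtain ⟨a, ha⟩ := odd_addOrderOf hodd (y - z)
  obtain ⟨b, rfl⟩ := hk
  have := hd.dvd_of_sum_eq hx hy hz (Z := {_, _}) (a := b) (b := a + b + 1)
    (c := a + 1) (by
      intro A hA'
      simp only [Multiset.insert_eq_cons, Multiset.mem_cons, Multiset.mem_singleton] at hA'
      rcases hA' with h | h
      · exact h ▸ isMinProdOne_sr_pair hodd hyz
      · exact h ▸ isMinProdOne_tripleSeq hodd hxy hk2 hkn e) (by
      simp only [Multiset.insert_eq_cons, Multiset.sum_cons, Multiset.sum_singleton, ha,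
        tripleSeq]
      rw [show 2 * b + 1 - 1 = 2 * b by lia]
      simp only [two_mul, Multiset.replicate_add, Multiset.replicate_one]
      abel)
  simp only [Multiset.insert_eq_cons, Multiset.card_cons, Multiset.card_singleton] at this
  convert this using 1
  rw [ha]
  push_cast
  ring

/-- If the three differences are units, the relations combine to `d ∣ n - 1` and `d ∣ k - 1`. -/
lemma DvdLengths.dvd_of_isUnit [NeZero n] (hd : DvdLengths d G₀) (hodd : Odd n) (hn : 3 ≤ n)
    (hx : sr x ∈ G₀) (hy : sr y ∈ G₀) (hz : sr z ∈ G₀) (hxy : IsUnit (x - y))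
    (hxz : IsUnit (x - z)) (hyz : IsUnit (y - z)) (hk2 : 2 ≤ k) (hkn : k < n)
    (e : z - x = k * (y - x)) : (d : ℤ) ∣ n - 1 ∧ (d : ℤ) ∣ k - 1 := by
  have : Fact (1 < n) := ⟨by lia⟩
  have hne : ∀ {a b : ZMod n}, IsUnit (a - b) → a ≠ b := by
    rintro a b h rfl
    simp at h
  have hyx : IsUnit (y - x) := by rwa [← neg_sub, IsUnit.neg_iff]
  have h1 := hd.dvd_order hodd hx hy (hne hxy)
  have h2 := hd.dvd_cycle hodd hx hy hz (hne hxy) (hne hxz) (hne hyz)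
  rw [addOrderOf_eq_iff_isUnit.2 hxy] at h1 h2
  rw [addOrderOf_eq_iff_isUnit.2 hxz, addOrderOf_eq_iff_isUnit.2 hyz] at h2
  have h3 : (d : ℤ) ∣ n - 1 := by
    obtain ⟨u, hu⟩ := h1
    obtain ⟨v, hv⟩ := h2
    exact ⟨v - u, by linear_combination hv - hu⟩
  refine ⟨h3, ?_⟩
  rcases Nat.even_or_odd k with hk | hk
  · have h4 := hd.dvd_triple_even hodd hx hy hz hyx hk2 hkn e (hne hxz) hk
    rw [addOrderOf_eq_iff_isUnit.2 hxz] at h4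
    obtain ⟨u, hu⟩ := h3
    obtain ⟨v, hv⟩ := h4
    exact ⟨v - u, by linear_combination hv - hu⟩
  · have h4 := hd.dvd_triple_odd hodd hx hy hz hyx hk2 hkn e (hne hyz) hk
    rw [addOrderOf_eq_iff_isUnit.2 hyz] at h4
    obtain ⟨u, hu⟩ := h3
    obtain ⟨v, hv⟩ := h4
    exact ⟨v - u, by linear_combination hv - hu⟩

/-- With `q = (n - 1) / d < 4`, the multiplier `k` is `1 / 2`, `1 / 3` or `2 / 3` modulo `n`.
Exchanging the roles of `x, y, z` replaces it by `2` or `3`, and then `d ∣ 1` or `d ∣ 2`. -/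
lemma DvdLengths.eq_of_isUnit [NeZero n] (hd : DvdLengths d G₀) (hodd : Odd n) (hn : 3 ≤ n)
    (hx : sr x ∈ G₀) (hy : sr y ∈ G₀) (hz : sr z ∈ G₀) (hxy : IsUnit (x - y))
    (hxz : IsUnit (x - z)) (hyz : IsUnit (y - z)) (hd1 : 1 < d) (hlt : n - 1 < 4 * d) :
    n = 7 ∧ d = 2 := by
  have hneg : ∀ {a b : ZMod n}, IsUnit (a - b) → IsUnit (b - a) := by
    intro a b h
    rwa [← neg_sub, IsUnit.neg_iff]
  have : Fact (1 < n) := ⟨by lia⟩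
  have hne : ∀ {a b : ZMod n}, IsUnit (a - b) → a ≠ b := by
    rintro a b h rfl
    simp at h
  obtain ⟨k, hk2, hkn, e⟩ := exists_natCast_mul_eq (hneg hxy) (hne hxz).symm (hne hyz).symm
  obtain ⟨⟨q, hq⟩, ⟨p, hp⟩⟩ := hd.dvd_of_isUnit hodd hn hx hy hz hxy hxz hyz hk2 hkn e
  have hq4 : q < 4 := by
    by_contra! h
    have := mul_le_mul_of_nonneg_left h (show (0 : ℤ) ≤ d by lia)
    lia
  have hp0 : 0 < p := by
    by_contra! h
    have := mul_nonpos_of_nonneg_of_nonpos (show (0 : ℤ) ≤ d by lia) h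
    lia
  have hpq : p < q := by
    by_contra! h
    have := mul_le_mul_of_nonneg_left h (show (0 : ℤ) ≤ d by lia)
    lia
  obtain rfl | rfl : q = 2 ∨ q = 3 := by lia
  · obtain rfl : p = 1 := by lia
    have h2k : ((2 * k : ℕ) : ZMod n) = 1 := by
      rw [show 2 * k = n + 1 by lia]
      simp
    push_cast at h2k
    have := (hd.dvd_of_isUnit hodd hn hx hz hy hxz hxy (hneg hyz) (k := 2) le_rfl (by lia)
      (by push_cast; linear_combination (x - y) * h2k - 2 * e)).2
    have := Int.le_of_dvd (by simp) this
    push_cast at this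
    lia
  · have hd2 : d ∣ 2 := by
      obtain rfl | rfl : p = 1 ∨ p = 2 := by lia
      · have h3k : ((3 * k : ℕ) : ZMod n) = 2 := by
          rw [show 3 * k = n + 2 by lia]
          simp
        push_cast at h3k
        have := (hd.dvd_of_isUnit hodd hn hy hz hx hyz (hneg hxy) (hneg hxz) (k := 3)
          (by lia) (by lia) (by push_cast; linear_combination (x - y) * h3k - 3 * e)).2
        norm_num at this
        exact_mod_cast this
      · have h3k : ((3 * k : ℕ) : ZMod n) = 1 := by
          rw [show 3 * k = 2 * n + 1 by lia]
          simp
        push_cast at h3k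
        have := (hd.dvd_of_isUnit hodd hn hx hz hy hxz hxy (hneg hyz) (k := 3)
          (by lia) (by lia) (by push_cast; linear_combination (x - y) * h3k - 3 * e)).2
        norm_num at this
        exact_mod_cast this
    have := Nat.le_of_dvd (by lia) hd2
    obtain rfl : d = 2 := by lia
    exact ⟨by lia, rfl⟩

/-- If `d` is larger than `(n - 1) / 4` and `n = m g` nontrivially with `d` dividing `2 (n - 1)`
and `2 (m - 1)`, then `d` also divides `2 (g - 1)`, which leaves three small cases. -/
lemma eq_of_dvd_of_lt {n m d : ℕ} (hodd : Odd n) (hm : m ∣ n) (hm1 : m ≠ 1) (hmn : m ≠ n)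
    (hd1 : 1 < d) (hlt : n - 1 < 4 * d) (h1 : (d : ℤ) ∣ 2 * (n - 1))
    (h2 : (d : ℤ) ∣ 2 * (m - 1)) :
    (n = 9 ∧ d = 4) ∨ (n = 25 ∧ d = 8) ∨ (n = 15 ∧ d = 4) := by
  obtain ⟨g, rfl⟩ := hm
  obtain ⟨hmo, hgo⟩ := Nat.odd_mul.1 hodd
  obtain ⟨m, rfl⟩ := hmo
  obtain ⟨g, rfl⟩ := hgo
  have hm0 : 0 < m := Nat.pos_of_ne_zero (by rintro rfl; simp at hm1)
  have hg0 : 0 < g := Nat.pos_of_ne_zero (by rintro rfl; simp at hmn)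
  have h2' : d ∣ 4 * m := by
    have : (d : ℤ) ∣ ((4 * m : ℕ) : ℤ) := by convert h2 using 1; push_cast; ring
    exact_mod_cast this
  have h1' : d ∣ 4 * (2 * m * g + m + g) := by
    have : (d : ℤ) ∣ ((4 * (2 * m * g + m + g) : ℕ) : ℤ) := by
      convert h1 using 1; push_cast; ring
    exact_mod_cast this
  have h3 : d ∣ 4 * g := by
    have h4 : d ∣ 4 * (2 * m * g + m + g) - (4 * m * (2 * g + 1)) :=
      Nat.dvd_sub h1' (h2'.mul_right _)
    have e : 4 * (2 * m * g + m + g) - (4 * m * (2 * g + 1)) = 4 * g := by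
      have : 4 * (2 * m * g + m + g) = 4 * m * (2 * g + 1) + 4 * g := by ring
      lia
    rwa [e] at h4
  obtain ⟨b, hb⟩ := h2'
  obtain ⟨c, hc⟩ := h3
  have hb0 : 0 < b := Nat.pos_of_ne_zero (by rintro rfl; lia)
  have hc0 : 0 < c := Nat.pos_of_ne_zero (by rintro rfl; lia)
  have hdb : d ≤ 4 * m := by rw [hb]; exact Nat.le_mul_of_pos_right d hb0
  have hdc : d ≤ 4 * g := by rw [hc]; exact Nat.le_mul_of_pos_right d hc0
  have hlt' : 4 * m * g + 2 * m + 2 * g < 4 * d := by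
    have : (2 * m + 1) * (2 * g + 1) = 4 * m * g + 2 * m + 2 * g + 1 := by ring
    lia
  have hm4 : m < 4 := by
    by_contra! h
    have := Nat.mul_le_mul_right (4 * g) h
    nlinarith
  have hg4 : g < 4 := by
    by_contra! h
    have := Nat.mul_le_mul_right (4 * m) h
    nlinarith
  have hd16 : d ≤ 12 := by lia
  have hb12 : d ∣ 4 * m := ⟨b, hb⟩
  have hc12 : d ∣ 4 * g := ⟨c, hc⟩
  clear hb hc h1 h2 h1'
  interval_cases m <;> interval_cases g <;> interval_cases d <;> revert hb12 hc12 hlt' <;> decide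

end Relations

end Reflections

section Triples

variable {n d : ℕ} {G₀ : Set (DihedralGroup n)} {x y z : ZMod n}

/-- The case where `x - z` is not a unit: the three remaining pairs `(n, d)` are excluded by the
relations between the orders of the differences. -/
lemma DvdLengths.false_of_not_isUnit [NeZero n] (hd : DvdLengths d G₀) (hodd : Odd n)
    (hx : sr x ∈ G₀) (hy : sr y ∈ G₀) (hz : sr z ∈ G₀) (hxy : IsUnit (x - y))
    (hxz : x ≠ z) (hyz : y ≠ z) (hxz' : ¬ IsUnit (x - z)) (hd1 : 1 < d)
    (hlt : n - 1 < 4 * d) : False := by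
  have hm1 : ∀ a : ZMod n, a ≠ 0 → addOrderOf a ≠ 1 := fun a ha h =>
    ha (AddMonoid.addOrderOf_eq_one_iff.1 h)
  have hneq : x ≠ y := by
    rintro rfl
    rw [sub_self] at hxy
    have := isUnit_zero_iff.1 hxy
    exact hxz (by linear_combination (x - z) * (-this))
  have hmn : addOrderOf (x - z) ≠ n := fun h => hxz' (addOrderOf_eq_iff_isUnit.1 h)
  have hyx : IsUnit (y - x) := by rwa [← neg_sub, IsUnit.neg_iff]
  have h1 := hd.dvd_order hodd hx hy hneq
  have h2 := hd.dvd_order hodd hx hz hxz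
  have hc := hd.dvd_cycle hodd hx hy hz hneq hxz hyz
  rw [addOrderOf_eq_iff_isUnit.2 hxy] at h1 hc
  obtain ⟨k, hk2, hkn, e⟩ := exists_natCast_mul_eq hyx hxz.symm hyz.symm
  have h3 := hd.dvd_triple hodd hx hy hz hyx hk2 hkn e
  have h4 := hd.dvd_triple_odd hodd hx hy hz hyx hk2 hkn e hyz
  have hmk : n ∣ addOrderOf (x - z) * k := by
    have := addOrderOf_nsmul_eq_zero (x - z)
    rw [nsmul_eq_mul] at this
    rw [← ZMod.natCast_eq_zero_iff, ← hyx.mul_left_eq_zero, ← neg_eq_zero, ← this]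
    push_cast
    linear_combination (addOrderOf (x - z) : ZMod n) * e
  have hmk' : n ∣ addOrderOf (y - z) * (k - 1) := by
    have := addOrderOf_nsmul_eq_zero (y - z)
    rw [nsmul_eq_mul] at this
    rw [← ZMod.natCast_eq_zero_iff, ← hyx.mul_left_eq_zero, ← neg_eq_zero, ← this]
    push_cast [Nat.cast_sub (show 1 ≤ k by lia)]
    linear_combination (addOrderOf (y - z) : ZMod n) * e
  have hlcm : n ∣ Nat.lcm (addOrderOf (x - z)) (addOrderOf (y - z)) := by
    rw [← ZMod.natCast_eq_zero_iff, ← hxy.mul_left_eq_zero]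
    obtain ⟨u, hu⟩ := Nat.dvd_lcm_left (addOrderOf (x - z)) (addOrderOf (y - z))
    obtain ⟨v, hv⟩ := Nat.dvd_lcm_right (addOrderOf (x - z)) (addOrderOf (y - z))
    have e1 := addOrderOf_nsmul_eq_zero (x - z)
    have e2 := addOrderOf_nsmul_eq_zero (y - z)
    rw [nsmul_eq_mul] at e1 e2
    have hu' := congrArg (Nat.cast : ℕ → ZMod n) hu
    have hv' := congrArg (Nat.cast : ℕ → ZMod n) hv
    push_cast at hu' hv'
    linear_combination (x - z) * hu' - (y - z) * hv' + u * e1 - v * e2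
  have hzx : addOrderOf (z - x) = addOrderOf (x - z) := by rw [← neg_sub, addOrderOf_neg]
  have hma := addOrderOf_dvd_zmod (x - z)
  have hmb := addOrderOf_dvd_zmod (y - z)
  have hma1 := hm1 _ (sub_ne_zero.2 hxz)
  have hmb1 := hm1 _ (sub_ne_zero.2 hyz)
  have hcases := eq_of_dvd_of_lt hodd hma hma1 hmn hd1 hlt h1 h2
  -- For `n = 15` and `k = 3` the multiplier of `x` with respect to `y` and `z` is `7`.
  have h5 : n = 15 → k = 3 → (d : ℤ) ∣ 7 + addOrderOf (x - z) - 2 := by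
    rintro rfl rfl
    have e2 : z - y = 2 * (y - x) := by push_cast at e; linear_combination e
    have hzy : IsUnit (z - y) := by
      rw [e2]
      exact (IsUnit.of_mul_eq_one 8 (by decide)).mul hyx
    have := hd.dvd_triple_odd (k := 7) hodd hy hz hx hzy (by lia) (by lia)
      (by
        rw [e2, ← mul_assoc, show ((7 : ℕ) : ZMod 15) * 2 = -1 by decide]
        ring) hxz.symm (by decide)
    rwa [hzx] at this
  generalize addOrderOf (x - z) = m at *
  generalize addOrderOf (y - z) = m' at *
  clear hd e hx hy hz h1 h2
  rcases hcases with ⟨rfl, rfl⟩ | ⟨rfl, rfl⟩ | ⟨rfl, rfl⟩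
  · have hm : m = 3 := by
      have := Nat.le_of_dvd (by lia) hma
      interval_cases m <;> simp_all
    have hm' : m' = 3 ∨ m' = 9 := by
      have := Nat.le_of_dvd (by lia) hmb
      interval_cases m' <;> simp_all
    subst hm
    rcases hm' with rfl | rfl
    · revert hlcm; decide
    · revert hc; decide
  · have hm : m = 5 := by
      have := Nat.le_of_dvd (by lia) hma
      interval_cases m <;> simp_all
    have hm' : m' = 5 ∨ m' = 25 := by
      have := Nat.le_of_dvd (by lia) hmb
      interval_cases m' <;> simp_all
    subst hm
    rcases hm' with rfl | rfl
    · revert hlcm; decide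
    · revert hc; decide
  · have hm : m = 3 ∨ m = 5 := by
      have := Nat.le_of_dvd (by lia) hma
      interval_cases m <;> simp_all
    have hm' : m' = 3 ∨ m' = 5 ∨ m' = 15 := by
      have := Nat.le_of_dvd (by lia) hmb
      interval_cases m' <;> simp_all
    have hk : Odd k := by
      rw [Nat.odd_iff]
      push_cast at h3
      lia
    have h4' := h4 hk
    clear hlt hd1 hyx hxy hxz' h4 hm1 hma hmb hmn
    rcases hm with rfl | rfl <;> rcases hm' with rfl | rfl | rfl <;> push_cast at * <;> lia

/-- The bound for sets containing three reflections, two of which generate the group. -/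
lemma DvdLengths.bound_of_triple [NeZero n] (hd : DvdLengths d G₀) (hodd : Odd n) (hn : 3 ≤ n)
    (hx : sr x ∈ G₀) (hy : sr y ∈ G₀) (hz : sr z ∈ G₀) (hxy : IsUnit (x - y))
    (hxz : x ≠ z) (hyz : y ≠ z) (hd1 : 1 < d) (hlt : n - 1 < 4 * d) : n = 7 ∧ d = 2 := by
  by_cases h1 : IsUnit (x - z)
  · by_cases h2 : IsUnit (y - z)
    · exact hd.eq_of_isUnit hodd hn hx hy hz hxy h1 h2 hd1 hlt
    · exact (hd.false_of_not_isUnit hodd hy hx hz (by rwa [← neg_sub, IsUnit.neg_iff]) hyz hxz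
        h2 hd1 hlt).elim
  · exact (hd.false_of_not_isUnit hodd hx hy hz hxy hxz hyz h1 hd1 hlt).elim

end Triples

section Pair

variable {n : ℕ}

lemma isProdOne_even_sr (x y : ZMod n) (a b : ℕ) :
    IsProdOne (Multiset.replicate (2 * a) (sr x : DihedralGroup n) +
      Multiset.replicate (2 * b) (sr y)) := by
  have h := isProdOne_add_map_inv (Multiset.replicate a (sr x : DihedralGroup n) +
    Multiset.replicate b (sr y))
  convert h using 1
  simp only [two_mul, Multiset.replicate_add, Multiset.map_add, Multiset.map_replicate, inv_sr]
  abel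

lemma eq_replicate_add_replicate {α : Type*} [DecidableEq α] {a b : α} (hab : a ≠ b)
    {A : Multiset α} (hA : ∀ g ∈ A, g = a ∨ g = b) :
    A = Multiset.replicate (A.count a) a + Multiset.replicate (A.count b) b := by
  ext g
  rw [Multiset.count_add, Multiset.count_replicate, Multiset.count_replicate]
  by_cases ha : a = g
  · subst ha
    simp [hab.symm]
  · by_cases hb : b = g
    · subst hb
      simp [hab]
    · simp only [ha, hb, if_false]
      exact Multiset.count_eq_zero.2 fun h => (hA g h).elim (fun h => ha h.symm)
        fun h => hb h.symm

/-- Over two reflections generating the group, the atoms are the two squares and the sequence in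
which both reflections have multiplicity `n`. The parity of the number of atoms of the latter
kind is determined by the multiplicity of `sr x`. -/
lemma dvdLengths_sr_pair [NeZero n] (hodd : Odd n) (hn : 3 ≤ n) {x y : ZMod n}
    (hxy : IsUnit (x - y)) : DvdLengths (2 * n - 2) ({sr x, sr y} : Set (DihedralGroup n)) := by
  have hne : x ≠ y := by
    have : Fact (1 < n) := ⟨by lia⟩
    rintro rfl
    simp at hxy
  intro S hS hS0 k hk l hl
  -- the value of `w` is `2`, `2 - 2 (2 n - 2)` and `2 n - n (2 n - 2)` on the three atoms, which is
  -- congruent to `2` modulo `2 (2 n - 2)` since `n` is odd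
  let w : Multiset (DihedralGroup n) →+ ℤ :=
    { toFun := fun A => A.card - (2 * n - 2) * A.count (sr x)
      map_zero' := by simp
      map_add' := fun A B => by
        simp only [Multiset.card_add, Multiset.count_add]
        push_cast
        ring }
  have h := dvd_mul_sub_of_atoms (G₀ := ({sr x, sr y} : Set (DihedralGroup n))) w 2
    (2 * (2 * n - 2)) (fun A hA hA0 => ?_) hS0 hk hl
  · have := Int.dvd_of_mul_dvd_mul_left (by norm_num) h
    rwa [Nat.cast_sub (by lia), Nat.cast_mul, Nat.cast_ofNat]
  have hA0' : ∀ g ∈ A, g = sr x ∨ g = sr y := by simpa using hA0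
  change _ ∣ (A.card - (2 * n - 2) * A.count (sr x) : ℤ) - 2
  obtain ⟨c, h1, h2, h3, h4, h5⟩ := hA.1.exists_coeff_pair hne hA0'
  rw [addOrderOf_eq_iff_isUnit.2 hxy] at h5
  have e := eq_replicate_add_replicate (by simpa using hne) hA0'
  have hcard : A.card = A.count (sr x) + A.count (sr y) := by
    conv_lhs => rw [e]
    simp
  generalize A.count (sr x) = a at *
  generalize A.count (sr y) = b at *
  subst e
  obtain ⟨w, hw⟩ := hodd
  rcases Nat.even_or_odd a with ha | ha
  · obtain ⟨a, rfl⟩ := even_iff_two_dvd.1 ha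
    obtain ⟨b, rfl⟩ : 2 ∣ b := by lia
    have hab : (a = 1 ∧ b = 0) ∨ (a = 0 ∧ b = 1) := by
      rcases Nat.eq_zero_or_pos a with rfl | ha0
      · rcases Nat.eq_zero_or_pos b with rfl | hb0
        · exact absurd rfl hA.2.1
        · obtain ⟨b, rfl⟩ : ∃ b', b = b' + 1 := ⟨b - 1, by lia⟩
          rcases hA.2.2 _ _ (isProdOne_even_sr x y 0 1) (isProdOne_even_sr x y 0 b) (by
            simp only [mul_add, Multiset.replicate_add]
            simp [add_comm]) with h | h
          · have := congrArg Multiset.card h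
            simp at this
          · have := congrArg Multiset.card h
            simp at this
            lia
      · obtain ⟨a, rfl⟩ : ∃ a', a = a' + 1 := ⟨a - 1, by lia⟩
        rcases hA.2.2 _ _ (isProdOne_even_sr x y 1 0) (isProdOne_even_sr x y a b) (by
          simp only [mul_add, Multiset.replicate_add]
          simp only [mul_one, mul_zero, Multiset.replicate_zero, add_zero]
          abel) with h | h
        · have := congrArg Multiset.card h
          simp at this
        · have := congrArg Multiset.card h
          simp at this
          lia
    rw [hcard]
    rcases hab with ⟨rfl, rfl⟩ | ⟨rfl, rfl⟩
    · exact ⟨-1, by push_cast; ring⟩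
    · exact ⟨0, by push_cast; ring⟩
  · have hc0 : c ≠ 0 := by
      rintro rfl
      obtain ⟨t, ht⟩ := ha
      lia
    have hcn := Int.le_of_dvd (abs_pos.2 hc0) ((dvd_abs _ _).2 h5)
    obtain ⟨t, ht⟩ := ha
    obtain ⟨a', rfl⟩ : ∃ a', a = n + 2 * a' := ⟨t - w, by lia⟩
    obtain ⟨b', rfl⟩ : ∃ b', b = n + 2 * b' := ⟨(b - n) / 2, by lia⟩
    have hab : a' = 0 ∧ b' = 0 := by
      rcases hA.2.2 _ _ (isProdOne_sr_pair (n := n) (x := x) (y := y) (m := n) (by simp))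
        (isProdOne_even_sr x y a' b') (by
          simp only [Multiset.replicate_add]
          abel) with h | h
      · have := congrArg Multiset.card h
        simp at this
        lia
      · have := congrArg Multiset.card h
        simp at this
        lia
    obtain ⟨rfl, rfl⟩ := hab
    rw [hcard]
    exact ⟨-w, by push_cast [hw]; ring⟩

end Pair

/-! ### Parity of lengths -/

section Parity

variable {n : ℕ}

lemma odd_of_two_dvd_sub {n u v a b : ℕ} (hn : Odd n) (ha : Odd a) (hb : Odd b)
    (h : (2 : ℤ) ∣ (n : ℤ) - ((u * a + v * b : ℕ) : ℤ)) : Odd (u + v) := by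
  obtain ⟨a, rfl⟩ := ha
  obtain ⟨b, rfl⟩ := hb
  obtain ⟨n, rfl⟩ := hn
  have e : u * (2 * a + 1) + v * (2 * b + 1) = 2 * (u * a + v * b) + (u + v) := by ring
  rw [e] at h
  rw [Nat.odd_iff]
  generalize u * a + v * b = t at h
  push_cast at h
  lia

/-- If all distances over two rotations are even, then all atoms have odd length: the `n`-th power
of an atom is also a product of atoms `(r a) ^ ord a`. -/
lemma odd_card_of_even_minDist [NeZero n] (hodd : Odd n) {a b : ZMod n} (hab : a ≠ b)
    (he : Even (minDist ({r a, r b} : Set (DihedralGroup n)))) {A : Multiset (DihedralGroup n)}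
    (hA : IsMinProdOne A) (hA0 : ∀ g ∈ A, g = r a ∨ g = r b) : Odd A.card := by
  have e := eq_replicate_add_replicate (by simpa using hab) hA0
  generalize A.count (r a) = u at e
  generalize A.count (r b) = v at e
  obtain ⟨w₁, h₁⟩ := addOrderOf_dvd_zmod a
  obtain ⟨w₂, h₂⟩ := addOrderOf_dvd_zmod b
  have hw₁ : Odd w₁ := hodd.of_dvd_nat ⟨_, by rw [mul_comm]; exact h₁⟩
  have hw₂ : Odd w₂ := hodd.of_dvd_nat ⟨_, by rw [mul_comm]; exact h₂⟩
  have hl1 := mul_mem_lengths_nsmul hA.one_mem_lengths n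
  have hl2 := add_mem_lengths
    (mul_mem_lengths_nsmul (isMinProdOne_replicate_r a).one_mem_lengths (u * w₁))
    (mul_mem_lengths_nsmul (isMinProdOne_replicate_r b).one_mem_lengths (v * w₂))
  have hS : (u * w₁) • Multiset.replicate (addOrderOf a) (r a : DihedralGroup n) +
      (v * w₂) • Multiset.replicate (addOrderOf b) (r b) = n • A := by
    rw [e, nsmul_add, Multiset.nsmul_replicate, Multiset.nsmul_replicate,
      Multiset.nsmul_replicate, Multiset.nsmul_replicate]
    congr 2
    · conv_rhs => rw [h₁]
      ring
    · conv_rhs => rw [h₂]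
      ring
  rw [hS, mul_one, mul_one] at hl2
  rw [mul_one] at hl1
  have h := minDist_dvd_sub (G₀ := ({r a, r b} : Set (DihedralGroup n))) (hA.1.nsmul n)
    (fun g hg => by simpa using hA0 g (Multiset.mem_of_mem_nsmul hg)) hl1 hl2
  have h2 : (2 : ℤ) ∣ minDist ({r a, r b} : Set (DihedralGroup n)) := by
    exact_mod_cast even_iff_two_dvd.1 he
  rw [e, Multiset.card_add, Multiset.card_replicate, Multiset.card_replicate]
  exact odd_of_two_dvd_sub hodd hw₁ hw₂ (h2.trans h)

/-- If one half of an atom of reflections is a power of `sr t`, multiplying the terms of the other half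
by `sr t` gives an atom of rotations of half the length. -/
lemma isMinProdOne_map_sub {s : Finset (ZMod n)} {t : ZMod n} {Q : Multiset (ZMod n × ZMod n)}
    (hA : IsMinProdOne (signedSeq 0 0 Q)) (hsum : signedSum 0 0 Q = 0)
    (hQ : ∀ q ∈ Q, q.2 = t ∧ q.1 ∈ s ∧ q.1 ≠ t) :
    ∃ X : Multiset (ZMod n), (∀ x ∈ X, x ∈ s ∧ x ≠ t) ∧
      IsMinProdOne (X.map fun x => (r (x - t) : DihedralGroup n)) ∧
      (signedSeq 0 0 Q).card = 2 * X.card := by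
  have e : Q = (Q.map Prod.fst).map (fun x => (x, t)) := by
    rw [Multiset.map_map]
    conv_lhs => rw [← Multiset.map_id Q]
    exact Multiset.map_congr rfl fun q hq => Prod.ext rfl (hQ q hq).1
  have hX : ∀ x ∈ Q.map Prod.fst, x ∈ s ∧ x ≠ t := fun x hx => by
    obtain ⟨q, hq, rfl⟩ := Multiset.mem_map.1 hx
    exact (hQ q hq).2
  generalize Q.map Prod.fst = X at e hX
  subst e
  have hiff : ∀ X : Multiset (ZMod n), IsProdOne (X.map fun x => (r (x - t) : DihedralGroup n)) ↔
      signedSum 0 0 (X.map fun x => (x, t)) = 0 := fun X => by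
    have := isProdOne_map_r_iff (n := n) (P := X.map fun x => x - t)
    rw [Multiset.map_map] at this
    simpa [signedSum, Multiset.map_map, Function.comp_def] using this
  refine ⟨X, hX, ⟨(hiff X).2 hsum, fun h => hA.2.1 ?_, fun T U hT hU h => ?_⟩,
    by simp [card_signedSeq]⟩
  · obtain rfl := Multiset.map_eq_zero.1 h
    rfl
  · obtain ⟨X₁, X₂, rfl, rfl, rfl⟩ := exists_map_eq_of_map_eq_add h
    rw [hiff] at hT hU
    have h1 := signedSeq_add (n := n) 0 0 0 0 (X₁.map fun x => (x, t)) (X₂.map fun x => (x, t))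
    rw [← Multiset.map_add, add_zero] at h1
    refine (hA.2.2 _ _ (isProdOne_signedSeq (fun _ => rfl) hT)
      (isProdOne_signedSeq (fun _ => rfl) hU) h1).imp (fun h => ?_) (fun h => ?_) <;>
    · have := congrArg Multiset.card h
      simp only [card_signedSeq, Multiset.card_map, Multiset.card_zero] at this
      exact Multiset.map_eq_zero.2 (Multiset.card_eq_zero.1 (by lia))

/-- An atom over at most three reflections is a square, or one of the reflections makes up one of
the two halves of the alternating product; in the latter case it corresponds to a minimal
zero-sum sequence of rotations. -/
lemma IsMinProdOne.card_eq_two_or [NeZero n] {A : Multiset (DihedralGroup n)}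
    (hA : IsMinProdOne A) {s : Finset (ZMod n)} (hs : s.card ≤ 3)
    (hAs : ∀ g ∈ A, ∃ i ∈ s, g = sr i) :
    A.card = 2 ∨ ∃ t ∈ s, ∃ X : Multiset (ZMod n), (∀ x ∈ X, x ∈ s ∧ x ≠ t) ∧
      IsMinProdOne (X.map fun x => (r (x - t) : DihedralGroup n)) ∧ A.card = 2 * X.card := by
  obtain ⟨Q, rfl, hsum⟩ := hA.1.exists_signedSeq_sr fun g hg => (hAs g hg).imp fun _ h => h.2
  have hQs : ∀ q ∈ Q, q.1 ∈ s ∧ q.2 ∈ s := by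
    intro q hq
    constructor
    · obtain ⟨i, hi, h⟩ := hAs (sr q.1) (Multiset.mem_add.2 (.inr (Multiset.mem_add.2
        (.inl (Multiset.mem_map_of_mem (fun q : ZMod n × ZMod n => sr q.1) hq)))))
      exact sr.inj h ▸ hi
    · obtain ⟨i, hi, h⟩ := hAs (sr q.2) (Multiset.mem_add.2 (.inr (Multiset.mem_add.2
        (.inr (Multiset.mem_map_of_mem (fun q : ZMod n × ZMod n => sr q.2) hq)))))
      exact sr.inj h ▸ hi
  by_cases hdisj : ∀ p ∈ Q, ∀ q ∈ Q, p.1 ≠ q.2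
  · right
    have hQ0 : Q ≠ 0 := by
      rintro rfl
      exact hA.2.1 rfl
    obtain ⟨q₀, hq₀⟩ := Multiset.exists_mem_of_ne_zero hQ0
    set X := (Q.map Prod.fst).toFinset with hX
    set Y := (Q.map Prod.snd).toFinset with hY
    have hXmem : ∀ q ∈ Q, q.1 ∈ X := fun q hq => by
      rw [hX, Multiset.mem_toFinset]; exact Multiset.mem_map_of_mem _ hq
    have hYmem : ∀ q ∈ Q, q.2 ∈ Y := fun q hq => by
      rw [hY, Multiset.mem_toFinset]; exact Multiset.mem_map_of_mem _ hq
    have hXY : Disjoint X Y := by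
      rw [Finset.disjoint_left]
      intro a ha hb
      rw [hX, Multiset.mem_toFinset] at ha
      rw [hY, Multiset.mem_toFinset] at hb
      obtain ⟨p, hp, rfl⟩ := Multiset.mem_map.1 ha
      obtain ⟨q, hq, h⟩ := Multiset.mem_map.1 hb
      exact hdisj p hp q hq h.symm
    have hsub : X ∪ Y ⊆ s := by
      intro a ha
      rcases Finset.mem_union.1 ha with h | h
      · rw [hX, Multiset.mem_toFinset] at h
        obtain ⟨p, hp, rfl⟩ := Multiset.mem_map.1 h
        exact (hQs p hp).1
      · rw [hY, Multiset.mem_toFinset] at h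
        obtain ⟨p, hp, rfl⟩ := Multiset.mem_map.1 h
        exact (hQs p hp).2
    have hcard := Finset.card_le_card hsub
    rw [Finset.card_union_of_disjoint hXY] at hcard
    obtain h | h : Y.card ≤ 1 ∨ X.card ≤ 1 := by lia
    · refine ⟨q₀.2, (hQs q₀ hq₀).2, isMinProdOne_map_sub hA hsum fun q hq => ?_⟩
      exact ⟨Finset.card_le_one.1 h _ (hYmem q hq) _ (hYmem q₀ hq₀), (hQs q hq).1,
        hdisj q hq q₀ hq₀⟩
    · refine ⟨q₀.1, (hQs q₀ hq₀).1, ?_⟩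
      rw [← signedSeq_swap] at hA ⊢
      refine isMinProdOne_map_sub hA (by rw [signedSum_swap, hsum, neg_zero]) fun q hq => ?_
      obtain ⟨p, hp, rfl⟩ := Multiset.mem_map.1 hq
      exact ⟨Finset.card_le_one.1 h _ (hXmem p hp) _ (hXmem q₀ hq₀), (hQs p hp).2,
        (hdisj q₀ hq₀ p hp).symm⟩
  · left
    push Not at hdisj
    obtain ⟨p, hp, q, hq, hpq⟩ := hdisj
    -- the square `(sr p.1) ^ 2` splits off
    have key : ∀ (Q' : Multiset (ZMod n × ZMod n)), signedSeq 0 0 Q =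
        signedSeq 0 0 {(p.1, p.1)} + signedSeq 0 0 Q' → signedSum 0 0 Q' = 0 →
        (signedSeq 0 0 Q).card = 2 := by
      intro Q' h1 h2
      rcases hA.2.2 _ _ (isProdOne_signedSeq (fun _ => rfl) (by simp [signedSum]))
        (isProdOne_signedSeq (fun _ => rfl) h2) h1 with h | h
      · have := congrArg Multiset.card h
        simp [card_signedSeq] at this
      · rw [h1, h]
        simp [card_signedSeq]
    obtain ⟨Q', rfl⟩ := Multiset.exists_cons_of_mem hp
    rcases Multiset.mem_cons.1 hq with rfl | hq
    · refine key Q' ?_ ?_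
      · rw [← signedSeq_add]
        simp only [add_zero, Multiset.singleton_add]
        congr 2
        exact Prod.ext rfl hpq.symm
      · rw [← hsum]
        simp [signedSum, hpq]
    · obtain ⟨Q', rfl⟩ := Multiset.exists_cons_of_mem hq
      refine key ((q.1, p.2) ::ₘ Q') ?_ ?_
      · simp only [signedSeq, Multiset.map_cons, Multiset.map_singleton, Multiset.map_zero, ← hpq]
        simp only [← Multiset.singleton_add]
        abel
      · rw [← hsum]
        simp only [signedSum, Multiset.map_cons, Multiset.sum_cons, ← hpq]
        ring

/-- The gcd condition forces all distances over `sr 0`, `sr 1`, `sr i` to be even. -/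
lemma dvdLengths_two_of_even_gcdMinDist [NeZero n] (hodd : Odd n) (hn : 3 ≤ n) {i : ℕ}
    (hi : 2 ≤ i) (hin : i < n)
    (he : Even (gcdMinDist (r 1 : DihedralGroup n) i)) :
    DvdLengths 2 ({sr 0, sr 1, sr (i : ZMod n)} : Set (DihedralGroup n)) := by
  have hfact : Fact (1 < n) := ⟨by lia⟩
  have hi0 : (i : ZMod n) ≠ 0 := by
    rw [Ne, ZMod.natCast_eq_zero_iff]
    exact fun h => by have := Nat.le_of_dvd (by lia) h; lia
  have hi1 : (i : ZMod n) ≠ 1 := by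
    intro h
    have h' : ((i - 1 : ℕ) : ZMod n) = 0 := by
      rw [Nat.cast_sub (by lia), h]
      simp
    rw [ZMod.natCast_eq_zero_iff] at h'
    have := Nat.le_of_dvd (by lia) h'
    lia
  rw [even_iff_two_dvd, gcdMinDist, Nat.dvd_gcd_iff, Nat.dvd_gcd_iff, ← even_iff_two_dvd,
    ← even_iff_two_dvd, ← even_iff_two_dvd, r_one_pow, r_one_zpow, r_one_zpow] at he
  push_cast at he
  obtain ⟨he1, he2, he3⟩ := he
  intro S hS hS0 k hk l hl
  have h := dvd_mul_sub_of_atoms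
    (G₀ := ({sr 0, sr 1, sr (i : ZMod n)} : Set (DihedralGroup n)))
    ((Nat.castAddMonoidHom ℤ).comp Multiset.cardHom) 2 4 (fun A hA hA0 => ?_) hS0 hk hl
  · rw [show (4 : ℤ) = 2 * 2 by norm_num] at h
    exact_mod_cast Int.dvd_of_mul_dvd_mul_left (by norm_num) h
  change (4 : ℤ) ∣ (A.card : ℤ) - 2
  have hodd_half : ∀ X : Multiset (ZMod n), Odd X.card → A.card = 2 * X.card →
      (4 : ℤ) ∣ (A.card : ℤ) - 2 := by
    rintro X ⟨w, hw⟩ h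
    exact ⟨w, by rw [h, hw]; push_cast; ring⟩
  rcases hA.card_eq_two_or (s := {0, 1, (i : ZMod n)}) Finset.card_le_three (fun g hg => by
    have := hA0 g hg
    simp only [Set.mem_insert_iff, Set.mem_singleton_iff] at this
    rcases this with rfl | rfl | rfl <;> exact ⟨_, by simp, rfl⟩) with h | ⟨t, ht, X, hX, hm, hc⟩
  · rw [h]
    norm_num
  refine hodd_half X ?_ hc
  simp only [Finset.mem_insert, Finset.mem_singleton] at ht hX
  rcases ht with rfl | rfl | rfl
  · have := odd_card_of_even_minDist hodd hi1.symm he1 hm (by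
      intro g hg
      obtain ⟨x, hx, rfl⟩ := Multiset.mem_map.1 hg
      rcases hX x hx with ⟨rfl | rfl | rfl, h⟩ <;> simp_all)
    simpa using this
  · have := odd_card_of_even_minDist hodd (fun h => hi0 (by linear_combination h)) he2 hm.map_inv
      (by
        intro g hg
        rw [Multiset.map_map] at hg
        obtain ⟨x, hx, rfl⟩ := Multiset.mem_map.1 hg
        rcases hX x hx with ⟨rfl | rfl | rfl, h⟩ <;> simp_all)
    simpa using this
  · have := odd_card_of_even_minDist hodd (fun h => one_ne_zero (by linear_combination h)) he3
      hm.map_inv (by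
        intro g hg
        rw [Multiset.map_map] at hg
        obtain ⟨x, hx, rfl⟩ := Multiset.mem_map.1 hg
        rcases hX x hx with ⟨rfl | rfl | rfl, h⟩ <;> simp_all)
    simpa using this

/-! ### The case `n = m ^ 2 - m + 1` -/

/-- For `n = m ^ 2 - m + 1`, the atoms over `r g`, `r (m g)` different from powers of one element
have multiplicities `(n - m j, j)` with `j < m`, so that their lengths are odd if `m` is odd. -/
lemma odd_card_of_isMinProdOne_mul [NeZero n] (hodd : Odd n) {m : ℕ} (hm : 3 ≤ m)
    (hmo : Odd m) (hnm : n = m ^ 2 - m + 1) {g : ZMod n} (hg : IsUnit g) {u v : ℕ}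
    (hA : IsMinProdOne (Multiset.replicate u (r g : DihedralGroup n) +
      Multiset.replicate v (r ((m : ZMod n) * g)))) : Odd (u + v) := by
  have hmm : m ^ 2 = m * m := sq m
  have hle : m ≤ m * m := Nat.le_mul_self m
  have hiff : ∀ u v : ℕ, IsProdOne (Multiset.replicate u (r g : DihedralGroup n) +
      Multiset.replicate v (r ((m : ZMod n) * g))) ↔ n ∣ u + m * v := fun u v => by
    have e : (u : ZMod n) * g + v * (m * g) = ((u + m * v : ℕ) : ZMod n) * g := by
      push_cast
      ring
    rw [isProdOne_r_pair_iff, ← ZMod.natCast_eq_zero_iff, e, hg.mul_left_eq_zero]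
  -- a nonempty product-one subsequence is everything
  have hmin : ∀ u' v' : ℕ, u' ≤ u → v' ≤ v → n ∣ u' + m * v' → 0 < u' + v' →
      u' = u ∧ v' = v := by
    intro u' v' hu hv h1 h2
    have h3 : n ∣ (u - u') + m * (v - v') := by
      have h4 := (hiff u v).1 hA.1
      have e : u + m * v = (u' + m * v') + ((u - u') + m * (v - v')) := by
        obtain ⟨a, rfl⟩ := Nat.exists_eq_add_of_le hu
        obtain ⟨b, rfl⟩ := Nat.exists_eq_add_of_le hv
        simp only [Nat.add_sub_cancel_left]
        ring
      rw [e] at h4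
      exact (Nat.dvd_add_right h1).1 h4
    rcases hA.2.2 _ _ ((hiff u' v').2 h1) ((hiff _ _).2 h3) (by
      conv_lhs => rw [← Nat.sub_add_cancel hu, ← Nat.sub_add_cancel hv]
      simp only [Multiset.replicate_add]
      abel) with h | h
    · have := congrArg Multiset.card h
      simp at this
      lia
    · have := congrArg Multiset.card h
      simp at this
      lia
  have hdvd := (hiff u v).1 hA.1
  have hpos : 0 < u + v := by
    have := Multiset.card_pos.2 hA.2.1
    simpa using this
  have hmul : m * (m - 1) = m * m - m := by rw [Nat.mul_sub, mul_one]
  rcases Nat.eq_zero_or_pos u with rfl | hu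
  · have hco : Nat.Coprime n m := by
      rw [show n = m * (m - 1) + 1 by lia]
      simp
    have hv : n ∣ v := hco.dvd_of_dvd_mul_left (by simpa using hdvd)
    have hle := Nat.le_of_dvd (by lia) hv
    have := hmin 0 n le_rfl hle (by simp) (by lia)
    rw [zero_add, ← this.2]
    exact hodd
  · by_cases hv : m - 1 ≤ v
    · have := hmin 1 (m - 1) hu hv ⟨1, by lia⟩ (by lia)
      rw [show u + v = m by lia]
      exact hmo
    · by_cases hun : n ≤ u
      · have := hmin n 0 hun (Nat.zero_le _) (by simp) (by lia)
        rw [← this.1, ← this.2, add_zero]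
        exact hodd
      · obtain ⟨t, ht⟩ := hdvd
        have hmv : m * v ≤ m * (m - 1) := Nat.mul_le_mul_left m (by lia)
        have ht1 : t = 1 := by
          have h2 : 0 < n * t := by lia
          have h3 : 0 < t := Nat.pos_of_ne_zero (by rintro rfl; simp at h2)
          by_contra hne
          have h4 : n * 2 ≤ n * t := Nat.mul_le_mul_left n (by lia)
          lia
        subst ht1
        obtain ⟨w, rfl⟩ := hmo
        obtain ⟨c, rfl⟩ := hodd
        have e : (2 * w + 1) * v = 2 * (w * v) + v := by ring
        rw [e] at ht
        generalize w * v = p at ht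
        rw [Nat.odd_iff]
        lia

/-- The `n`-th power of the atom `(r g) ^ (n - m) (r (m g))` also has length `n - m + 1`, and all
atoms have odd length. -/
lemma groupDistSet_nonempty_and_even_minDist [NeZero n] (hodd : Odd n) {m : ℕ} (hm : 3 ≤ m) (hmo : Odd m)
    (hnm : n = m ^ 2 - m + 1) {g : ZMod n} (hg : IsUnit g) :
    (groupDistSet ({r g, r ((m : ZMod n) * g)} : Set (DihedralGroup n))).Nonempty ∧
      Even (minDist ({r g, r ((m : ZMod n) * g)} : Set (DihedralGroup n))) := by
  have hmm : m ^ 2 = m * m := sq m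
  have h3m : 3 * m ≤ m * m := Nat.mul_le_mul_right m hm
  have hfact : Fact (1 < n) := ⟨by lia⟩
  have hne : g ≠ (m : ZMod n) * g := by
    intro h
    have h1 : ((m - 1 : ℕ) : ZMod n) * g = 0 := by
      rw [Nat.cast_sub (by lia)]
      push_cast
      linear_combination -h
    rw [hg.mul_left_eq_zero, ZMod.natCast_eq_zero_iff] at h1
    have := Nat.le_of_dvd (by lia) h1
    lia
  have hmu : IsUnit (m : ZMod n) := by
    refine IsUnit.of_mul_eq_one (1 - m) ?_
    have : ((m ^ 2 - m + 1 : ℕ) : ZMod n) = 0 := by rw [← hnm, ZMod.natCast_self]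
    rw [Nat.cast_add, Nat.cast_sub (by lia)] at this
    push_cast at this
    linear_combination -this
  have hiff : ∀ u v : ℕ, IsProdOne (Multiset.replicate u (r g : DihedralGroup n) +
      Multiset.replicate v (r ((m : ZMod n) * g))) ↔ n ∣ u + m * v := fun u v => by
    have e : (u : ZMod n) * g + v * (m * g) = ((u + m * v : ℕ) : ZMod n) * g := by
      push_cast
      ring
    rw [isProdOne_r_pair_iff, ← ZMod.natCast_eq_zero_iff, e, hg.mul_left_eq_zero]
  have hA : IsMinProdOne (Multiset.replicate (n - m) (r g : DihedralGroup n) +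
      Multiset.replicate 1 (r ((m : ZMod n) * g))) := by
    refine ⟨(hiff _ _).2 ⟨1, by lia⟩, by simp, fun T U hT hU h => ?_⟩
    obtain ⟨u₁, v₁, u₂, v₂, hu, hv, rfl, rfl⟩ := exists_replicate_of_add_eq h
    rw [hiff] at hT hU
    have key : ∀ u : ℕ, u ≤ n - m → n ∣ u + m * 0 → u = 0 := by
      intro u hu h
      rw [mul_zero, add_zero] at h
      by_contra h0
      have := Nat.le_of_dvd (by lia) h
      lia
    obtain ⟨rfl, rfl⟩ | ⟨rfl, rfl⟩ : v₁ = 0 ∧ v₂ = 1 ∨ v₁ = 1 ∧ v₂ = 0 := by lia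
    · obtain rfl := key u₁ (by lia) hT
      simp
    · obtain rfl := key u₂ (by lia) hU
      simp
  have hl1 := mul_mem_lengths_nsmul hA.one_mem_lengths n
  have hl2 := add_mem_lengths
    (mul_mem_lengths_nsmul (isMinProdOne_replicate_r g).one_mem_lengths (n - m))
    (isMinProdOne_replicate_r ((m : ZMod n) * g)).one_mem_lengths
  rw [addOrderOf_eq_iff_isUnit.2 hg, addOrderOf_eq_iff_isUnit.2 (hmu.mul hg), mul_one] at hl2
  have e : n • (Multiset.replicate (n - m) (r g : DihedralGroup n) +
      Multiset.replicate 1 (r ((m : ZMod n) * g))) =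
      (n - m) • Multiset.replicate n (r g) + Multiset.replicate n (r ((m : ZMod n) * g)) := by
    rw [nsmul_add, Multiset.nsmul_replicate, Multiset.nsmul_replicate, Multiset.nsmul_replicate,
      mul_comm, mul_one]
  rw [mul_one, e] at hl1
  have hmem : ∀ h ∈ (n - m) • Multiset.replicate n (r g : DihedralGroup n) +
      Multiset.replicate n (r ((m : ZMod n) * g)),
      h ∈ ({r g, r ((m : ZMod n) * g)} : Set (DihedralGroup n)) := by
    intro h hh
    rw [Multiset.nsmul_replicate, Multiset.mem_add] at hh
    simpa using hh.imp Multiset.eq_of_mem_replicate Multiset.eq_of_mem_replicate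
  have hdist : (groupDistSet ({r g, r ((m : ZMod n) * g)} : Set (DihedralGroup n))).Nonempty := by
    rw [groupDistSet_eq_distOver]
    exact distOver_nonempty (e ▸ hA.1.nsmul n) hmem hl1 hl2 (by lia)
  refine ⟨hdist, ?_⟩
  have hmin := Nat.sInf_mem hdist
  rw [minDist]
  generalize sInf (groupDistSet ({r g, r ((m : ZMod n) * g)} : Set (DihedralGroup n))) = d at hmin
  rw [groupDistSet_eq_distOver] at hmin
  obtain ⟨S, hS, hS0, hd⟩ := hmin
  obtain ⟨a, ha, hda⟩ := exists_mem_of_mem_distances hd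
  have := dvd_mul_sub_of_atoms (G₀ := ({r g, r ((m : ZMod n) * g)} : Set (DihedralGroup n)))
    ((Nat.castAddMonoidHom ℤ).comp Multiset.cardHom) 1 2 (fun A hA hA0 => by
      change (2 : ℤ) ∣ (A.card : ℤ) - 1
      have e := eq_replicate_add_replicate (a := (r g : DihedralGroup n)) (b := r ((m : ZMod n) * g))
        (by simpa using hne) (by simpa using hA0)
      rw [e] at hA
      obtain ⟨w, hw⟩ := odd_card_of_isMinProdOne_mul hodd hm hmo hnm hg hA
      rw [e, Multiset.card_add, Multiset.card_replicate, Multiset.card_replicate, hw]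
      exact ⟨w, by push_cast; ring⟩) hS0 hda ha
  rw [even_iff_two_dvd]
  push_cast at this
  lia

end Parity

/-! ### Elasticity of the monoid of product-one sequences over a dihedral group -/

lemma mem_sum_iff {α : Type*} {a : α} {Z : Multiset (Multiset α)} :
    a ∈ Z.sum ↔ ∃ A ∈ Z, a ∈ A := Multiset.mem_join

lemma IsMinProdOne.eq_singleton_one {G : Type*} [Group G] {A : Multiset G}
    (hA : IsMinProdOne A) (h1 : (1 : G) ∈ A) : A = {1} := by
  obtain ⟨l, rfl, hl⟩ := hA.1
  obtain ⟨l₁, l₂, rfl⟩ := List.append_of_mem (Multiset.mem_coe.1 h1)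
  have h := hA.2.2 {1} ((l₁ ++ l₂ : List G) : Multiset G) (isProdOne_singleton.2 rfl)
    ⟨_, rfl, by simpa using hl⟩ (by
      rw [Multiset.singleton_add, Multiset.cons_coe, Multiset.coe_eq_coe]
      exact List.perm_middle)
  rcases h with h | h
  · simp at h
  · rw [Multiset.coe_eq_coe.2 List.perm_middle, ← Multiset.cons_coe, h]
    rfl

lemma IsMinProdOne.two_le_card {G : Type*} [Group G] {A : Multiset G} (hA : IsMinProdOne A)
    (h1 : (1 : G) ∉ A) : 2 ≤ A.card := by
  have h0 := Multiset.card_pos.2 hA.2.1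
  by_contra! hlt
  obtain ⟨g, rfl⟩ := Multiset.card_eq_one.1 (by lia : A.card = 1)
  have := isProdOne_singleton.1 hA.1
  simp [this] at h1

lemma IsMinProdOne.eq_pair {G : Type*} [Group G] {A : Multiset G} (hA : IsMinProdOne A)
    (hc : A.card = 2) : ∃ g, A = {g, g⁻¹} := by
  obtain ⟨l, rfl, hl⟩ := hA.1
  match l, hc with
  | [a, b], _ =>
    rw [List.prod_cons, List.prod_singleton] at hl
    refine ⟨a, ?_⟩
    rw [← eq_inv_of_mul_eq_one_right hl]
    rfl

section Elasticity

variable {n : ℕ}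

/-- The length of a sequence, where the identity element counts twice. With this weight the
atom `1` behaves like the atoms of length two. -/
def weight (A : Multiset (DihedralGroup n)) : ℕ := A.card + A.count 1

lemma weight_add (A B : Multiset (DihedralGroup n)) : weight (A + B) = weight A + weight B := by
  simp only [weight, Multiset.card_add, Multiset.count_add]
  lia

lemma IsMinProdOne.two_le_weight {A : Multiset (DihedralGroup n)} (hA : IsMinProdOne A) :
    2 ≤ weight A := by
  by_cases h1 : (1 : DihedralGroup n) ∈ A
  · simp [weight, hA.eq_singleton_one h1]
  · have := hA.two_le_card h1
    rw [weight]
    lia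

lemma IsMinProdOne.weight_le [NeZero n] {A : Multiset (DihedralGroup n)}
    (hA : IsMinProdOne A) : weight A ≤ 2 * n := by
  have := NeZero.pos n
  by_cases h1 : (1 : DihedralGroup n) ∈ A
  · simp only [weight, hA.eq_singleton_one h1, Multiset.card_singleton,
      Multiset.count_singleton_self]
    lia
  · rw [weight, Multiset.count_eq_zero.2 h1]
    exact hA.card_le

lemma two_mul_card_le_weight {Z : Multiset (Multiset (DihedralGroup n))}
    (hZ : ∀ A ∈ Z, IsMinProdOne A) : 2 * Z.card ≤ weight Z.sum := by
  induction Z using Multiset.induction with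
  | empty => simp
  | cons A Z ih =>
    have h1 := ih fun B hB => hZ B (Multiset.mem_cons_of_mem hB)
    have h2 := (hZ A (by simp)).two_le_weight
    rw [Multiset.card_cons, Multiset.sum_cons, weight_add]
    lia

lemma weight_le_mul_card [NeZero n] {Z : Multiset (Multiset (DihedralGroup n))}
    (hZ : ∀ A ∈ Z, IsMinProdOne A) : weight Z.sum ≤ 2 * n * Z.card := by
  induction Z using Multiset.induction with
  | empty => simp [weight]
  | cons A Z ih =>
    have h1 := ih fun B hB => hZ B (Multiset.mem_cons_of_mem hB)
    have h2 := (hZ A (by simp)).weight_le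
    rw [Multiset.card_cons, Multiset.sum_cons, weight_add, mul_add]
    lia

lemma le_mul_of_mem_lengths [NeZero n] {S : Multiset (DihedralGroup n)} {k l : ℕ}
    (hk : k ∈ lengths S) (hl : l ∈ lengths S) : l ≤ n * k := by
  obtain ⟨Z, hZ, hZS, rfl⟩ := hk
  obtain ⟨Z', hZ', hZS', rfl⟩ := hl
  have h1 := weight_le_mul_card hZ
  have h2 := two_mul_card_le_weight hZ'
  rw [hZS] at h1
  rw [hZS', mul_comm 2] at h2
  rw [mul_assoc] at h1
  lia

/-- If `S` has maximal elasticity, then `S` is a product of atoms of length `2 n` as well as a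
product of atoms of length `2`. -/
lemma exists_of_mem_lengths [NeZero n] (hn : 2 ≤ n) {S : Multiset (DihedralGroup n)} {k : ℕ}
    (hk : k ∈ lengths S) (hnk : n * k ∈ lengths S) :
    ∃ Z Z' : Multiset (Multiset (DihedralGroup n)), Z.card = k ∧ Z.sum = S ∧ Z'.sum = S ∧
      (∀ A ∈ Z, IsMinProdOne A ∧ A.card = 2 * n) ∧ ∀ A ∈ Z', ∃ g, A = {g, g⁻¹} := by
  obtain ⟨Z, hZ, hZS, rfl⟩ := hk
  obtain ⟨Z', hZ', hZS', hc⟩ := hnk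
  have h1 := weight_le_mul_card hZ
  have h2 := two_mul_card_le_weight hZ'
  rw [hZS, mul_assoc] at h1
  rw [hZS', hc] at h2
  have hw : weight S = 2 * (n * Z.card) := by lia
  have hZ1 : ∀ A ∈ Z, weight A = 2 * n := by
    intro A hA
    obtain ⟨W, rfl⟩ := Multiset.exists_cons_of_mem hA
    have h3 := weight_le_mul_card fun B hB => hZ B (Multiset.mem_cons_of_mem hB)
    have h4 := (hZ A hA).weight_le
    rw [← hZS, Multiset.sum_cons, weight_add, Multiset.card_cons] at hw
    have e : 2 * (n * (W.card + 1)) = 2 * n * W.card + 2 * n := by ring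
    lia
  have hZ2 : ∀ A ∈ Z', weight A = 2 := by
    intro A hA
    obtain ⟨W, rfl⟩ := Multiset.exists_cons_of_mem hA
    have h3 := two_mul_card_le_weight fun B hB => hZ' B (Multiset.mem_cons_of_mem hB)
    have h4 := (hZ' A hA).two_le_weight
    rw [← hZS', Multiset.sum_cons, weight_add] at hw
    rw [Multiset.card_cons] at hc
    lia
  have hone : ∀ A ∈ Z, (1 : DihedralGroup n) ∉ A := by
    intro A hA h1
    have := hZ1 A hA
    simp only [weight, (hZ A hA).eq_singleton_one h1, Multiset.card_singleton,
      Multiset.count_singleton_self] at this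
    lia
  have hone' : (1 : DihedralGroup n) ∉ S := by
    rw [← hZS, mem_sum_iff]
    rintro ⟨A, hA, h⟩
    exact hone A hA h
  refine ⟨Z, Z', rfl, hZS, hZS', fun A hA => ⟨hZ A hA, ?_⟩, fun A hA => (hZ' A hA).eq_pair ?_⟩
  · rw [← hZ1 A hA, weight, Multiset.count_eq_zero.2 (hone A hA), add_zero]
  · rw [← hZ2 A hA, weight, Multiset.count_eq_zero.2, add_zero]
    intro h1
    apply hone'
    rw [← hZS', mem_sum_iff]
    exact ⟨A, hA, h1⟩

lemma IsMinProdOne.card_mem_lengths {G : Type*} [Group G] {A : Multiset G}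
    (hA : IsMinProdOne A) (hc : 2 ≤ A.card) : A.card ∈ lengths (A + A.map (·⁻¹)) := by
  refine card_mem_lengths_add_map_inv fun g hg h => ?_
  subst h
  rw [hA.eq_singleton_one hg, Multiset.card_singleton] at hc
  lia

/-- The elasticity `n` is attained by an atom of length `2 n` times its inverse. -/
lemma monoidElasticity_productOneMonoid [NeZero n] (hodd : Odd n) (hn : 3 ≤ n) :
    monoidElasticity (productOneMonoid (Set.univ : Set (DihedralGroup n))) = n := by
  refine le_antisymm (iSup_le fun a => ?_) ?_
  · rw [lengthSet_eq_lengths_coe]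
    exact elasticity_le (by lia) fun k hk l hl => le_mul_of_mem_lengths hk hl
  · have hfact : Fact (1 < n) := ⟨by lia⟩
    obtain ⟨A, hA, hc⟩ : ∃ A : Multiset (DihedralGroup n), IsMinProdOne A ∧ A.card = n * 2 :=
      ⟨_, isMinProdOne_rotations_sr hn hodd (g := 1) isUnit_one 0, by
        rw [Multiset.card_add, Multiset.card_replicate, Multiset.card_replicate]; lia⟩
    have h2 := hA.card_mem_lengths (by lia)
    rw [hc] at h2
    refine le_iSup_of_le (⟨Multiplicative.ofAdd (A + A.map (·⁻¹)), fun _ _ => trivial,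
      isProdOne_add_map_inv A⟩ : productOneMonoid (Set.univ : Set (DihedralGroup n))) ?_
    rw [lengthSet_eq_lengths_coe]
    exact le_elasticity (by lia) (by lia) hA.two_mem_lengths h2

/-- A sequence has maximal elasticity if and only if it has lengths `k > 0` and `n k`. -/
lemma mem_groupDeltaStarRho_iff [NeZero n] (hodd : Odd n) (hn : 3 ≤ n) {d : ℕ} :
    d ∈ groupDeltaStarRho (DihedralGroup n) ↔ ∃ S : Multiset (DihedralGroup n), IsProdOne S ∧
      (∃ k, 0 < k ∧ k ∈ lengths S ∧ n * k ∈ lengths S) ∧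
      IsLeast (distOver {g | g ∈ S}) d := by
  constructor
  · rintro ⟨a, h1, h2⟩
    rw [monoidElasticity_productOneMonoid hodd hn, lengthSet_eq_lengths_coe] at h1
    rw [distSet_divisorClosure] at h2
    exact ⟨_, a.2.2, exists_of_elasticity_eq (by lia)
      (fun k hk l hl => le_mul_of_mem_lengths hk hl) h1, h2⟩
  · rintro ⟨S, hS, ⟨k, hk, hk1, hk2⟩, hd⟩
    refine ⟨⟨Multiplicative.ofAdd S, fun _ _ => trivial, hS⟩, ?_, ?_⟩
    · rw [monoidElasticity_productOneMonoid hodd hn, lengthSet_eq_lengths_coe]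
      exact le_antisymm (elasticity_le (by lia) fun k hk l hl => le_mul_of_mem_lengths hk hl)
        (le_elasticity hk (by lia) hk1 hk2)
    · rw [distSet_divisorClosure]
      exact hd

end Elasticity

/-! ### The set of minimal distances -/

section Main

variable {n d : ℕ}

lemma DvdLengths.of_isLeast {G : Type*} [Group G] {G₀ : Set G} (hd : IsLeast (distOver G₀) d) :
    DvdLengths d G₀ :=
  fun _ hS hS0 _ hk _ hl => dvd_sub_of_isLeast hd hS hS0 hk hl

lemma DvdLengths.dvd_of_mem_distOver {G : Type*} [Group G] {G₀ : Set G} {e : ℕ}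
    (hd : DvdLengths d G₀) (he : e ∈ distOver G₀) : d ∣ e := by
  obtain ⟨S, hS, hS0, he⟩ := he
  obtain ⟨a, ha, hae⟩ := exists_mem_of_mem_distances he
  have := hd S hS hS0 _ hae _ ha
  push_cast at this
  rw [add_sub_cancel_left] at this
  exact_mod_cast this

lemma DvdLengths.mono {G : Type*} [Group G] {G₀ G₁ : Set G} (hd : DvdLengths d G₁)
    (h : G₀ ⊆ G₁) : DvdLengths d G₀ :=
  fun S hS hS0 => hd S hS fun g hg => h (hS0 g hg)

/-- An atom `A` such that `G₀` contains its terms and their inverses: `A` times its inverse has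
the lengths `2` and `A.card`. -/
lemma DvdLengths.dvd_card_sub_two {G : Type*} [Group G] {G₀ : Set G} (hd : DvdLengths d G₀)
    {A : Multiset G} (hA : IsMinProdOne A) (hc : 2 ≤ A.card) (h : ∀ g ∈ A, g ∈ G₀ ∧ g⁻¹ ∈ G₀) :
    d ∣ A.card - 2 := by
  have := hd _ (isProdOne_add_map_inv A) (fun g hg => by
    rcases Multiset.mem_add.1 hg with hg | hg
    · exact (h g hg).1
    · obtain ⟨x, hx, rfl⟩ := Multiset.mem_map.1 hg
      exact (h x hx).2) _ (hA.card_mem_lengths hc) _ hA.two_mem_lengths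
  rw [← Nat.cast_sub hc] at this
  exact_mod_cast this

/-- The lengths `2` and `A.card` of `A` times its inverse differ. -/
lemma exists_isLeast {G : Type*} [Group G] {A : Multiset G} (hA : IsMinProdOne A)
    (hc : 3 ≤ A.card) {G₀ : Set G} (h : ∀ g ∈ A, g ∈ G₀ ∧ g⁻¹ ∈ G₀) :
    ∃ d, 0 < d ∧ IsLeast (distOver G₀) d := by
  have hne := distOver_nonempty (isProdOne_add_map_inv A) (fun g hg => by
    rcases Multiset.mem_add.1 hg with hg | hg
    · exact (h g hg).1
    · obtain ⟨x, hx, rfl⟩ := Multiset.mem_map.1 hg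
      exact (h x hx).2) (hA.card_mem_lengths (by lia)) hA.two_mem_lengths (by lia)
  have hmem := Nat.sInf_mem hne
  obtain ⟨S, -, -, hd⟩ := id hmem
  exact ⟨sInf (distOver G₀), hd.1, hmem, fun x hx => Nat.sInf_le hx⟩

/-- The atoms `(r g) ^ n` and `(r g) ^ (2 n - 2) (sr x) ^ 2`, times their inverses, give the differences
`n - 2` and `2 n - 2` of lengths, which are coprime for odd `n`. -/
lemma DvdLengths.dvd_one [NeZero n] (hodd : Odd n) (hn : 3 ≤ n) {G₀ : Set (DihedralGroup n)}
    (hd : DvdLengths d G₀) {g x : ZMod n} (hg : IsUnit g) (h1 : r g ∈ G₀) (h2 : r (-g) ∈ G₀)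
    (h3 : sr x ∈ G₀) : d ∣ 1 := by
  have hA := hd.dvd_card_sub_two (isMinProdOne_rotations_sr hn hodd hg x) (by simp) (by
    intro a ha
    rcases Multiset.mem_add.1 ha with ha | ha
    · obtain rfl := Multiset.eq_of_mem_replicate ha
      exact ⟨h1, by simpa using h2⟩
    · obtain rfl := Multiset.eq_of_mem_replicate ha
      exact ⟨h3, by simpa using h3⟩)
  have hB := hd.dvd_card_sub_two (isMinProdOne_replicate_r g) (by
      rw [Multiset.card_replicate, addOrderOf_eq_iff_isUnit.2 hg]; lia) (by
    intro a ha
    obtain rfl := Multiset.eq_of_mem_replicate ha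
    exact ⟨h1, by simpa using h2⟩)
  rw [Multiset.card_add, Multiset.card_replicate, Multiset.card_replicate] at hA
  rw [Multiset.card_replicate, addOrderOf_eq_iff_isUnit.2 hg] at hB
  obtain ⟨w, rfl⟩ := hodd
  have hC := Nat.dvd_sub hA (hB.mul_right 2)
  rw [show 2 * (2 * w + 1) - 2 + 2 - 2 - (2 * w + 1 - 2) * 2 = 2 by lia] at hC
  have hD := Nat.dvd_sub hB (hC.mul_right (w - 1))
  rwa [show 2 * w + 1 - 2 - 2 * (w - 1) = 1 by lia] at hD

/-- An atom `A` of length `2 n` times its inverse has the lengths `2` and `2 n`, hence maximal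
elasticity. -/
lemma mem_groupDeltaStarRho_of_atom [NeZero n] (hodd : Odd n) (hn : 3 ≤ n)
    {A : Multiset (DihedralGroup n)} (hA : IsMinProdOne A) (hc : A.card = 2 * n) {e : ℕ}
    (h : ∀ d, 0 < d → IsLeast (distOver {g | g ∈ A + A.map (·⁻¹)}) d → d = e) :
    e ∈ groupDeltaStarRho (DihedralGroup n) := by
  obtain ⟨d, hd0, hd⟩ := exists_isLeast hA (by lia) (G₀ := {g | g ∈ A + A.map (·⁻¹)})
    fun g hg => ⟨Multiset.mem_add.2 (.inl hg),
      Multiset.mem_add.2 (.inr (Multiset.mem_map_of_mem (·⁻¹) hg))⟩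
  rw [← h d hd0 hd, mem_groupDeltaStarRho_iff hodd hn]
  refine ⟨_, isProdOne_add_map_inv A, ⟨2, by lia, hA.two_mem_lengths, ?_⟩, hd⟩
  rw [mul_comm, ← hc]
  exact hA.card_mem_lengths (by lia)

lemma one_mem_groupDeltaStarRho [NeZero n] (hodd : Odd n) (hn : 3 ≤ n) :
    1 ∈ groupDeltaStarRho (DihedralGroup n) := by
  have hfact : Fact (1 < n) := ⟨by lia⟩
  refine mem_groupDeltaStarRho_of_atom hodd hn
    (isMinProdOne_rotations_sr hn hodd (g := 1) isUnit_one 0) (by simp; lia) fun d _ hd => ?_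
  have h0 : 2 * n - 2 ≠ 0 := by lia
  exact Nat.dvd_one.1 ((DvdLengths.of_isLeast hd).dvd_one hodd hn (g := 1) (x := 0) isUnit_one
    (by simp [Multiset.mem_replicate, h0]) (by simp [Multiset.mem_replicate, h0])
    (by simp [Multiset.mem_replicate]))

lemma eq_of_isLeast_sr_pair [NeZero n] (hodd : Odd n) (hn : 3 ≤ n) {x y : ZMod n}
    (hxy : IsUnit (x - y)) {G₀ : Set (DihedralGroup n)} (hx : sr x ∈ G₀) (hy : sr y ∈ G₀)
    (h0 : G₀ ⊆ {sr x, sr y}) (hd : IsLeast (distOver G₀) d) : d = 2 * n - 2 := by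
  have hne : x ≠ y := by
    have : Fact (1 < n) := ⟨by lia⟩
    rintro rfl
    simp at hxy
  refine Nat.dvd_antisymm ?_
    (((dvdLengths_sr_pair hodd hn hxy).mono h0).dvd_of_mem_distOver hd.1)
  have hA := isMinProdOne_sr_pair hodd hne
  rw [addOrderOf_eq_iff_isUnit.2 hxy] at hA
  have := (DvdLengths.of_isLeast hd).dvd_card_sub_two hA (by simp; lia) (by
    intro a ha
    rcases Multiset.mem_add.1 ha with ha | ha
    · obtain rfl := Multiset.eq_of_mem_replicate ha
      exact ⟨hx, by simpa using hx⟩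
    · obtain rfl := Multiset.eq_of_mem_replicate ha
      exact ⟨hy, by simpa using hy⟩)
  rwa [Multiset.card_add, Multiset.card_replicate, Multiset.card_replicate, ← two_mul] at this

lemma two_mul_sub_two_mem_groupDeltaStarRho [NeZero n] (hodd : Odd n) (hn : 3 ≤ n) :
    2 * n - 2 ∈ groupDeltaStarRho (DihedralGroup n) := by
  have hfact : Fact (1 < n) := ⟨by lia⟩
  have h1 : IsUnit ((0 : ZMod n) - 1) := by simp
  have hA := isMinProdOne_sr_pair (n := n) hodd (x := 0) (y := 1) zero_ne_one
  rw [addOrderOf_eq_iff_isUnit.2 h1] at hA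
  have h0 : n ≠ 0 := by lia
  refine mem_groupDeltaStarRho_of_atom hodd hn hA (by simp; lia) fun d _ hd =>
    eq_of_isLeast_sr_pair hodd hn h1 ?_ ?_ ?_ hd
  · simp [Multiset.mem_replicate, h0]
  · simp [Multiset.mem_replicate, h0]
  · intro g hg
    simp only [Set.mem_ofPred_eq, Multiset.mem_add, Multiset.map_add, Multiset.map_replicate,
      Multiset.mem_replicate, inv_sr] at hg
    simp only [Set.mem_insert_iff, Set.mem_singleton_iff]
    tauto

/-- The support of a sequence of maximal elasticity contains the terms of an atom of length `2 n` and
is closed under inversion, since the sequence is also a product of atoms of length `2`. -/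
theorem bound_of_mem_groupDeltaStarRho [NeZero n] (hodd : Odd n) (hn : 3 ≤ n)
    (hd : d ∈ groupDeltaStarRho (DihedralGroup n)) (hne : d ≠ 2 * n - 2) :
    d ≤ 1 ∨ 4 * d ≤ n - 1 ∨ (n = 7 ∧ d = 2) := by
  obtain ⟨S, hS, ⟨k, hk0, hk, hnk⟩, hleast⟩ := (mem_groupDeltaStarRho_iff hodd hn).1 hd
  have hdvd := DvdLengths.of_isLeast hleast
  obtain ⟨Z, Z', rfl, hZS, hZS', hZ, hZ'⟩ := exists_of_mem_lengths (by lia) hk hnk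
  have hmemS : ∀ A ∈ Z, ∀ g ∈ A, g ∈ S := fun A hA g hg => by
    rw [← hZS, mem_sum_iff]
    exact ⟨A, hA, hg⟩
  have hinv : ∀ g ∈ S, g⁻¹ ∈ S := by
    intro g hg
    rw [← hZS', mem_sum_iff] at hg ⊢
    obtain ⟨A, hA, hg⟩ := hg
    refine ⟨A, hA, ?_⟩
    obtain ⟨a, rfl⟩ := hZ' A hA
    simp only [Multiset.insert_eq_cons, Multiset.mem_cons, Multiset.mem_singleton] at hg ⊢
    rcases hg with rfl | rfl
    · exact .inr rfl
    · exact .inl (inv_inv a)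
  have h0 : n ≠ 0 := by lia
  by_cases hrot : ∃ A ∈ Z, ∃ g x : ZMod n, IsUnit g ∧
      A = Multiset.replicate (2 * n - 2) (r g) + Multiset.replicate 2 (sr x)
  · left
    obtain ⟨A, hA, g, x, hg, rfl⟩ := hrot
    have h20 : 2 * n - 2 ≠ 0 := by lia
    have h1 : r g ∈ S := hmemS _ hA _ (by simp [Multiset.mem_replicate, h20])
    refine (Nat.dvd_one.1 (hdvd.dvd_one hodd hn hg (x := x) h1 ?_ ?_)).le
    · simpa using hinv _ h1
    · exact hmemS _ hA _ (by simp [Multiset.mem_replicate])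
  · have hrefl : ∀ A ∈ Z, ∃ x y : ZMod n, IsUnit (x - y) ∧
        A = Multiset.replicate n (sr x) + Multiset.replicate n (sr y) := fun A hA => by
      rcases (hZ A hA).1.eq_of_card_eq hn (hZ A hA).2 with ⟨g, x, h⟩ | h
      · exact absurd ⟨A, hA, g, x, h⟩ hrot
      · exact h
    obtain ⟨A, hA⟩ := Multiset.card_pos_iff_exists_mem.1 hk0
    obtain ⟨x, y, hxy, rfl⟩ := hrefl A hA
    have hx : sr x ∈ S := hmemS _ hA _ (by simp [Multiset.mem_replicate, h0])
    have hy : sr y ∈ S := hmemS _ hA _ (by simp [Multiset.mem_replicate, h0])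
    by_cases hsub : ∀ g ∈ S, g = sr x ∨ g = sr y
    · exact absurd (eq_of_isLeast_sr_pair hodd hn hxy hx hy
        (fun g hg => by simpa using hsub g hg) hleast) hne
    · push Not at hsub
      obtain ⟨g, hg, hgx, hgy⟩ := hsub
      have hg' := hg
      rw [← hZS, mem_sum_iff] at hg'
      obtain ⟨B, hB, hgB⟩ := hg'
      obtain ⟨u, v, -, rfl⟩ := hrefl B hB
      obtain ⟨z, rfl⟩ : ∃ z, g = sr z := by
        rcases Multiset.mem_add.1 hgB with h | h <;> exact ⟨_, Multiset.eq_of_mem_replicate h⟩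
      have := hdvd.bound_of_triple hodd hn (x := x) (y := y) (z := z) hx hy hg hxy
        (fun h => hgx (by rw [h])) (fun h => hgy (by rw [h]))
      by_cases h1 : d ≤ 1
      · exact .inl h1
      by_cases h2 : 4 * d ≤ n - 1
      · exact .inr (.inl h2)
      exact .inr (.inr (this (by lia) (by lia)))

/-- The support `{sr 0, sr 1, sr i}` realizes an even minimal distance, which divides
`2 (i - 1)` and is therefore different from `2 n - 2`. -/
theorem ssubset_of_even_gcdMinDist [NeZero n] (hodd : Odd n) (hn : 3 ≤ n) {i : ℕ} (hi : 2 ≤ i)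
    (hin : i < n) (hco : Nat.gcd i n = 1) (he : Even (gcdMinDist (r 1 : DihedralGroup n) i)) :
    ({1, 2 * n - 2} : Set ℕ) ⊂ groupDeltaStarRho (DihedralGroup n) := by
  have hfact : Fact (1 < n) := ⟨by lia⟩
  have h1 : IsUnit ((0 : ZMod n) - 1) := by simp
  have hiu : IsUnit (i : ZMod n) := (ZMod.isUnit_iff_coprime i n).2 hco
  have h2 : IsUnit ((0 : ZMod n) - i) := by simpa using hiu
  have hA := isMinProdOne_sr_pair (n := n) hodd (x := 0) (y := 1) zero_ne_one
  have hB := isMinProdOne_sr_pair (n := n) hodd (x := 0) (y := i) (fun h => by simp [← h] at hiu)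
  rw [addOrderOf_eq_iff_isUnit.2 h1] at hA
  rw [addOrderOf_eq_iff_isUnit.2 h2] at hB
  generalize hAdef : Multiset.replicate n (sr 0 : DihedralGroup n) + Multiset.replicate n (sr 1) =
    A at hA
  generalize hBdef : Multiset.replicate n (sr 0 : DihedralGroup n) +
    Multiset.replicate n (sr (i : ZMod n)) = B at hB
  have hcA : A.card = 2 * n := by rw [← hAdef]; simp; lia
  have hcB : B.card = 2 * n := by rw [← hBdef]; simp; lia
  set S := (A + A.map (·⁻¹)) + (B + B.map (·⁻¹)) with hS
  have h0 : n ≠ 0 := by lia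
  have hmem : ∀ g, g ∈ S ↔ g = sr 0 ∨ g = sr 1 ∨ g = sr (i : ZMod n) := by
    intro g
    rw [hS, ← hAdef, ← hBdef]
    simp only [Multiset.mem_add, Multiset.map_add, Multiset.map_replicate,
      Multiset.mem_replicate, inv_sr]
    tauto
  have hset : {g | g ∈ S} = ({sr 0, sr 1, sr (i : ZMod n)} : Set (DihedralGroup n)) := by
    ext g
    simpa using hmem g
  have hPO : IsProdOne S := (isProdOne_add_map_inv A).add (isProdOne_add_map_inv B)
  have hl1 := add_mem_lengths hA.two_mem_lengths hB.two_mem_lengths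
  have hl2 := add_mem_lengths (hA.card_mem_lengths (by lia)) (hB.card_mem_lengths (by lia))
  rw [hcA, hcB, show 2 * n + 2 * n = n * 4 by lia] at hl2
  obtain ⟨d, hd0, hd⟩ := exists_isLeast hA (by lia) (G₀ := {g | g ∈ S}) fun g hg =>
    ⟨by simp [hS, hg], by simp [hS, hg]⟩
  have hdmem : d ∈ groupDeltaStarRho (DihedralGroup n) :=
    (mem_groupDeltaStarRho_iff hodd hn).2 ⟨S, hPO, ⟨4, by lia, hl1, hl2⟩, hd⟩
  have hd2 : 2 ∣ d := by
    have := dvdLengths_two_of_even_gcdMinDist hodd hn hi hin he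
    rw [← hset] at this
    exact this.dvd_of_mem_distOver hd.1
  have hdi : (d : ℤ) ∣ 2 * (i - 1) := (DvdLengths.of_isLeast hd).dvd_triple hodd
    (x := 0) (y := 1) (z := i) ((hmem _).2 (.inl rfl)) ((hmem _).2 (.inr (.inl rfl)))
    ((hmem _).2 (.inr (.inr rfl))) (by simp) hi hin (by simp)
  have hle := Int.le_of_dvd (by lia) hdi
  rw [Set.ssubset_iff_of_subset]
  · refine ⟨d, hdmem, ?_⟩
    simp only [Set.mem_insert_iff, Set.mem_singleton_iff]
    lia
  · rintro x (rfl | rfl)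
    · exact one_mem_groupDeltaStarRho hodd hn
    · exact two_mul_sub_two_mem_groupDeltaStarRho hodd hn

/-- The choice `i = m` works: `m` is a primitive sixth root of unity modulo `n`, so that
multiplication by a unit maps each of the three sets to one of the form `{g, m g}`. -/
theorem exists_even_gcdMinDist [NeZero n] (hodd : Odd n) {m : ℕ} (hm : 3 ≤ m) (hmo : Odd m)
    (hnm : n = m ^ 2 - m + 1) :
    ∃ i : ℕ, 2 ≤ i ∧ i ≤ n - 1 ∧ Nat.gcd i n = 1 ∧
      (groupDistSet {(r 1 : DihedralGroup n), r 1 ^ i}).Nonempty ∧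
      (groupDistSet {(r 1 : DihedralGroup n), r 1 ^ (1 - (i : ℤ))}).Nonempty ∧
      (groupDistSet {(r 1 : DihedralGroup n) ^ i, r 1 ^ ((i : ℤ) - 1)}).Nonempty ∧
      Even (gcdMinDist (r 1 : DihedralGroup n) i) := by
  have hmm : m ^ 2 = m * m := sq m
  have h3m : 3 * m ≤ m * m := Nat.mul_le_mul_right m hm
  have h0 : (m : ZMod n) * (1 - m) = 1 := by
    have : ((m ^ 2 - m + 1 : ℕ) : ZMod n) = 0 := by rw [← hnm, ZMod.natCast_self]
    rw [Nat.cast_add, Nat.cast_sub (by lia)] at this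
    push_cast at this
    linear_combination -this
  have hmu : IsUnit (m : ZMod n) := IsUnit.of_mul_eq_one _ h0
  have hmu' : IsUnit (1 - m : ZMod n) := IsUnit.of_mul_eq_one m (by rw [mul_comm]; exact h0)
  obtain ⟨a1, a2⟩ := groupDistSet_nonempty_and_even_minDist hodd hm hmo hnm (g := 1) isUnit_one
  obtain ⟨b1, b2⟩ := groupDistSet_nonempty_and_even_minDist hodd hm hmo hnm hmu'
  obtain ⟨c1, c2⟩ := groupDistSet_nonempty_and_even_minDist hodd hm hmo hnm hmu
  rw [mul_one] at a1 a2
  rw [h0, Set.pair_comm] at b1 b2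
  rw [show (m : ZMod n) * m = m - 1 by linear_combination -h0] at c1 c2
  have e1 : (r 1 : DihedralGroup n) ^ m = r (m : ZMod n) := r_one_pow m
  have e2 : (r 1 : DihedralGroup n) ^ (1 - (m : ℤ)) = r (1 - m : ZMod n) := by
    rw [r_one_zpow]; push_cast; rfl
  have e3 : (r 1 : DihedralGroup n) ^ ((m : ℤ) - 1) = r (m - 1 : ZMod n) := by
    rw [r_one_zpow]; push_cast; rfl
  refine ⟨m, by lia, by lia, (ZMod.isUnit_iff_coprime m n).1 hmu, ?_, ?_, ?_, ?_⟩
  · rwa [e1]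
  · rwa [e2]
  · rwa [e1, e3]
  · rw [gcdMinDist, e1, e2, e3, even_iff_two_dvd]
    exact Nat.dvd_gcd (even_iff_two_dvd.1 a2)
      (Nat.dvd_gcd (even_iff_two_dvd.1 b2) (even_iff_two_dvd.1 c2))

end Main

end ProductOne

theorem theorem6p7 (n : ℕ) (hn : 3 ≤ n) (hodd : Odd n) :
    -- the elements `1` and `2n - 2`, and the bound for all other elements
    (({1, 2 * n - 2} : Set ℕ) ⊆ ProductOne.groupDeltaStarRho (DihedralGroup n) ∧
      ∀ d ∈ ProductOne.groupDeltaStarRho (DihedralGroup n), d ≠ 2 * n - 2 →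
        (d : ℝ) ≤ max 1 (((n : ℝ) - 1) / 4) ∨ (n = 7 ∧ d = 2)) ∧
    -- the gcd condition forces further elements
    ((∃ i : ℕ, 2 ≤ i ∧ i ≤ n - 1 ∧ Nat.gcd i n = 1 ∧
        Even (ProductOne.gcdMinDist (DihedralGroup.r 1 : DihedralGroup n) i)) →
      ({1, 2 * n - 2} : Set ℕ) ⊂ ProductOne.groupDeltaStarRho (DihedralGroup n)) ∧
    -- the gcd condition holds for `n = m² - m + 1`, with all three sets of distances non-empty
    (∀ m : ℕ, 3 ≤ m → Odd m → n = m ^ 2 - m + 1 →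
      ∃ i : ℕ, 2 ≤ i ∧ i ≤ n - 1 ∧ Nat.gcd i n = 1 ∧
        (ProductOne.groupDistSet
          {(DihedralGroup.r 1 : DihedralGroup n), DihedralGroup.r 1 ^ i}).Nonempty ∧
        (ProductOne.groupDistSet
          {(DihedralGroup.r 1 : DihedralGroup n), DihedralGroup.r 1 ^ (1 - (i : ℤ))}).Nonempty ∧
        (ProductOne.groupDistSet
          {(DihedralGroup.r 1 : DihedralGroup n) ^ i,
            DihedralGroup.r 1 ^ ((i : ℤ) - 1)}).Nonempty ∧
        Even (ProductOne.gcdMinDist (DihedralGroup.r 1 : DihedralGroup n) i)) := by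
  have : NeZero n := ⟨by lia⟩
  refine ⟨⟨?_, fun d hd hne => ?_⟩, ?_, fun m hm hmo hnm =>
    ProductOne.exists_even_gcdMinDist hodd hm hmo hnm⟩
  · rintro x (rfl | rfl)
    · exact ProductOne.one_mem_groupDeltaStarRho hodd hn
    · exact ProductOne.two_mul_sub_two_mem_groupDeltaStarRho hodd hn
  · rcases ProductOne.bound_of_mem_groupDeltaStarRho hodd hn hd hne with h | h | h
    · exact .inl (le_max_of_le_left (by exact_mod_cast h))
    · refine .inl (le_max_of_le_right ?_)
      have h' : ((4 * d + 1 : ℕ) : ℝ) ≤ n := by exact_mod_cast (by lia : 4 * d + 1 ≤ n)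
      push_cast at h'
      linarith
    · exact .inr h
  · rintro ⟨i, hi, hin, hco, he⟩
    exact ProductOne.ssubset_of_even_gcdMinDist hodd hn hi (by lia) hco he
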